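/- Let $k$ be a field of characteristic different from $2$, let $D$ be a central division algebra over $k$ of degree $n=2^d$ with $d\ge 1$ (so $\dim_k D=n^2$), and let $\sigma$ be a symplectic involution of $D$ (a $k$-linear anti-automorphism with $\sigma^2=\mathrm{id}$ which over a splitting field is adjoint to a nonsingular alternating form; in particular $D$ has exponent $2$). Let $X$ be the Severi–Brauer variety of $n$-dimensional left ideals of $D$: its points over a commutative $k$-algebra $R$ are, naturally in $R$, the left ideals of $R\otimes_k D$ which are direct summands of rank $n$ of this $R$-module. Let $F=k(X)$ and $\mathcal D=D\otimes_k\mathcal O_X$. Let $T\subset D\otimes_k F$ be the left ideal corresponding to the generic point of $X$, let $\mathcal T=T\cap\mathcal D$, a sheaf of left $\mathcal D$-modules, and let $\mathcal L_\sigma=(T\cap\sigma(T))\cap\mathcal D$. Let $\mathsf{Mod}_X$ be the category of locally free $\mathcal O_X$-modules of finite rank, with $\mathcal M^*=\mathcal{H}om(\mathcal M,\mathcal L_\sigma)$ and the evaluation maps $\varpi_{\mathcal M}\colon\mathcal M\to\mathcal M^{**}$. Let $\mathsf{Mod}_{\mathcal D}$ be the category of right $\mathcal D$-modules which are locally free of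 finite rank as $\mathcal O_X$-modules, with $\mathcal V^\sharp=\mathcal{H}om_{\mathcal D}(\mathcal V,\mathcal D)$, made into a right $\mathcal D$-module by $(f\cdot d)(y)=\sigma(d)f(y)$, and the maps $\pi_{\mathcal V}\colon\mathcal V\to\mathcal V^{\sharp\sharp}$, $\pi_{\mathcal V}(x)(f)=\sigma(f(x))$. For a category with duality as below, the Witt group $W$ is the Grothendieck group of isometry classes of symmetric spaces under orthogonal sum, modulo the subgroup generated by the metabolic spaces, i.e. the spaces $(S,\varphi)$ for which there is a morphism $\alpha\colon L\to S$ such that $0\to L\xrightarrow{\alpha}S\xrightarrow{\alpha^*\varphi}L^*\to0$ (with the dual in question in place of $*$) is an exact sequence. Put $W(X,\mathcal L_\sigma)=W(\mathsf{Mod}_X,*,\varpi)$ and $W^-(\mathcal D,\sigma)=W(\mathsf{Mod}_{\mathcal D},\sharp,-\pi)$. **Proposition 3.2.** The functors $*$ and $\sharp$ preserve $\mathsf{Mod}_X$ and $\mathsf{Mod}_{\mathcal D}$, all $\varpi_{\mathcal M}$ and $\pi_{\mathcal V}$ are isomorphisms, and $\Theta(\mathcal V)=\mathcal V\otimes_{\mathcal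 D}\mathcal T$ defines an equivalence of categories $\Theta\colon\mathsf{Mod}_{\mathcal D}\to\mathsf{Mod}_X$. There is a natural isomorphism $\theta\colon\Theta\circ\sharp\to *\circ\Theta$ such that $$\theta_{\mathcal V}(f\otimes t)(y\otimes t')=\sigma(t)\,f(y)\,t'$$ for all local sections $f$ of $\mathcal V^\sharp$, $y$ of $\mathcal V$ and $t,t'$ of $\mathcal T$, and $(\Theta,\theta)$ is a duality-preserving functor from $(\mathsf{Mod}_{\mathcal D},\sharp,-\pi)$ to $(\mathsf{Mod}_X,*,\varpi)$: $$\theta_{\mathcal V^\sharp}\circ(-\pi_{\mathcal V}\otimes\mathrm{id}_{\mathcal T})=(\theta_{\mathcal V})^*\circ\varpi_{\Theta(\mathcal V)}\qquad\text{for all }\mathcal V\text{ in }\mathsf{Mod}_{\mathcal D}.$$ There is an isomorphism of groups $$\mathsf{Mor}\colon W^-(\mathcal D,\sigma)\longrightarrow W(X,\mathcal L_\sigma)$$ which maps the Witt class of every space $(\mathcal V,\varphi)$ for $(\sharp,-\pi)$ to the Witt class of the space $(\mathcal V\otimes_{\mathcal D}\mathcal T,\ \theta_{\mathcal V}\circ(\varphi\otimes\mathrm{id}_{\mathcal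 T}))$. -/

import Mathlib

open CategoryTheory AlgebraicGeometry TopologicalSpace Opposite
open scoped TensorProduct

universe u

namespace SBWitt

noncomputable section

section Tools

variable {X : Scheme.{u}}

/-- Restriction of sections of an `O_X`-module to a smaller open set. -/
def res (M : X.Modules) {U V : X.Opens} (h : V ≤ U) : Γ(M, U) →+ Γ(M, V) :=
  (M.presheaf.map (homOfLE h).op).hom

/-- Restriction of regular functions to a smaller open set. -/
def resO {U V : X.Opens} (h : V ≤ U) : Γ(X, U) →+* Γ(X, V) :=
  (X.presheaf.map (homOfLE h).op).hom

theorem res_self (M : X.Modules) {U : X.Opens} (h : U ≤ U) (x : Γ(M, U)) : res M h x = x := by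
  simp [res]

theorem res_res (M : X.Modules) {U V W : X.Opens} (h : V ≤ U) (h' : W ≤ V) (x : Γ(M, U)) :
    res M h' (res M h x) = res M (h'.trans h) x := by
  have : (homOfLE (h'.trans h)).op = (homOfLE h).op ≫ (homOfLE h').op := rfl
  simp [res, this]

theorem resO_self {U : X.Opens} (h : U ≤ U) (x : Γ(X, U)) : resO h x = x := by
  simp [resO]

theorem resO_resO {U V W : X.Opens} (h : V ≤ U) (h' : W ≤ V) (x : Γ(X, U)) :
    resO h' (resO h x) = resO (h'.trans h) x := by
  have : (homOfLE (h'.trans h)).op = (homOfLE h).op ≫ (homOfLE h').op := rfl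
  simp [resO, this]

theorem res_smul (M : X.Modules) {U V : X.Opens} (h : V ≤ U) (r : Γ(X, U)) (x : Γ(M, U)) :
    res M h (r • x) = resO h r • res M h x :=
  Scheme.Modules.map_smul M (homOfLE h) r x

/-- A morphism of `O_X`-modules, on sections over an open set. -/
def sec {M N : X.Modules} (f : M ⟶ N) (U : X.Opens) : Γ(M, U) →ₗ[Γ(X, U)] Γ(N, U) where
  toFun := f.app U
  map_add' := by simp
  map_smul' r x := Scheme.Modules.Hom.app_smul f r x

theorem sec_res {M N : X.Modules} (f : M ⟶ N) {U V : X.Opens} (h : V ≤ U) (x : Γ(M, U)) :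
    sec f V (res M h x) = res N h (sec f U x) :=
  PresheafOfModules.naturality_apply f.val (homOfLE h).op x

theorem sec_ext {M N : X.Modules} {f g : M ⟶ N} (h : ∀ U x, sec f U x = sec g U x) : f = g := by
  apply Scheme.Modules.hom_ext
  intro U
  ext x
  exact h U x

@[simp] theorem sec_id (M : X.Modules) (U : X.Opens) (x : Γ(M, U)) : sec (𝟙 M) U x = x := rfl
@[simp] theorem sec_comp {M N P : X.Modules} (f : M ⟶ N) (g : N ⟶ P) (U : X.Opens) (x : Γ(M, U)) :
    sec (f ≫ g) U x = sec g U (sec f U x) := rfl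
@[simp] theorem sec_add {M N : X.Modules} (f g : M ⟶ N) (U : X.Opens) (x : Γ(M, U)) :
    sec (f + g) U x = sec f U x + sec g U x := rfl
@[simp] theorem sec_neg {M N : X.Modules} (f : M ⟶ N) (U : X.Opens) (x : Γ(M, U)) :
    sec (-f) U x = - sec f U x := rfl
@[simp] theorem sec_zero {M N : X.Modules} (U : X.Opens) (x : Γ(M, U)) :
    sec (0 : M ⟶ N) U x = 0 := rfl

/-- A morphism of `O_X`-modules given by compatible linear maps on sections. -/
def homMk {M N : X.Modules} (f : ∀ U : X.Opens, Γ(M, U) →ₗ[Γ(X, U)] Γ(N, U))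
    (hf : ∀ {U V : X.Opens} (h : V ≤ U) (x : Γ(M, U)), f V (res M h x) = res N h (f U x)) :
    M ⟶ N :=
  SheafOfModules.Hom.mk (PresheafOfModules.homMk
    { app := fun U => AddCommGrpCat.ofHom (f U.unop).toAddMonoidHom
      naturality := fun U V i => by
        ext x
        exact hf i.unop.le x }
    (fun U r x => (f U.unop).map_smul r x))

@[simp] theorem sec_homMk {M N : X.Modules} (f : ∀ U : X.Opens, Γ(M, U) →ₗ[Γ(X, U)] Γ(N, U))
    (hf) (U : X.Opens) (x : Γ(M, U)) : sec (homMk f hf) U x = f U x := rfl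

/-- The presheaf of abelian groups underlying `preMk`. -/
def preAb (S : X.Opens → Type u) [∀ U, AddCommGroup (S U)]
    (r : ∀ {U V : X.Opens}, V ≤ U → S U →+ S V)
    (r_self : ∀ {U : X.Opens} (h : U ≤ U) (x : S U), r h x = x)
    (r_r : ∀ {U V W : X.Opens} (h : V ≤ U) (h' : W ≤ V) (x : S U),
      r h' (r h x) = r (h'.trans h) x) : X.Opensᵒᵖ ⥤ Ab.{u} where
  obj U := AddCommGrpCat.of (S U.unop)
  map i := AddCommGrpCat.ofHom (r i.unop.le)
  map_id U := by ext x; exact r_self _ x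
  map_comp i j := by ext x; exact (r_r i.unop.le j.unop.le x).symm

/-- A presheaf of modules given by explicit sections and restriction maps. -/
def preMk (S : X.Opens → Type u) [∀ U, AddCommGroup (S U)] [m : ∀ U, Module Γ(X, U) (S U)]
    (r : ∀ {U V : X.Opens}, V ≤ U → S U →+ S V)
    (r_self : ∀ {U : X.Opens} (h : U ≤ U) (x : S U), r h x = x)
    (r_r : ∀ {U V W : X.Opens} (h : V ≤ U) (h' : W ≤ V) (x : S U),
      r h' (r h x) = r (h'.trans h) x)
    (r_smul : ∀ {U V : X.Opens} (h : V ≤ U) (a : Γ(X, U)) (x : S U),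
      r h (a • x) = resO h a • r h x) : X.PresheafOfModules :=
  @PresheafOfModules.ofPresheaf _ _ X.ringCatSheaf.obj (preAb S r r_self r_r)
    (fun U => m U.unop) (fun _ _ i a x => r_smul i.unop.le a x)

/-- An `O_X`-module given by explicit sections and restriction maps which satisfy the
sheaf condition. -/
def modMk (S : X.Opens → Type u) [∀ U, AddCommGroup (S U)] [∀ U, Module Γ(X, U) (S U)]
    (r : ∀ {U V : X.Opens}, V ≤ U → S U →+ S V)
    (r_self : ∀ {U : X.Opens} (h : U ≤ U) (x : S U), r h x = x)
    (r_r : ∀ {U V W : X.Opens} (h : V ≤ U) (h' : W ≤ V) (x : S U),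
      r h' (r h x) = r (h'.trans h) x)
    (r_smul : ∀ {U V : X.Opens} (h : V ≤ U) (a : Γ(X, U)) (x : S U),
      r h (a • x) = resO h a • r h x)
    (glue : ∀ {ι : Type u} (U : ι → X.Opens) (s : ∀ i, S (U i)),
      (∀ i j, r (inf_le_left : U i ⊓ U j ≤ U i) (s i) =
        r (inf_le_right : U i ⊓ U j ≤ U j) (s j)) →
      ∃! t : S (iSup U), ∀ i, r (le_iSup U i) t = s i) : X.Modules where
  val := preMk S r r_self r_r r_smul
  isSheaf := by
    change TopCat.Presheaf.IsSheaf (preMk S r r_self r_r r_smul).presheaf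
    rw [TopCat.Presheaf.isSheaf_iff_isSheaf_comp (forget Ab)]
    apply TopCat.Presheaf.isSheaf_of_isSheafUniqueGluing_types
    intro ι U s hs
    exact glue U s hs

theorem glue (M : X.Modules) {ι : Type u} (U : ι → X.Opens) (s : ∀ i, Γ(M, U i))
    (h : ∀ i j, res M (inf_le_left : U i ⊓ U j ≤ U i) (s i) =
        res M (inf_le_right : U i ⊓ U j ≤ U j) (s j)) :
    ∃! t : Γ(M, iSup U), ∀ i, res M (le_iSup U i) t = s i :=
  TopCat.Sheaf.existsUnique_gluing ⟨M.presheaf, M.isSheaf⟩ U s h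

theorem glueO {ι : Type u} (U : ι → X.Opens) (s : ∀ i, Γ(X, U i))
    (h : ∀ i j, resO (inf_le_left : U i ⊓ U j ≤ U i) (s i) =
        resO (inf_le_right : U i ⊓ U j ≤ U j) (s j)) :
    ∃! t : Γ(X, iSup U), ∀ i, resO (le_iSup U i) t = s i :=
  TopCat.Sheaf.existsUnique_gluing X.sheaf U s h

/-- Sections of an `O_X`-module which agree locally are equal. -/
theorem eq_of_local (M : X.Modules) {U : X.Opens} (s t : Γ(M, U))
    (h : ∀ x ∈ U, ∃ V : X.Opens, ∃ hV : V ≤ U, x ∈ V ∧ res M hV s = res M hV t) : s = t := by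
  choose! V hV hx e using h
  exact TopCat.Sheaf.eq_of_locally_eq' ⟨M.presheaf, M.isSheaf⟩ (fun x : U => V x) U
    (fun x => homOfLE (hV x x.2))
    (fun x hxU => TopologicalSpace.Opens.mem_iSup.2 ⟨⟨x, hxU⟩, hx x hxU⟩) s t
    (fun x => e x x.2)

/-- Gluing of sections over an open cover of a given open set. -/
theorem glue' (M : X.Modules) {ι : Type u} {V : X.Opens} (U : ι → X.Opens) (hU : ∀ i, U i ≤ V)
    (hV : V ≤ iSup U) (s : ∀ i, Γ(M, U i))
    (h : ∀ i j, res M (inf_le_left : U i ⊓ U j ≤ U i) (s i) =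
        res M (inf_le_right : U i ⊓ U j ≤ U j) (s j)) :
    ∃ t : Γ(M, V), ∀ i, res M (hU i) t = s i :=
  (TopCat.Sheaf.existsUnique_gluing' ⟨M.presheaf, M.isSheaf⟩ U V (fun i => homOfLE (hU i))
    hV s h).exists

section SubSheaf

variable (M : X.Modules) (P : ∀ U : X.Opens, Submodule Γ(X, U) Γ(M, U))
  (hres : ∀ {U V : X.Opens} (h : V ≤ U) (x : Γ(M, U)), x ∈ P U → res M h x ∈ P V)
  (hloc : ∀ {U : X.Opens} (x : Γ(M, U)),
    (∀ p ∈ U, ∃ V : X.Opens, ∃ hV : V ≤ U, p ∈ V ∧ res M hV x ∈ P V) → x ∈ P U)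

/-- The subsheaf of an `O_X`-module given by a local condition on sections. -/
def subMk : X.Modules :=
  modMk (fun U => P U)
    (fun {U V} h =>
      { toFun := fun x => ⟨res M h x.1, hres h x.1 x.2⟩
        map_zero' := Subtype.ext (map_zero (res M h))
        map_add' := fun x y => Subtype.ext (map_add (res M h) x.1 y.1) })
    (fun h x => Subtype.ext (res_self M h x.1))
    (fun h h' x => Subtype.ext (res_res M h h' x.1))
    (fun h a x => Subtype.ext (res_smul M h a x.1))
    (by
      intro ι U s hs
      obtain ⟨t, ht, htu⟩ := glue M U (fun i => (s i).1) (fun i j => congrArg Subtype.val (hs i j))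
      refine ⟨⟨t, hloc t ?_⟩, fun i => Subtype.ext (ht i), ?_⟩
      · intro p hp
        obtain ⟨i, hi⟩ := TopologicalSpace.Opens.mem_iSup.1 hp
        exact ⟨U i, le_iSup U i, hi, by rw [ht i]; exact (s i).2⟩
      · intro t' ht'
        exact Subtype.ext (htu t'.1 (fun i => congrArg Subtype.val (ht' i))))

/-- The inclusion of a subsheaf. -/
def subι : subMk M P hres hloc ⟶ M :=
  homMk (M := subMk M P hres hloc) (fun U => (P U).subtype) (fun _ _ => rfl)

theorem res_subMk {U V : X.Opens} (h : V ≤ U) (x : Γ(subMk M P hres hloc, U)) :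
    (res (subMk M P hres hloc) h x : P V).1 = res M h (x : P U).1 := rfl

end SubSheaf

section HomSheaf

variable (M N : X.Modules)

/-- Morphisms of `O_U`-modules from `M|_U` to `N|_U`: families of linear maps
`M(V) → N(V)`, for `V ⊆ U` open, which are compatible with restrictions. -/
def LocHom (U : X.Opens) :
    AddSubgroup (∀ V : {V : X.Opens // V ≤ U}, Γ(M, V.1) →ₗ[Γ(X, V.1)] Γ(N, V.1)) where
  carrier := {f | ∀ (V W : {V : X.Opens // V ≤ U}) (h : W.1 ≤ V.1) (x : Γ(M, V.1)),
    f W (res M h x) = res N h (f V x)}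
  zero_mem' := fun V W h x => by simp
  add_mem' := fun {f g} hf hg V W h x => by simp [hf V W h x, hg V W h x]
  neg_mem' := fun {f} hf V W h x => by simp [hf V W h x]

variable {M N}

theorem LocHom.ext {U : X.Opens} {f g : LocHom M N U} (h : ∀ V x, f.1 V x = g.1 V x) : f = g :=
  Subtype.ext (funext fun V => LinearMap.ext (h V))

instance (U : X.Opens) : SMul Γ(X, U) (LocHom M N U) where
  smul a f := ⟨fun V => resO V.2 a • f.1 V, fun V W h x => by
    simp only [LinearMap.smul_apply, f.2 V W h x, res_smul, resO_resO]⟩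

theorem LocHom.smul_apply {U : X.Opens} (a : Γ(X, U)) (f : LocHom M N U)
    (V : {V : X.Opens // V ≤ U}) (x : Γ(M, V.1)) : (a • f).1 V x = resO V.2 a • f.1 V x := rfl

theorem LocHom.add_apply {U : X.Opens} (f g : LocHom M N U)
    (V : {V : X.Opens // V ≤ U}) (x : Γ(M, V.1)) : (f + g).1 V x = f.1 V x + g.1 V x := rfl

theorem LocHom.zero_apply {U : X.Opens}
    (V : {V : X.Opens // V ≤ U}) (x : Γ(M, V.1)) : (0 : LocHom M N U).1 V x = 0 := rfl

instance (U : X.Opens) : Module Γ(X, U) (LocHom M N U) where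
  one_smul f := LocHom.ext fun V x => by simp [LocHom.smul_apply]
  mul_smul a b f := LocHom.ext fun V x => by simp [LocHom.smul_apply, mul_smul]
  smul_zero a := LocHom.ext fun V x => by simp [LocHom.smul_apply]
  smul_add a f g := LocHom.ext fun V x => by simp [LocHom.smul_apply]
  add_smul a b f := LocHom.ext fun V x => by
    simp [LocHom.smul_apply, add_smul]
  zero_smul f := LocHom.ext fun V x => by simp [LocHom.smul_apply]

/-- Restriction of local morphisms to a smaller open set. -/
def LocHom.restrict {U V : X.Opens} (h : V ≤ U) : LocHom M N U →+ LocHom M N V where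
  toFun f := ⟨fun W => f.1 ⟨W.1, W.2.trans h⟩, fun W W' h' x =>
    f.2 ⟨W.1, W.2.trans h⟩ ⟨W'.1, W'.2.trans h⟩ h' x⟩
  map_zero' := rfl
  map_add' _ _ := rfl

variable (M N)

/-- The sheaf of homomorphisms between two `O_X`-modules. -/
def homSheaf : X.Modules :=
  modMk (fun U => LocHom M N U) LocHom.restrict (fun _ _ => rfl) (fun _ _ _ => rfl)
    (fun h a f => LocHom.ext fun V x => by
      change resO (V.2.trans h) a • f.1 ⟨V.1, V.2.trans h⟩ x = resO V.2 (resO h a) • f.1 ⟨V.1, V.2.trans h⟩ x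
      rw [resO_resO])
    (by
      intro ι U s hs
      have key : ∀ (V : {V : X.Opens // V ≤ iSup U}) (x : Γ(M, V.1)), ∃ y : Γ(N, V.1),
          ∀ (i : ι) (W : X.Opens) (hW : W ≤ V.1) (hi : W ≤ U i),
            res N hW y = (s i).1 ⟨W, hi⟩ (res M hW x) := by
        intro V x
        obtain ⟨y, hy⟩ := glue' N (V := V.1) (fun i => V.1 ⊓ U i) (fun i => inf_le_left)
          (by rw [← inf_iSup_eq]; exact le_inf le_rfl V.2)
          (fun i => (s i).1 ⟨V.1 ⊓ U i, inf_le_right⟩ (res M inf_le_left x))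
          (by
            intro i j
            dsimp only
            rw [← (s i).2 ⟨V.1 ⊓ U i, inf_le_right⟩
                ⟨V.1 ⊓ U i ⊓ (V.1 ⊓ U j), inf_le_left.trans inf_le_right⟩ inf_le_left,
              ← (s j).2 ⟨V.1 ⊓ U j, inf_le_right⟩
                ⟨V.1 ⊓ U i ⊓ (V.1 ⊓ U j), inf_le_right.trans inf_le_right⟩ inf_le_right,
              res_res, res_res]
            have := congrArg (fun f => f.1 ⟨V.1 ⊓ U i ⊓ (V.1 ⊓ U j),
              le_inf (inf_le_left.trans inf_le_right) (inf_le_right.trans inf_le_right)⟩) (hs i j)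
            exact LinearMap.congr_fun this _)
        refine ⟨y, fun i W hW hi => ?_⟩
        have h1 := hy i
        rw [← res_res N (inf_le_left : V.1 ⊓ U i ≤ V.1) (le_inf hW hi), h1,
          ← (s i).2 ⟨V.1 ⊓ U i, inf_le_right⟩ ⟨W, hi⟩ (le_inf hW hi), res_res]
      have uniq : ∀ (V : {V : X.Opens // V ≤ iSup U}) (y y' : Γ(N, V.1)),
          (∀ (i : ι) (W : X.Opens) (hW : W ≤ V.1) (_ : W ≤ U i), res N hW y = res N hW y') →
            y = y' := by
        intro V y y' h
        apply eq_of_local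
        intro p hp
        obtain ⟨i, hi⟩ := TopologicalSpace.Opens.mem_iSup.1 (V.2 hp)
        exact ⟨V.1 ⊓ U i, inf_le_left, ⟨hp, hi⟩, h i _ inf_le_left inf_le_right⟩
      choose f hf using key
      refine ⟨⟨fun V => { toFun := f V, map_add' := ?_, map_smul' := ?_ }, ?_⟩, ?_, ?_⟩
      · intro x y
        refine uniq V _ _ fun i W hW hi => ?_
        rw [map_add, hf V _ i W hW hi, hf V _ i W hW hi, hf V _ i W hW hi, map_add, map_add]
      · intro a x
        refine uniq V _ _ fun i W hW hi => ?_
        rw [RingHom.id_apply, res_smul, hf V _ i W hW hi, hf V _ i W hW hi, res_smul, map_smul]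
      · intro V V' h x
        refine uniq V' _ _ fun i W hW hi => ?_
        change res N hW (f V' _) = res N hW (res N h (f V x))
        rw [res_res, hf V' _ i W hW hi, hf V _ i W (hW.trans h) hi, res_res]
      · intro i
        refine LocHom.ext fun V x => ?_
        change f ⟨V.1, _⟩ x = _
        have := hf ⟨V.1, V.2.trans (le_iSup U i)⟩ x i V.1 le_rfl V.2
        rwa [res_self, res_self] at this
      · intro g hg
        refine LocHom.ext fun V x => uniq V _ _ fun i W hW hi => ?_
        change _ = res N hW (f V x)
        rw [hf V x i W hW hi, ← g.2 V ⟨W, hW.trans V.2⟩ hW, ← hg i]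
        rfl)

variable {M N}

/-- The value of a section of the sheaf of homomorphisms over `U` on a section over `V ⊆ U`. -/
def ev {U : X.Opens} (f : Γ(homSheaf M N, U)) {V : X.Opens} (h : V ≤ U) :
    Γ(M, V) →ₗ[Γ(X, V)] Γ(N, V) := (f : LocHom M N U).1 ⟨V, h⟩

theorem ev_res {U V W : X.Opens} (f : Γ(homSheaf M N, U)) (h : V ≤ U) (h' : W ≤ V) (x : Γ(M, W)) :
    ev (res (homSheaf M N) h f) h' x = ev f (h'.trans h) x := rfl

theorem res_ev {U V W : X.Opens} (f : Γ(homSheaf M N, U)) (h : V ≤ U) (h' : W ≤ V) (x : Γ(M, V)) :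
    ev f (h'.trans h) (res M h' x) = res N h' (ev f h x) :=
  (f : LocHom M N U).2 ⟨V, h⟩ ⟨W, h'.trans h⟩ h' x

theorem ev_ext {U : X.Opens} {f g : Γ(homSheaf M N, U)}
    (h : ∀ (V : X.Opens) (hV : V ≤ U) (x : Γ(M, V)), ev f hV x = ev g hV x) : f = g :=
  LocHom.ext fun V x => h V.1 V.2 x

theorem ev_add {U V : X.Opens} (f g : Γ(homSheaf M N, U)) (h : V ≤ U) (x : Γ(M, V)) :
    ev (f + g) h x = ev f h x + ev g h x := rfl

theorem ev_smul {U V : X.Opens} (a : Γ(X, U)) (f : Γ(homSheaf M N, U)) (h : V ≤ U)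
    (x : Γ(M, V)) : ev (a • f) h x = resO h a • ev f h x := rfl

/-- A section over `U` of the sheaf of homomorphisms. -/
def evMk {U : X.Opens} (f : ∀ V : X.Opens, V ≤ U → (Γ(M, V) →ₗ[Γ(X, V)] Γ(N, V)))
    (hf : ∀ {V W : X.Opens} (hV : V ≤ U) (h : W ≤ V) (x : Γ(M, V)),
      f W (h.trans hV) (res M h x) = res N h (f V hV x)) : Γ(homSheaf M N, U) :=
  (⟨fun V => f V.1 V.2, fun V _ h x => hf V.2 h x⟩ : LocHom M N U)

@[simp] theorem ev_evMk {U V : X.Opens} (f : ∀ V : X.Opens, V ≤ U → (Γ(M, V) →ₗ[Γ(X, V)] Γ(N, V)))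
    (hf) (h : V ≤ U) (x : Γ(M, V)) : ev (evMk f hf) h x = f V h x := rfl

end HomSheaf

end Tools

section Algebras

variable {k : Type u} [Field k] {X : Scheme.{u}} [X.Over (Spec (.of k))]

/-- The homomorphism from `k` to the regular functions on an open set of a `k`-scheme `X`. -/
def kToO (U : X.Opens) : k →+* Γ(X, U) :=
  (resO (le_top : U ≤ ⊤)).comp
    ((X ↘ Spec (.of k)).appTop.hom.comp (Scheme.ΓSpecIso (.of k)).inv.hom)

instance instAlgebraSections (U : X.Opens) : Algebra k Γ(X, U) := (kToO U).toAlgebra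

instance instAlgebraStalk (x : X) : Algebra k (X.presheaf.stalk x) :=
  ((X.presheaf.germ ⊤ x trivial).hom.comp (kToO (k := k) (⊤ : X.Opens))).toAlgebra

/-- Restriction of regular functions, as a homomorphism of `k`-algebras. -/
def resA {U V : X.Opens} (h : V ≤ U) : Γ(X, U) →ₐ[k] Γ(X, V) where
  toRingHom := resO h
  commutes' _ := resO_resO _ _ _

/-- Taking germs, as a homomorphism of `k`-algebras. -/
def germA (U : X.Opens) (x : X) (h : x ∈ U) : Γ(X, U) →ₐ[k] X.presheaf.stalk x where
  toRingHom := (X.presheaf.germ U x h).hom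
  commutes' _ := (X.presheaf.germ_res_apply (homOfLE le_top) x h _).trans
    (X.presheaf.germ_res_apply (homOfLE le_top) x (TopologicalSpace.Opens.mem_top x) _).symm

variable (D : Type u) [Ring D] [Algebra k D]

/-- Extension of scalars `R ⊗ D → S ⊗ D` along a homomorphism of commutative `k`-algebras. -/
abbrev ext {R S : Type u} [CommRing R] [Algebra k R] [CommRing S] [Algebra k S]
    (f : R →ₐ[k] S) : R ⊗[k] D →ₐ[k] S ⊗[k] D :=
  Algebra.TensorProduct.map f (AlgHom.id k D)

theorem ext_smul {R S : Type u} [CommRing R] [Algebra k R] [CommRing S] [Algebra k S]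
    (f : R →ₐ[k] S) (a : R) (x : R ⊗[k] D) : ext D f (a • x) = f a • ext D f x := by
  induction x with
  | zero => simp
  | tmul r d => simp [TensorProduct.smul_tmul']
  | add x y hx hy => simp only [smul_add, map_add, hx, hy]

theorem ext_ext {R S T : Type u} [CommRing R] [Algebra k R] [CommRing S] [Algebra k S]
    [CommRing T] [Algebra k T] (f : R →ₐ[k] S) (g : S →ₐ[k] T) (x : R ⊗[k] D) :
    ext D g (ext D f x) = ext D (g.comp f) x := by
  induction x with
  | zero => simp
  | tmul r d => simp
  | add x y hx hy => simp only [map_add, hx, hy]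

theorem repr_ext {ι : Type*} (b : Module.Basis ι k D) {R S : Type u} [CommRing R] [Algebra k R]
    [CommRing S] [Algebra k S] (f : R →ₐ[k] S) (x : R ⊗[k] D) (i : ι) :
    (Algebra.TensorProduct.basis S b).repr (ext D f x) i =
      f ((Algebra.TensorProduct.basis R b).repr x i) := by
  induction x with
  | zero => simp
  | tmul r d => simp [Algebra.TensorProduct.basis_repr_tmul]
  | add x y hx hy => simp only [map_add, Finsupp.add_apply, hx, hy]

variable (k X) [FiniteDimensional k D]

/-- The sheaf `D ⊗ O_X`. -/
def sheafD : X.Modules :=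
  modMk (fun U => Γ(X, U) ⊗[k] D) (fun h => (ext D (resA h)).toRingHom.toAddMonoidHom)
    (fun h x => by
      change ext D (resA h) x = x
      have : resA (k := k) h = AlgHom.id k _ := AlgHom.ext fun y => resO_self h y
      rw [this]
      simp [ext])
    (fun h h' x => by
      change ext D (resA h') (ext D (resA h) x) = ext D (resA (h'.trans h)) x
      rw [ext_ext]
      congr 1
      congr 1
      exact AlgHom.ext fun y => resO_resO h h' y)
    (fun h a x => ext_smul D (resA h) a x)
    (by
      intro ι U s hs
      let b := Module.finBasis k D
      have h1 : ∀ j, ∃! t : Γ(X, iSup U), ∀ i, resO (le_iSup U i) t =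
          (Algebra.TensorProduct.basis Γ(X, U i) b).repr (s i) j := fun j =>
        glueO U (fun i => (Algebra.TensorProduct.basis Γ(X, U i) b).repr (s i) j) (fun i i' => by
          have := congrArg (fun z => (Algebra.TensorProduct.basis _ b).repr z j) (hs i i')
          change (Algebra.TensorProduct.basis _ b).repr (ext D (resA _) (s i)) j =
            (Algebra.TensorProduct.basis _ b).repr (ext D (resA _) (s i')) j at this
          rwa [repr_ext, repr_ext] at this)
      choose t ht htu using h1
      refine ⟨(Algebra.TensorProduct.basis Γ(X, iSup U) b).equivFun.symm t, fun i => ?_,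
        fun t' ht' => ?_⟩
      · change ext D (resA _) _ = _
        apply (Algebra.TensorProduct.basis Γ(X, U i) b).ext_elem
        intro j
        rw [repr_ext]
        have : (Algebra.TensorProduct.basis Γ(X, iSup U) b).repr
            ((Algebra.TensorProduct.basis Γ(X, iSup U) b).equivFun.symm t) j = t j := by
          rw [← Module.Basis.equivFun_apply, LinearEquiv.apply_symm_apply]
        rw [this]
        exact ht j i
      · apply (Algebra.TensorProduct.basis Γ(X, iSup U) b).equivFun.injective
        rw [LinearEquiv.apply_symm_apply]
        funext j
        apply htu j
        intro i
        rw [Module.Basis.equivFun_apply, ← ht' i]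
        exact (repr_ext D b (resA (le_iSup U i)) t' j).symm)

variable {X}

/-- Sections of the sheaf `D ⊗ O_X`, as elements of an algebra. -/
def val {U : X.Opens} (x : Γ(sheafD k X D, U)) : Γ(X, U) ⊗[k] D := x

theorem val_res {U V : X.Opens} (h : V ≤ U) (x : Γ(sheafD k X D, U)) :
    val k D (res (sheafD k X D) h x) = ext D (resA h) (val k D x) := rfl

end Algebras

section SeveriBrauer

variable (k : Type u) [Field k] (D : Type u) [Ring D] [Algebra k D] (n : ℕ)

/-- For a commutative `k`-algebra `R`, the left ideals of `R ⊗ D` which are direct summands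
of rank `n` as `R`-modules. -/
def LeftIdeals (R : Type u) [CommRing R] [Algebra k R] : Type u :=
  {I : Ideal (R ⊗[k] D) // (∃ J : Submodule R (R ⊗[k] D), IsCompl (I.restrictScalars R) J) ∧
    ∀ p : PrimeSpectrum R, Module.rankAtStalk (R := R) (I.restrictScalars R) p = n}

/-- The set of `R`-points of a `k`-scheme. -/
def Points (X : Scheme.{u}) [X.Over (Spec (.of k))] (R : Type u) [CommRing R] [Algebra k R] :
    Type u :=
  {f : Spec (.of R) ⟶ X // f ≫ (X ↘ Spec (.of k)) = Spec.map (CommRingCat.ofHom (algebraMap k R))}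

/-- The structure of a Severi-Brauer variety of `n`-dimensional left ideals of `D` on a
`k`-scheme `X`: for every commutative `k`-algebra `R`, a bijection between the `R`-points of `X`
and the left ideals of `R ⊗ D` which are direct summands of rank `n`, compatible with
extension of scalars. -/
structure SeveriBrauer (X : Scheme.{u}) [X.Over (Spec (.of k))] where
  equiv (R : Type u) [CommRing R] [Algebra k R] : Points k X R ≃ LeftIdeals k D n R
  equiv_map {R S : Type u} [CommRing R] [Algebra k R] [CommRing S] [Algebra k S] (g : R →ₐ[k] S)
    (f : Points k X R) (f' : Points k X S)
    (h : f'.1 = Spec.map (CommRingCat.ofHom g.toRingHom) ≫ f.1) :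
    (equiv S f').1 = (equiv R f).1.map (ext D g)

variable {X : Scheme.{u}} [X.Over (Spec (.of k))] [IsIntegral X]

/-- The generic point of `X`, as a point over the function field of `X`. -/
def genericPt : Points k X X.functionField :=
  ⟨X.fromSpecStalk (genericPoint X), by
    apply ext_of_isAffine
    have hφ : CommRingCat.ofHom (algebraMap k X.functionField) =
        (Scheme.ΓSpecIso (.of k)).inv ≫ (X ↘ Spec (.of k)).appTop ≫
          X.presheaf.germ ⊤ (genericPoint X) trivial := by
      ext c
      exact congrArg (X.presheaf.germ ⊤ (genericPoint X) trivial).hom (resO_self _ _)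
    have hid : ((Spec X.functionField).presheaf.map
        (homOfLE (le_top : (⊤ : (Spec X.functionField).Opens) ≤ ⊤)).op) = 𝟙 _ :=
      (Spec X.functionField).presheaf.map_id _
    rw [Scheme.Hom.comp_appTop, Scheme.fromSpecStalk_appTop,
      ← cancel_epi (Scheme.ΓSpecIso (.of k)).inv]
    refine Eq.trans ?_ (Scheme.ΓSpecIso_inv_naturality _)
    rw [hφ, hid, Category.comp_id]
    simp only [Category.assoc]
    rfl⟩

variable {k D n}

/-- The left ideal `T` over the function field defined by the generic point. -/
def idealT (sb : SeveriBrauer k D n X) : Ideal (X.functionField ⊗[k] D) :=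
  (sb.equiv X.functionField (genericPt k)).1

end SeveriBrauer

section Intersections

variable {k : Type u} [Field k] {D : Type u} [Ring D] [Algebra k D] [FiniteDimensional k D]
  {X : Scheme.{u}} [X.Over (Spec (.of k))]

theorem ext_germ_res {U V : X.Opens} (h : V ≤ U) (x : X) (hx : x ∈ V) (s : Γ(sheafD k X D, U)) :
    ext D (germA V x hx) (val k D (res _ h s)) = ext D (germA U x (h hx)) (val k D s) := by
  rw [val_res, ext_ext]
  congr 1
  congr 1
  exact AlgHom.ext fun y => X.presheaf.germ_res_apply (homOfLE h) x hx y

variable [IsIntegral X]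

/-- For an `F`-subspace `W` of `F ⊗ D`, where `F` is the function field of `X`, the sections over
`U` of the intersection of `W` and `D ⊗ O_X` in `F ⊗ D`. -/
def interSections (W : Submodule X.functionField (X.functionField ⊗[k] D)) (U : X.Opens) :
    Submodule Γ(X, U) Γ(sheafD k X D, U) where
  carrier := {s | ∀ h : genericPoint X ∈ U, ext D (germA U _ h) (val k D s) ∈ W}
  zero_mem' := fun h => by
    rw [show val k D (0 : Γ(sheafD k X D, U)) = 0 from rfl, map_zero]
    exact W.zero_mem
  add_mem' := fun {s t} hs ht h => by
    rw [show val k D (s + t) = val k D s + val k D t from rfl, map_add]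
    exact W.add_mem (hs h) (ht h)
  smul_mem' := fun a s hs h => by
    rw [show val k D (a • s) = a • val k D s from rfl, ext_smul]
    exact W.smul_mem _ (hs h)

/-- The sheaf `W ∩ (D ⊗ O_X)`, for an `F`-subspace `W` of `F ⊗ D`. -/
def inter (W : Submodule X.functionField (X.functionField ⊗[k] D)) : X.Modules :=
  subMk (sheafD k X D) (interSections W)
    (fun {U V} h x hx hV => by
      rw [ext_germ_res h _ hV x]
      exact hx (h hV))
    (fun {U} x hx hU => by
      obtain ⟨V, hV, hp, hm⟩ := hx _ hU
      rw [← ext_germ_res hV _ hp x]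
      exact hm hp)

/-- A section of `W ∩ (D ⊗ O_X)` over `U`, as an element of `O_X(U) ⊗ D`. -/
def interVal {W : Submodule X.functionField (X.functionField ⊗[k] D)} {U : X.Opens}
    (s : Γ(inter W, U)) : Γ(X, U) ⊗[k] D := (s : interSections W U).1

variable {n : ℕ} (sb : SeveriBrauer k D n X) (σ : D →ₗ[k] D)

/-- The generic point of `X`, as a subspace of `F ⊗ D`. -/
def spaceT : Submodule X.functionField (X.functionField ⊗[k] D) :=
  (idealT sb).restrictScalars X.functionField

/-- The subspace `T ∩ σ(T)` of `F ⊗ D`. -/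
def spaceL : Submodule X.functionField (X.functionField ⊗[k] D) :=
  spaceT sb ⊓ (spaceT sb).map (σ.baseChange X.functionField)

/-- The sheaf `𝒯 = T ∩ (D ⊗ O_X)`. -/
def sheafT : X.Modules := inter (spaceT sb)

/-- The sheaf `ℒ_σ = (T ∩ σ(T)) ∩ (D ⊗ O_X)`. -/
def sheafL : X.Modules := inter (spaceL sb σ)

/-- The action of `D` on `𝒯` by multiplication on the left. -/
def leftAct (d : D) : sheafT sb ⟶ sheafT sb :=
  homMk (M := sheafT sb) (N := sheafT sb)
    (fun U =>
      { toFun := fun s => (⟨((1 : Γ(X, U)) ⊗ₜ[k] d * interVal s : Γ(X, U) ⊗[k] D), fun h => by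
          have := (s : interSections (spaceT sb) U).2 h
          change ext D (germA U _ h) (_ * interVal s) ∈ idealT sb
          rw [map_mul]
          exact (idealT sb).mul_mem_left _ this⟩ : interSections (spaceT sb) U)
        map_add' := fun s t => Subtype.ext (mul_add _ (interVal s) (interVal t))
        map_smul' := fun a s => Subtype.ext (mul_smul_comm a _ (interVal s)) })
    (fun {U V} h s => Subtype.ext (by
      change 1 ⊗ₜ[k] d * ext D (resA h) (interVal s) = ext D (resA h) (1 ⊗ₜ[k] d * interVal s)
      rw [map_mul]
      simp [ext]))

end Intersections

section RightModules

variable (k : Type u) [Field k] (D : Type u) [Ring D] [Algebra k D]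
  (X : Scheme.{u}) [X.Over (Spec (.of k))]

/-- `O_X`-modules with an action of the `k`-algebra `D` on the right, that is, right modules over
`D ⊗ O_X`. -/
structure RMod where
  /-- the underlying `O_X`-module -/
  mod : X.Modules
  /-- the action `v ↦ v * d` of elements of `D` -/
  act : D → (mod ⟶ mod)
  act_add (a b : D) : act (a + b) = act a + act b
  act_one : act 1 = 𝟙 mod
  act_mul (a b : D) : act (a * b) = act a ≫ act b
  act_algebraMap (c : k) (U : X.Opens) (v : Γ(mod, U)) :
    sec (act (algebraMap k D c)) U v = algebraMap k Γ(X, U) c • v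

variable {k D X}

/-- Morphisms of `O_X`-modules which commute with the action of `D`. -/
@[ext]
structure RMod.Hom (V W : RMod k D X) where
  hom : V.mod ⟶ W.mod
  comm (d : D) : V.act d ≫ hom = hom ≫ W.act d

instance : Category (RMod k D X) where
  Hom := RMod.Hom
  id V := ⟨𝟙 _, fun d => by simp⟩
  comp f g := ⟨f.hom ≫ g.hom, fun d => by
    rw [← Category.assoc, f.comm, Category.assoc, g.comm, Category.assoc]⟩

@[ext]
theorem RMod.hom_ext {V W : RMod k D X} {f g : V ⟶ W} (h : f.hom = g.hom) : f = g :=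
  RMod.Hom.ext h

theorem RMod.comm_apply {V W : RMod k D X} (f : V ⟶ W) (d : D) (U : X.Opens) (x : Γ(V.mod, U)) :
    sec f.hom U (sec (V.act d) U x) = sec (W.act d) U (sec f.hom U x) := by
  rw [← sec_comp, f.comm, sec_comp]

@[simp] theorem RMod.id_hom (V : RMod k D X) : RMod.Hom.hom (𝟙 V) = 𝟙 V.mod := rfl
@[simp] theorem RMod.comp_hom {V W Z : RMod k D X} (f : V ⟶ W) (g : W ⟶ Z) :
    (f ≫ g).hom = f.hom ≫ g.hom := rfl

instance {V W : RMod k D X} : Zero (V ⟶ W) where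
  zero := ⟨0, fun d => by simp⟩
instance {V W : RMod k D X} : Add (V ⟶ W) where
  add f g := ⟨f.hom + g.hom, fun d => by simp [f.comm, g.comm]⟩
instance {V W : RMod k D X} : Neg (V ⟶ W) where
  neg f := ⟨-f.hom, fun d => by simp [f.comm]⟩

@[simp] theorem RMod.add_hom {V W : RMod k D X} (f g : V ⟶ W) :
    (f + g).hom = f.hom + g.hom := rfl
@[simp] theorem RMod.neg_hom {V W : RMod k D X} (f : V ⟶ W) : (-f).hom = -f.hom := rfl
@[simp] theorem RMod.zero_hom {V W : RMod k D X} : (0 : V ⟶ W).hom = 0 := rfl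

instance {V W : RMod k D X} : AddCommGroup (V ⟶ W) where
  add_assoc f g h := RMod.hom_ext (add_assoc f.hom g.hom h.hom)
  zero_add f := RMod.hom_ext (zero_add f.hom)
  add_zero f := RMod.hom_ext (add_zero f.hom)
  add_comm f g := RMod.hom_ext (add_comm f.hom g.hom)
  neg_add_cancel f := RMod.hom_ext (neg_add_cancel f.hom)
  nsmul := nsmulRec
  zsmul := zsmulRec

instance : Preadditive (RMod k D X) where
  add_comp _ _ _ f f' g := RMod.hom_ext (by
    rw [RMod.comp_hom, RMod.add_hom, RMod.add_hom, RMod.comp_hom, RMod.comp_hom,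
      Preadditive.add_comp])
  comp_add _ _ _ f g g' := RMod.hom_ext (by
    rw [RMod.comp_hom, RMod.add_hom, RMod.add_hom, RMod.comp_hom, RMod.comp_hom,
      Preadditive.comp_add])

variable (k D X)

/-- The functor which forgets the action of `D`. -/
@[simps]
def RMod.forget : RMod k D X ⥤ X.Modules where
  obj V := V.mod
  map f := f.hom

end RightModules

section Dualities

universe v w v' w' v'' w''

/-- An additive contravariant functor `*` with a natural transformation `can : M → M**` such that
the composition `M* → M*** → M*` is the identity. -/
structure Duality (C : Type w) [Category.{v} C] [Preadditive C] where
  dual : Cᵒᵖ ⥤ C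
  additive : dual.Additive
  can : 𝟭 C ⟶ dual.rightOp ⋙ dual
  can_dual (M : C) : can.app (dual.obj (op M)) ≫ dual.map (can.app M).op = 𝟙 _

variable {C : Type w} [Category.{v} C] [Preadditive C]

/-- `(C, *, can)` is a category with duality: the transformation `can` is an isomorphism. -/
def Duality.IsStrong (δ : Duality C) : Prop := ∀ M : C, IsIso (δ.can.app M)

/-- The duality `(*, -can)`. -/
@[simps dual]
def Duality.neg (δ : Duality C) : Duality C where
  dual := δ.dual
  additive := δ.additive
  can := -δ.can
  can_dual M := by
    have := δ.additive
    have h : ((-δ.can).app M).op = -(δ.can.app M).op := rfl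
    rw [h, Functor.map_neg]
    change (-δ.can.app _) ≫ _ = _
    rw [Preadditive.neg_comp_neg]
    exact δ.can_dual M

/-- The restriction of a duality to a full subcategory which is stable under it. -/
def Duality.restrict (δ : Duality C) (P : ObjectProperty C)
    (h : ∀ M : C, P M → P (δ.dual.obj (op M))) : Duality P.FullSubcategory where
  dual := P.lift (P.ι.op ⋙ δ.dual) (fun M => h _ M.unop.property)
  additive :=
    have := δ.additive
    { map_add := fun {M N f g} => P.hom_ext (by
        change δ.dual.map (f.unop.hom + g.unop.hom).op = _
        rw [op_add, Functor.map_add]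
        rfl) }
  can :=
    { app := fun M => P.homMk (δ.can.app M.obj)
      naturality := fun M N f => P.hom_ext (δ.can.naturality f.hom) }
  can_dual M := P.hom_ext (δ.can_dual M.obj)

/-- Symmetric spaces in a category with duality. -/
structure Space (δ : Duality C) where
  obj : C
  form : obj ⟶ δ.dual.obj (op obj)
  isIso : IsIso form
  symm : δ.can.app obj ≫ δ.dual.map form.op = form

variable {δ : Duality C}

/-- Two spaces are isometric. -/
def Space.Isometric (S T : Space δ) : Prop :=
  ∃ e : S.obj ≅ T.obj, e.hom ≫ T.form ≫ δ.dual.map e.hom.op = S.form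

/-- The space `S` is the orthogonal sum of `P` and `Q`. -/
def Space.IsOrthogonalSum (S P Q : Space δ) : Prop :=
  ∃ (i : P.obj ⟶ S.obj) (j : Q.obj ⟶ S.obj) (p : S.obj ⟶ P.obj) (q : S.obj ⟶ Q.obj),
    i ≫ p = 𝟙 _ ∧ j ≫ q = 𝟙 _ ∧ i ≫ q = 0 ∧ j ≫ p = 0 ∧ p ≫ i + q ≫ j = 𝟙 _ ∧
    S.form = p ≫ P.form ≫ δ.dual.map p.op + q ≫ Q.form ≫ δ.dual.map q.op

variable {A : Type w''} [Category.{v''} A] [Abelian A]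

/-- A space `(S, φ)` is metabolic if it has a Lagrangian, that is, a subobject `α : L → S` such
that the sequence `0 → L → S → L* → 0` with the maps `α` and `α* φ` is exact. Exactness is tested
after applying the given functor to an abelian category. -/
def Space.IsMetabolic (E : C ⥤ A) (S : Space δ) : Prop :=
  ∃ (L : C) (α : L ⟶ S.obj) (w : E.map α ≫ E.map (S.form ≫ δ.dual.map α.op) = 0),
    (ShortComplex.mk _ _ w).ShortExact

/-- The relations which define the Witt group. -/
inductive WittRel (δ : Duality C) (E : C ⥤ A) : FreeAbelianGroup (Space δ) → Prop
  | isometric (S T : Space δ) (h : S.Isometric T) : WittRel δ E (.of S - .of T)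
  | sum (S P Q : Space δ) (h : S.IsOrthogonalSum P Q) : WittRel δ E (.of S - (.of P + .of Q))
  | metabolic (S : Space δ) (h : S.IsMetabolic E) : WittRel δ E (.of S)

/-- The Witt group: the Grothendieck group of the isometry classes of symmetric spaces, for the
orthogonal sum, modulo the subgroup generated by the classes of metabolic spaces. Exactness in
`C` is defined through the functor `E` to an abelian category. -/
def WittGroup (δ : Duality C) (E : C ⥤ A) : Type (max w v) :=
  FreeAbelianGroup (Space δ) ⧸ AddSubgroup.closure {x | WittRel δ E x}

instance (δ : Duality C) (E : C ⥤ A) : AddCommGroup (WittGroup δ E) :=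
  inferInstanceAs (AddCommGroup (_ ⧸ AddSubgroup.closure {x | WittRel δ E x}))

/-- The Witt class of a space. -/
def WittGroup.mk (E : C ⥤ A) (S : Space δ) : WittGroup δ E :=
  QuotientAddGroup.mk (FreeAbelianGroup.of S)

variable {C' : Type w'} [Category.{v'} C'] [Preadditive C']

/-- A duality-preserving functor `(F, θ)`. -/
structure DualityPreserving (F : C ⥤ C') (δ : Duality C) (δ' : Duality C') where
  θ : δ.dual ⋙ F ≅ F.op ⋙ δ'.dual
  comm (M : C) : F.map (δ.can.app M) ≫ θ.hom.app (op (δ.dual.obj (op M))) =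
    δ'.can.app (F.obj M) ≫ δ'.dual.map (θ.hom.app (op M)).op

/-- The space `(F(M), θ_M ∘ F(φ))`. -/
@[simps obj form]
def DualityPreserving.mapSpace {F : C ⥤ C'} {δ : Duality C} {δ' : Duality C'}
    (Φ : DualityPreserving F δ δ') (S : Space δ) : Space δ' where
  obj := F.obj S.obj
  form := F.map S.form ≫ Φ.θ.hom.app (op S.obj)
  isIso := by
    have := S.isIso
    infer_instance
  symm := by
    have h := Φ.θ.hom.naturality S.form.op
    simp only [Functor.comp_map, Functor.op_map, Quiver.Hom.unop_op] at h
    rw [op_comp, Functor.map_comp, ← Category.assoc, ← Φ.comm, Category.assoc]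
    erw [← h]
    rw [← Category.assoc, ← F.map_comp, S.symm]

end Dualities

section Star

variable {X : Scheme.{u}}

/-- The contravariant functor `M ↦ Hom(M, L)`. -/
def starFunctor (L : X.Modules) : X.Modulesᵒᵖ ⥤ X.Modules where
  obj M := homSheaf M.unop L
  map f := homMk (fun U =>
      { toFun := fun g => evMk (fun V h => (ev g h).comp (sec f.unop V)) (fun hV h x => by
          simp only [LinearMap.comp_apply]
          rw [sec_res, res_ev])
        map_add' := fun _ _ => rfl
        map_smul' := fun _ _ => rfl })
    (fun _ _ => rfl)

/-- The duality `M* = Hom(M, L)` on `O_X`-modules, with the evaluation maps `M → M**`. -/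
def starDuality (L : X.Modules) : Duality X.Modules where
  dual := starFunctor L
  additive :=
    { map_add := fun {M N f g} => sec_ext fun U x => ev_ext fun V h y => by
        change ev (M := M.unop) (N := L) x h (sec (f.unop + g.unop) V y) =
          ev (M := M.unop) (N := L) x h (sec f.unop V y) +
            ev (M := M.unop) (N := L) x h (sec g.unop V y)
        rw [sec_add, map_add] }
  can :=
    { app := fun M => homMk (N := homSheaf (homSheaf M L) L) (fun U =>
        { toFun := fun x => evMk (M := homSheaf M L) (fun V h =>
            { toFun := fun f => ev f le_rfl (res M h x)
              map_add' := fun _ _ => rfl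
              map_smul' := fun a f => by
                rw [ev_smul, resO_self]
                rfl })
            (fun {V W} hV h f => by
              change ev f h (res M (h.trans hV) x) = res L h (ev f le_rfl (res M hV x))
              rw [← res_ev f le_rfl h, res_res])
          map_add' := fun x y => ev_ext fun V h f => by
            change ev f le_rfl (res M h (x + y)) = ev f le_rfl (res M h x) +
              ev f le_rfl (res M h y)
            rw [map_add, map_add]
          map_smul' := fun a x => ev_ext fun V h f => by
            change ev f le_rfl (res M h (a • x)) = resO h a • ev f le_rfl (res M h x)
            rw [res_smul, map_smul] })
        (fun {U V} h x => ev_ext fun W hW f => by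
          change ev f le_rfl (res M hW (res M h x)) = ev f le_rfl (res M (hW.trans h) x)
          rw [res_res])
      naturality := fun M N f => sec_ext fun U x => ev_ext fun V h g => by
        change ev g le_rfl (res N h (sec f U x)) = ev g le_rfl (sec f V (res M h x))
        rw [sec_res] }
  can_dual M := sec_ext fun _ f => ev_ext fun _ h x =>
    congrArg (ev (M := M) (N := L) f h) (res_self M le_rfl x)

end Star

section Sharp

variable (k : Type u) [Field k] (D : Type u) [Ring D] [Algebra k D]

/-- Involutions of the first kind on a `k`-algebra. -/
structure Involution where
  map : D →ₗ[k] D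
  map_mul (a b : D) : map (a * b) = map b * map a
  map_map (a : D) : map (map a) = a

variable {k D} (σ : Involution k D)

theorem Involution.map_one : σ.map 1 = 1 := by
  have h := σ.map_mul 1 (σ.map 1)
  rw [one_mul, σ.map_map, one_mul] at h
  exact h.symm

/-- The involution of `R ⊗ D` obtained from an involution of `D` by scalar extension. -/
abbrev Involution.onExt (R : Type u) [CommRing R] [Algebra k R] : R ⊗[k] D →ₗ[R] R ⊗[k] D :=
  σ.map.baseChange R

theorem Involution.onExt_mul (R : Type u) [CommRing R] [Algebra k R] (x y : R ⊗[k] D) :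
    σ.onExt R (x * y) = σ.onExt R y * σ.onExt R x := by
  induction x with
  | zero => simp
  | add x x' hx hx' => simp only [add_mul, mul_add, map_add, hx, hx']
  | tmul a d =>
    induction y with
    | zero => simp
    | add y y' hy hy' => simp only [add_mul, mul_add, map_add, hy, hy']
    | tmul b e => simp [σ.map_mul, mul_comm]

theorem Involution.onExt_onExt (R : Type u) [CommRing R] [Algebra k R] (x : R ⊗[k] D) :
    σ.onExt R (σ.onExt R x) = x := by
  induction x with
  | zero => simp
  | add x x' hx hx' => simp only [map_add, hx, hx']
  | tmul a d => simp [σ.map_map]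

theorem Involution.ext_onExt {R S : Type u} [CommRing R] [Algebra k R] [CommRing S] [Algebra k S]
    (f : R →ₐ[k] S) (x : R ⊗[k] D) : ext D f (σ.onExt R x) = σ.onExt S (ext D f x) := by
  induction x with
  | zero => simp
  | add x x' hx hx' => simp only [map_add, hx, hx']
  | tmul a d => simp

variable {X : Scheme.{u}} [X.Over (Spec (.of k))] [FiniteDimensional k D]

/-- The homomorphisms of right modules over `D ⊗ O_U` from `V|_U` to `D ⊗ O_U`, as sections of
the sheaf of `O_X`-linear homomorphisms. -/
def sharpSections (V : RMod k D X) (U : X.Opens) :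
    Submodule Γ(X, U) Γ(homSheaf V.mod (sheafD k X D), U) where
  carrier := {f | ∀ (W : X.Opens) (h : W ≤ U) (x : Γ(V.mod, W)) (d : D),
    val k D (ev f h (sec (V.act d) W x)) = val k D (ev f h x) * ((1 : Γ(X, W)) ⊗ₜ[k] d)}
  zero_mem' := fun W h x d => (zero_mul ((1 : Γ(X, W)) ⊗ₜ[k] d)).symm
  add_mem' := fun {f g} hf hg W h x d => by
    change val k D (ev f h (sec (V.act d) W x)) + val k D (ev g h (sec (V.act d) W x)) =
      (val k D (ev f h x) + val k D (ev g h x)) * (1 ⊗ₜ[k] d)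
    rw [hf, hg, add_mul]
  smul_mem' := fun a f hf W h x d => by
    change resO h a • val k D (ev f h (sec (V.act d) W x)) =
      (resO h a • val k D (ev f h x)) * (1 ⊗ₜ[k] d)
    rw [hf, smul_mul_assoc]

/-- The sheaf of homomorphisms of right `D ⊗ O_X`-modules from `V` to `D ⊗ O_X`. -/
def sharpSheaf (V : RMod k D X) : X.Modules :=
  subMk (homSheaf V.mod (sheafD k X D)) (sharpSections V)
    (fun h f hf W hW x d => hf W (hW.trans h) x d)
    (fun {U} f hf W hW x d => by
      change ev f hW (sec (V.act d) W x) =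
        (val k D (ev f hW x) * ((1 : Γ(X, W)) ⊗ₜ[k] d) : Γ(X, W) ⊗[k] D)
      refine eq_of_local (sheafD k X D) (U := W) _ _ fun p hp => ?_
      obtain ⟨Z, hZ, hpZ, hm⟩ := hf p (hW hp)
      refine ⟨Z ⊓ W, inf_le_right, ⟨hpZ, hp⟩, ?_⟩
      have h1 := hm (Z ⊓ W) inf_le_left (res V.mod inf_le_right x) d
      rw [ev_res, ev_res, sec_res, res_ev f hW, res_ev f hW] at h1
      refine h1.trans ?_
      change ext D (resA _) _ * _ = ext D (resA _) _
      rw [map_mul]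
      simp [ext]
      rfl)

/-- The value of a section of `V♯` over `U` on a section of `V` over `W ⊆ U`. -/
def sharpEv {V : RMod k D X} {U : X.Opens} (f : Γ(sharpSheaf V, U)) {W : X.Opens} (h : W ≤ U)
    (x : Γ(V.mod, W)) : Γ(X, W) ⊗[k] D := val k D (ev (f : sharpSections V U).1 h x)

end Sharp

theorem mul_tmul_smul {k : Type u} [Field k] {D : Type u} [Ring D] [Algebra k D] {R : Type u} [CommRing R] [Algebra k R] (c : k) (x : R ⊗[k] D) :
    1 ⊗ₜ[k] (algebraMap k D c) * x = algebraMap k R c • x := by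
  induction x with
  | zero => simp
  | add x y hx hy => simp only [mul_add, smul_add, hx, hy]
  | tmul r d =>
    rw [Algebra.TensorProduct.tmul_mul_tmul, one_mul, ← Algebra.smul_def, ← TensorProduct.smul_tmul,
      TensorProduct.smul_tmul', algebraMap_smul]

section SharpDuality

variable {k : Type u} [Field k] {D : Type u} [Ring D] [Algebra k D] [FiniteDimensional k D]
  {X : Scheme.{u}} [X.Over (Spec (.of k))]

theorem sharp_ext {V : RMod k D X} {U : X.Opens} {f g : Γ(sharpSheaf V, U)}
    (h : ∀ (W : X.Opens) (hW : W ≤ U) (x : Γ(V.mod, W)), sharpEv f hW x = sharpEv g hW x) :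
    f = g :=
  Subtype.ext (ev_ext h)

theorem sharpEv_act {V : RMod k D X} {U : X.Opens} (f : Γ(sharpSheaf V, U)) {W : X.Opens}
    (h : W ≤ U) (x : Γ(V.mod, W)) (d : D) :
    sharpEv f h (sec (V.act d) W x) = sharpEv f h x * (1 ⊗ₜ[k] d) :=
  (f : sharpSections V U).2 W h x d

theorem sharpEv_add {V : RMod k D X} {U : X.Opens} (f : Γ(sharpSheaf V, U)) {W : X.Opens}
    (h : W ≤ U) (x y : Γ(V.mod, W)) : sharpEv f h (x + y) = sharpEv f h x + sharpEv f h y :=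
  map_add (ev (f : sharpSections V U).1 h) x y

theorem sharpEv_smul {V : RMod k D X} {U : X.Opens} (f : Γ(sharpSheaf V, U)) {W : X.Opens}
    (h : W ≤ U) (a : Γ(X, W)) (x : Γ(V.mod, W)) : sharpEv f h (a • x) = a • sharpEv f h x :=
  map_smul (ev (f : sharpSections V U).1 h) a x

theorem sharpEv_res {V : RMod k D X} {U : X.Opens} (f : Γ(sharpSheaf V, U)) {W W' : X.Opens}
    (h : W ≤ U) (h' : W' ≤ W) (x : Γ(V.mod, W)) :
    sharpEv f (h'.trans h) (res V.mod h' x) = ext D (resA h') (sharpEv f h x) :=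
  res_ev (f : sharpSections V U).1 h h' x

/-- A section of `V♯`, given by its values. -/
def sharpMk {V : RMod k D X} {U : X.Opens}
    (f : ∀ W : X.Opens, W ≤ U → (Γ(V.mod, W) →ₗ[Γ(X, W)] Γ(X, W) ⊗[k] D))
    (hres : ∀ {W W' : X.Opens} (h : W ≤ U) (h' : W' ≤ W) (x : Γ(V.mod, W)),
      f W' (h'.trans h) (res V.mod h' x) = ext D (resA h') (f W h x))
    (hact : ∀ {W : X.Opens} (h : W ≤ U) (x : Γ(V.mod, W)) (d : D),
      f W h (sec (V.act d) W x) = f W h x * (1 ⊗ₜ[k] d)) : Γ(sharpSheaf V, U) :=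
  (⟨evMk (N := sheafD k X D) f hres, fun _ h x d => hact h x d⟩ : sharpSections V U)

theorem sharpEv_sharpMk {V : RMod k D X} {U : X.Opens} (f) (hres) (hact) {W : X.Opens} (h : W ≤ U)
    (x : Γ(V.mod, W)) : sharpEv (sharpMk (V := V) (U := U) f hres hact) h x = f W h x := rfl

/-- A morphism of `O_X`-modules into `V♯`, given by its values. -/
def sharpHomMk {M : X.Modules} {V : RMod k D X} (f : ∀ U : X.Opens, Γ(M, U) → Γ(sharpSheaf V, U))
    (hadd : ∀ (U : X.Opens) (x y : Γ(M, U)) (W : X.Opens) (h : W ≤ U) (v : Γ(V.mod, W)),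
      sharpEv (f U (x + y)) h v = sharpEv (f U x) h v + sharpEv (f U y) h v)
    (hsmul : ∀ (U : X.Opens) (a : Γ(X, U)) (x : Γ(M, U)) (W : X.Opens) (h : W ≤ U)
      (v : Γ(V.mod, W)), sharpEv (f U (a • x)) h v = resO h a • sharpEv (f U x) h v)
    (hres : ∀ {U U' : X.Opens} (h' : U' ≤ U) (x : Γ(M, U)) (W : X.Opens) (h : W ≤ U')
      (v : Γ(V.mod, W)), sharpEv (f U' (res M h' x)) h v = sharpEv (f U x) (h.trans h') v) :
    M ⟶ sharpSheaf V :=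
  homMk (fun U =>
      { toFun := f U
        map_add' := fun x y => sharp_ext (hadd U x y)
        map_smul' := fun a x => sharp_ext (hsmul U a x) })
    (fun h x => sharp_ext (hres h x))

variable (σ : Involution k D)

/-- The right module `V♯`: the left action of `D` on the homomorphisms from `V` to `D ⊗ O_X` is
twisted by `σ` into a right action. -/
def sharp (V : RMod k D X) : RMod k D X where
  mod := sharpSheaf V
  act d := sharpHomMk
    (fun U f => sharpMk (fun W h =>
        { toFun := fun x => 1 ⊗ₜ[k] (σ.map d) * sharpEv f h x
          map_add' := fun x y => by rw [sharpEv_add, mul_add]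
          map_smul' := fun a x => by rw [sharpEv_smul, mul_smul_comm, RingHom.id_apply] })
      (fun h h' x => by
        change _ * sharpEv f _ _ = ext D (resA h') (_ * sharpEv f _ x)
        rw [sharpEv_res f h h', map_mul]
        simp [ext])
      (fun h x d => by
        change _ * sharpEv f _ _ = _ * sharpEv f _ _ * _
        rw [sharpEv_act, mul_assoc]))
    (fun U f g W h v => mul_add _ (sharpEv f h v) (sharpEv g h v))
    (fun U a f W h v => mul_smul_comm (resO h a) _ (sharpEv f h v))
    (fun h' f W h v => rfl)
  act_add a b := sec_ext fun U f => sharp_ext fun W h v => by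
    change 1 ⊗ₜ[k] (σ.map (a + b)) * sharpEv f h v =
      1 ⊗ₜ[k] (σ.map a) * sharpEv f h v + 1 ⊗ₜ[k] (σ.map b) * sharpEv f h v
    rw [map_add, TensorProduct.tmul_add, add_mul]
  act_one := sec_ext fun U f => sharp_ext fun W h v => by
    change 1 ⊗ₜ[k] (σ.map 1) * sharpEv f h v = sharpEv f h v
    rw [σ.map_one]
    exact one_mul _
  act_mul a b := sec_ext fun U f => sharp_ext fun W h v => by
    change 1 ⊗ₜ[k] (σ.map (a * b)) * sharpEv f h v =
      1 ⊗ₜ[k] (σ.map b) * (1 ⊗ₜ[k] (σ.map a) * sharpEv f h v)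
    rw [σ.map_mul, ← mul_assoc, Algebra.TensorProduct.tmul_mul_tmul, one_mul]
  act_algebraMap c U f := sharp_ext fun W h v => by
    change 1 ⊗ₜ[k] (σ.map (algebraMap k D c)) * sharpEv f h v =
      resO h (algebraMap k Γ(X, U) c) • sharpEv f h v
    rw [Algebra.algebraMap_eq_smul_one, map_smul, σ.map_one, ← Algebra.algebraMap_eq_smul_one,
      mul_tmul_smul]
    congr 1
    exact ((resA h).commutes c).symm

theorem sharpEv_sharp_act (V : RMod k D X) {U W : X.Opens} (d : D) (f : Γ(sharpSheaf V, U))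
    (h : W ≤ U) (x : Γ(V.mod, W)) :
    sharpEv (sec ((sharp σ V).act d) U f) h x = 1 ⊗ₜ[k] (σ.map d) * sharpEv f h x := rfl

variable {σ} in
theorem sharp_hom_ext {M : RMod k D X} {V : RMod k D X} {f g : M ⟶ sharp σ V}
    (h : ∀ (U : X.Opens) (x : Γ(M.mod, U)) (W : X.Opens) (hW : W ≤ U) (v : Γ(V.mod, W)),
      sharpEv (V := V) (sec f.hom U x) hW v = sharpEv (V := V) (sec g.hom U x) hW v) : f = g :=
  RMod.hom_ext (sec_ext fun U x => sharp_ext (V := V) (h U x))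

/-- The morphism `f♯ : W♯ → V♯` for `f : V → W`, which maps `g` to `g ∘ f`. -/
def sharpMap {V W : RMod k D X} (f : V ⟶ W) : sharp σ W ⟶ sharp σ V where
  hom := sharpHomMk (M := sharpSheaf W)
    (fun U g => sharpMk (fun Z h =>
        { toFun := fun x => sharpEv g h (sec f.hom Z x)
          map_add' := fun x y => by rw [map_add, sharpEv_add]
          map_smul' := fun a x => by rw [map_smul, sharpEv_smul, RingHom.id_apply] })
      (fun h h' x => by
        change sharpEv g _ (sec f.hom _ (res _ _ _)) = _
        rw [sec_res, sharpEv_res g h h']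
        rfl)
      (fun h x d => by
        change sharpEv g _ (sec f.hom _ (sec _ _ x)) = _
        rw [RMod.comm_apply, sharpEv_act]
        rfl))
    (fun _ _ _ _ _ _ => rfl) (fun _ _ _ _ _ _ => rfl) (fun _ _ _ _ _ => rfl)
  comm d := sec_ext fun U g => sharp_ext (V := V) fun Z h x => by
    exact sharpEv_sharp_act σ W d g h (sec f.hom Z x)

theorem sharpEv_sharpMap {V W : RMod k D X} (f : V ⟶ W) {U Z : X.Opens} (g : Γ(sharpSheaf W, U))
    (h : Z ≤ U) (x : Γ(V.mod, Z)) :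
    sharpEv (V := V) (sec (sharpMap σ f).hom U g) h x = sharpEv g h (sec f.hom Z x) := rfl

/-- The contravariant functor `♯`. -/
def sharpFunctor : (RMod k D X)ᵒᵖ ⥤ RMod k D X where
  obj V := sharp σ V.unop
  map f := sharpMap σ f.unop
  map_id _ := sharp_hom_ext fun _ _ _ _ _ => rfl
  map_comp _ _ := sharp_hom_ext fun _ _ _ _ _ => rfl

/-- The usual map `π : V → V♯♯`, where `π(x)` maps `f` to `σ(f(x))`. -/
def sharpCan (V : RMod k D X) : V ⟶ sharp σ (sharp σ V) where
  hom := sharpHomMk (M := V.mod) (V := sharp σ V)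
    (fun U x => sharpMk (V := sharp σ V) (fun W h =>
        { toFun := fun f => σ.onExt _ (sharpEv (V := V) f le_rfl (res V.mod h x))
          map_add' := fun f g => map_add (σ.onExt _)
            (sharpEv (V := V) f le_rfl (res V.mod h x))
            (sharpEv (V := V) g le_rfl (res V.mod h x))
          map_smul' := fun a f => by
            change σ.onExt _ (resO le_rfl a • sharpEv (V := V) f le_rfl (res V.mod h x)) =
              a • σ.onExt _ (sharpEv (V := V) f le_rfl (res V.mod h x))
            rw [resO_self, map_smul] })
      (fun {W W'} h h' f => by
        change σ.onExt _ (sharpEv (V := V) f h' (res V.mod (h'.trans h) x)) =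
          ext D (resA h') (σ.onExt _ (sharpEv (V := V) f le_rfl (res V.mod h x)))
        rw [σ.ext_onExt, ← sharpEv_res (V := V) f le_rfl h', res_res])
      (fun {W} h f d => by
        change σ.onExt _ (1 ⊗ₜ[k] (σ.map d) * sharpEv (V := V) f le_rfl _) =
          σ.onExt _ (sharpEv (V := V) f le_rfl _) * _
        rw [σ.onExt_mul]
        congr 1
        simp [σ.map_map]))
    (fun U x y W h (f : Γ(sharpSheaf V, W)) => by
      change σ.onExt _ (sharpEv (V := V) f le_rfl (res V.mod h (x + y))) =
        σ.onExt _ (sharpEv (V := V) f le_rfl (res V.mod h x)) +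
        σ.onExt _ (sharpEv (V := V) f le_rfl (res V.mod h y))
      rw [map_add, sharpEv_add, map_add])
    (fun U a x W h (f : Γ(sharpSheaf V, W)) => by
      change σ.onExt _ (sharpEv (V := V) f le_rfl (res V.mod h (a • x))) =
        resO h a • σ.onExt _ (sharpEv (V := V) f le_rfl (res V.mod h x))
      rw [res_smul, sharpEv_smul, map_smul])
    (fun {U U'} h' x W h f => by
      change σ.onExt _ (sharpEv (V := V) f le_rfl (res V.mod h (res V.mod h' x))) =
        σ.onExt _ (sharpEv (V := V) f le_rfl (res V.mod (h.trans h') x))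
      rw [res_res])
  comm d := sec_ext fun U x => sharp_ext (V := sharp σ V) fun W h (f : Γ(sharpSheaf V, W)) => by
    change σ.onExt _ (sharpEv (V := V) f le_rfl (res V.mod h (sec (V.act d) U x))) =
      1 ⊗ₜ[k] (σ.map d) * σ.onExt _ (sharpEv (V := V) f le_rfl (res V.mod h x))
    rw [← sec_res, sharpEv_act, σ.onExt_mul]
    congr 1

theorem sharpEv_sharpCan (V : RMod k D X) {U W : X.Opens} (x : Γ(V.mod, U)) (h : W ≤ U)
    (f : Γ(sharpSheaf V, W)) :
    sharpEv (V := sharp σ V) (sec (sharpCan σ V).hom U x) h f =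
      σ.onExt _ (sharpEv f le_rfl (res V.mod h x)) := rfl

/-- The duality `(♯, π)` on right modules over `D ⊗ O_X`. -/
def sharpDuality : Duality (RMod k D X) where
  dual := sharpFunctor σ
  additive :=
    { map_add := fun {V W f g} => sharp_hom_ext (V := W.unop) fun U x Z h y => by
        change sharpEv (V := V.unop) x h (sec (f.unop.hom + g.unop.hom) Z y) =
          sharpEv (V := V.unop) x h (sec f.unop.hom Z y) +
            sharpEv (V := V.unop) x h (sec g.unop.hom Z y)
        rw [sec_add]
        exact sharpEv_add (V := V.unop) x h _ _ }
  can :=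
    { app := fun V => sharpCan σ V
      naturality := fun V W f => sharp_hom_ext (V := sharp σ W)
        fun U (x : Γ(V.mod, U)) Z h (g : Γ(sharpSheaf W, Z)) => by
          change σ.onExt _ (sharpEv g le_rfl (res W.mod h (sec f.hom U x))) =
            σ.onExt _ (sharpEv g le_rfl (sec f.hom Z (res V.mod h x)))
          rw [sec_res] }
  can_dual V := sharp_hom_ext (V := V) fun U (f : Γ(sharpSheaf V, U)) W h x => by
    change σ.onExt _ (σ.onExt _ (sharpEv f h (res V.mod le_rfl x))) = sharpEv f h x
    rw [σ.onExt_onExt, res_self]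

end SharpDuality

section Tensor

variable {k : Type u} [Field k] {D : Type u} [Ring D] [Algebra k D]
  {X : Scheme.{u}} [X.Over (Spec (.of k))]

/-- Restriction of sections on the tensor product of sections of two `O_X`-modules. -/
def tensorRes (M N : X.Modules) {U V : X.Opens} (h : V ≤ U) :
    Γ(M, U) ⊗[Γ(X, U)] Γ(N, U) →ₛₗ[resO h] Γ(M, V) ⊗[Γ(X, V)] Γ(N, V) where
  toFun := TensorProduct.liftAddHom
    (AddMonoidHom.mk' (fun m => ((TensorProduct.mk Γ(X, V) _ _ (res M h m)).toAddMonoidHom.comp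
      (res N h))) (fun m m' => by ext n; simp))
    (fun r m n => by
      change res M h (r • m) ⊗ₜ[Γ(X, V)] res N h n = res M h m ⊗ₜ[Γ(X, V)] res N h (r • n)
      rw [res_smul, res_smul, TensorProduct.smul_tmul])
  map_add' x y := map_add _ x y
  map_smul' a x := by
    induction x with
    | zero => simp
    | add x y hx hy => simp only [smul_add, map_add, hx, hy]
    | tmul m n =>
      change res M h (a • m) ⊗ₜ[Γ(X, V)] res N h n =
        resO h a • (res M h m ⊗ₜ[Γ(X, V)] res N h n)
      rw [res_smul, TensorProduct.smul_tmul']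

theorem tensorRes_tmul (M N : X.Modules) {U V : X.Opens} (h : V ≤ U) (m : Γ(M, U)) (n : Γ(N, U)) :
    tensorRes M N h (m ⊗ₜ n) = res M h m ⊗ₜ[Γ(X, V)] res N h n := rfl

variable (V : RMod k D X) (T : X.Modules) (l : D → (T ⟶ T))

/-- The relations `v d ⊗ t = v ⊗ d t`, for `d` in `D`. -/
def tensorRel (U : X.Opens) : Submodule Γ(X, U) (Γ(V.mod, U) ⊗[Γ(X, U)] Γ(T, U)) :=
  Submodule.span _ {z | ∃ (v : Γ(V.mod, U)) (d : D) (t : Γ(T, U)),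
    z = sec (V.act d) U v ⊗ₜ t - v ⊗ₜ sec (l d) U t}

theorem tensorRes_rel {U W : X.Opens} (h : W ≤ U) :
    tensorRel V T l U ≤ (tensorRel V T l W).comap (tensorRes V.mod T h) := by
  refine Submodule.span_le.2 ?_
  rintro _ ⟨v, d, t, rfl⟩
  refine Submodule.subset_span ⟨res V.mod h v, d, res T h t, ?_⟩
  rw [map_sub, tensorRes_tmul, tensorRes_tmul, sec_res, sec_res]

/-- The presheaf with sections `V(U) ⊗ T(U)`, where the tensor product is over `D ⊗ O_X(U)`. -/
def tensorPre : X.PresheafOfModules :=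
  preMk (fun U => (Γ(V.mod, U) ⊗[Γ(X, U)] Γ(T, U)) ⧸ tensorRel V T l U)
    (fun {U W} h => (Submodule.mapQ (tensorRel V T l U) (tensorRel V T l W)
      (tensorRes V.mod T h) (tensorRes_rel V T l h)).toAddMonoidHom)
    (fun {U} h x => by
      obtain ⟨x, rfl⟩ := Submodule.mkQ_surjective _ x
      change Submodule.mkQ _ (tensorRes V.mod T h x) = Submodule.mkQ _ x
      congr 1
      induction x with
      | zero => simp
      | add x y hx hy => simp only [map_add, hx, hy]
      | tmul m n => rw [tensorRes_tmul, res_self, res_self])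
    (fun {U W Z} h h' x => by
      obtain ⟨x, rfl⟩ := Submodule.mkQ_surjective _ x
      change Submodule.mkQ _ (tensorRes V.mod T h' (tensorRes V.mod T h x)) =
        Submodule.mkQ _ (tensorRes V.mod T (h'.trans h) x)
      congr 1
      induction x with
      | zero => simp
      | add x y hx hy => simp only [map_add, hx, hy]
      | tmul m n => simp only [tensorRes_tmul, res_res])
    (fun {U W} h a x => map_smulₛₗ (Submodule.mapQ (tensorRel V T l U) (tensorRel V T l W)
      (tensorRes V.mod T h) (tensorRes_rel V T l h)) a x)

/-- The sheaf `V ⊗ T`, where the tensor product is over `D ⊗ O_X`. -/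
def tensorSheaf : X.Modules :=
  (PresheafOfModules.sheafification (𝟙 X.ringCatSheaf.obj)).obj (tensorPre V T l)

variable {V T l} in
/-- The section `v ⊗ t` of `V ⊗ T`. -/
def tmul {U : X.Opens} (v : Γ(V.mod, U)) (t : Γ(T, U)) : Γ(tensorSheaf V T l, U) :=
  (((PresheafOfModules.sheafificationAdjunction (𝟙 X.ringCatSheaf.obj)).unit.app
    (tensorPre V T l)).app (op U)).hom (Submodule.Quotient.mk (v ⊗ₜ[Γ(X, U)] t))

variable {V} in
/-- The map `f ⊗ id` on sections over `U`. -/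
def tensorSec {W : RMod k D X} (f : V ⟶ W) (U : X.Opens) :
    (Γ(V.mod, U) ⊗[Γ(X, U)] Γ(T, U)) ⧸ tensorRel V T l U →ₗ[Γ(X, U)]
      (Γ(W.mod, U) ⊗[Γ(X, U)] Γ(T, U)) ⧸ tensorRel W T l U :=
  Submodule.mapQ _ _ (TensorProduct.map (sec f.hom U) LinearMap.id) (by
    refine Submodule.span_le.2 ?_
    rintro _ ⟨v, d, t, rfl⟩
    refine Submodule.subset_span ⟨sec f.hom U v, d, t, ?_⟩
    rw [map_sub, TensorProduct.map_tmul, TensorProduct.map_tmul, RMod.comm_apply]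
    rfl)

variable {V} in
theorem tensorSec_mkQ {W : RMod k D X} (f : V ⟶ W) (U : X.Opens)
    (x : Γ(V.mod, U) ⊗[Γ(X, U)] Γ(T, U)) :
    tensorSec T l f U (Submodule.mkQ _ x) =
      Submodule.mkQ _ (TensorProduct.map (sec f.hom U) LinearMap.id x) := rfl

variable {V} in
/-- The map `f ⊗ id` on the level of presheaves. -/
def tensorPreMap {W : RMod k D X} (f : V ⟶ W) : tensorPre V T l ⟶ tensorPre W T l :=
  PresheafOfModules.homMk
    { app := fun U => AddCommGrpCat.ofHom (tensorSec T l f U.unop).toAddMonoidHom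
      naturality := fun U U' i => by
        ext x
        obtain ⟨x, rfl⟩ := Submodule.mkQ_surjective (tensorRel V T l U.unop) x
        change Submodule.mkQ (tensorRel W T l U'.unop) (TensorProduct.map (sec f.hom U'.unop)
            LinearMap.id (tensorRes V.mod T i.unop.le x)) =
          Submodule.mkQ (tensorRel W T l U'.unop) (tensorRes W.mod T i.unop.le
            (TensorProduct.map (sec f.hom U.unop) LinearMap.id x))
        congr 1
        induction x with
        | zero => simp
        | add x y hx hy => simp only [map_add, hx, hy]
        | tmul m n =>
          rw [tensorRes_tmul, TensorProduct.map_tmul, TensorProduct.map_tmul, tensorRes_tmul,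
            sec_res]
          rfl }
    (fun U (a : Γ(X, U.unop)) (x : (Γ(V.mod, U.unop) ⊗[Γ(X, U.unop)] Γ(T, U.unop)) ⧸
        tensorRel V T l U.unop) => map_smul (tensorSec T l f U.unop) a x)

theorem tensorSec_id (U : X.Opens) (x) : tensorSec T l (𝟙 V) U x = x := by
  obtain ⟨x, rfl⟩ := Submodule.mkQ_surjective _ x
  rw [tensorSec_mkQ]
  congr 1
  exact LinearMap.congr_fun TensorProduct.map_id x

variable {V} in
theorem tensorSec_comp {W Z : RMod k D X} (f : V ⟶ W) (g : W ⟶ Z) (U : X.Opens) (x) :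
    tensorSec T l (f ≫ g) U x = tensorSec T l g U (tensorSec T l f U x) := by
  obtain ⟨x, rfl⟩ := Submodule.mkQ_surjective _ x
  rw [tensorSec_mkQ, tensorSec_mkQ, tensorSec_mkQ]
  congr 1
  exact LinearMap.congr_fun
    (TensorProduct.map_comp (sec g.hom U) LinearMap.id (sec f.hom U) LinearMap.id) x

/-- The functor `V ↦ V ⊗ T`, where the tensor product is over `D ⊗ O_X`. -/
def tensorFunctor : RMod k D X ⥤ X.Modules where
  obj V := tensorSheaf V T l
  map f := (PresheafOfModules.sheafification (𝟙 X.ringCatSheaf.obj)).map (tensorPreMap T l f)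
  map_id V := by
    have : tensorPreMap T l (𝟙 V) = 𝟙 _ := by
      ext U x
      exact tensorSec_id V T l U.unop x
    rw [this]
    exact (PresheafOfModules.sheafification (𝟙 X.ringCatSheaf.obj)).map_id _
  map_comp {V W Z} f g := by
    have : tensorPreMap T l (f ≫ g) = tensorPreMap T l f ≫ tensorPreMap T l g := by
      ext U x
      exact tensorSec_comp T l f g U.unop x
    rw [this]
    exact (PresheafOfModules.sheafification (𝟙 X.ringCatSheaf.obj)).map_comp _ _

end Tensor

section Statement

variable {X : Scheme.{u}}

/-- Locally free `O_X`-modules of finite rank: every point has an open neighbourhood `U` and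
sections `e₁, …, eₙ` over `U` such that the map `(c₁, …, cₙ) ↦ ∑ cᵢ eᵢ` is an isomorphism from
`O_U ^ n` to the restriction of the module to `U`. -/
def IsLocFree : ObjectProperty X.Modules := fun M =>
  ∀ x : X, ∃ (U : X.Opens) (n : ℕ) (e : Fin n → Γ(M, U)), x ∈ U ∧ ∀ (V : X.Opens) (h : V ≤ U),
    Function.Bijective fun c : Fin n → Γ(X, V) => ∑ i, c i • res M h (e i)

variable (k : Type u) [Field k] (D : Type u) [Ring D] [Algebra k D] [X.Over (Spec (.of k))]

/-- Right modules over `D ⊗ O_X` which are locally free of finite rank as `O_X`-modules. -/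
def IsLocFreeD : ObjectProperty (RMod k D X) := fun V => IsLocFree V.mod

variable (X) in
/-- The category of locally free `O_X`-modules of finite rank. -/
abbrev ModX : Type (u + 1) := (IsLocFree (X := X)).FullSubcategory

variable (X) in
/-- The category of right modules over `D ⊗ O_X` which are locally free of finite rank as
`O_X`-modules. -/
abbrev ModD : Type (u + 1) := (IsLocFreeD (X := X) k D).FullSubcategory

variable {k D}

/-- An involution of the first kind on a central simple algebra of degree `n` is symplectic if,
after extension of scalars to a splitting field, it is adjoint to a nonsingular alternating
bilinear form. -/
def Involution.IsSymplectic (σ : Involution k D) (n : ℕ) : Prop :=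
  ∃ (K : Type u) (_ : Field K) (_ : Algebra k K) (e : K ⊗[k] D ≃ₐ[K] Matrix (Fin n) (Fin n) K)
    (J : Matrix (Fin n) (Fin n) K), IsUnit J.det ∧ J.transpose = -J ∧ (∀ i, J i i = 0) ∧
    ∀ x : K ⊗[k] D, e (σ.onExt K x) = J⁻¹ * (e x).transpose * J

end Statement

end

end SBWitt

open SBWitt

/-!
The Severi–Brauer variety `X` carries everywhere locally the structure of a splitting of `D`, and
the whole statement is a computation with this local structure.

*Local structure.* Let `R` be the local ring of `X` at a point, with residue field `K`. The
canonical `R`-point of `X` is a left ideal `I` of `R ⊗ D` which is a direct summand of rank `n`. As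
`K ⊗ D` is simple (`one_mem_twoSided`) of dimension `n²`, it is the full endomorphism algebra of
the `n`-dimensional fibre of `I`; so right multiplication by elements of the fibre is scalar, and
some element is the identity. By Nakayama's lemma `I` is generated by an idempotent `e` which is
full (`1 = ∑ aᵢ e bᵢ`) and of rank one (`e z e` is a multiple of `e`), see
`exists_idempotent_of_isLocalRing`. The idempotents `e` and `σ(e)` are equivalent through elements
`u`, `v` (`exists_equivalence_of_idempotents`). These finitely many elements and equations extend
to an open set `U`, which gives a `Splitting` over `U`: there `𝒯 = (D ⊗ O_X) e`, and
`ℒ_σ = σ(e) (D ⊗ O_X) e` is free with basis `u`.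

*Local freeness.* Over such `U`, a section `z` of `V ⊗ 𝒯` is `mult z ⊗ e`, where `mult` is the
multiplication map to `V` (`Splitting.tmul_mult`). So `V ⊗ 𝒯` is a retract of `V`, and a retract of
a free module is locally free since idempotent matrices over local rings split
(`exists_basis_of_retract`). In the same way `𝒯` is a retract of `D ⊗ O_X`.

*Equivalence.* The functor `M ↦ Hom(𝒯, M)` is inverse to `V ↦ V ⊗ 𝒯`: the unit and the counit are
isomorphisms over every `U` as above, by the Morita relations `1 = ∑ aᵢ e bᵢ` and `e z e = c e`.

*Dualities.* The map `θ(f ⊗ t)(z) = σ(t) f(mult z)` is bijective over `U`; a homomorphism `G` from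
`V ⊗ 𝒯` to `ℒ_σ` comes from `v ↦ ∑ G(v aᵢ ⊗ e) bᵢ`, which is a homomorphism of right modules from
`V` to `D ⊗ O_X`. As `V♯` is isomorphic to `Hom(𝒯, V♯ ⊗ 𝒯)`, hence to `Hom(𝒯, Hom(V ⊗ 𝒯, ℒ_σ))`, it
is locally free. The compatibility of `θ` with the dualities amounts to `σ(s) = -s` for all `s` in
`ℒ_σ`: over a splitting field, `e` is a product `v w` of a column and a row, and for `y` in the left
ideal generated by `e` the product `σ(y) y` has a factor `zᵗ J z = 0` with the alternating matrix
`J` which defines `σ` (`onExt_mul_self_of_isSymplectic`); the claim follows by polarization, from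
`y = e` and `y = s` (`onExt_eq_neg_of_isSymplectic`). That `π` is an isomorphism now follows from
the same property of `ϖ`.

*Witt groups.* A duality-preserving equivalence which preserves and reflects exact sequences
induces an isomorphism of Witt groups (`DualityPreserving.exists_wittEquiv`). Exactness is
preserved and reflected because over `U` a section `z` of `V ⊗ 𝒯` is given by `mult z`, and a
section `v` of `V` by its components `v aᵢ ⊗ e` (`LocallySplit.isExactSeq_iff`).
-/

namespace SBWitt

noncomputable section

/-! ### Tensor products over `D ⊗ O_X` -/

section TensorSheaf

variable {k : Type u} [Field k] {D : Type u} [Ring D] [Algebra k D]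
  {X : Scheme.{u}} [X.Over (Spec (.of k))]
  {V : RMod k D X} {T : X.Modules} {l : D → (T ⟶ T)}

/-- The map from the tensor product of sections to the sections of the tensor product sheaf. -/
def tensorUnit (V : RMod k D X) (T : X.Modules) (l : D → (T ⟶ T)) (U : X.Opens) :
    Γ(V.mod, U) ⊗[Γ(X, U)] Γ(T, U) →ₗ[Γ(X, U)] Γ(tensorSheaf V T l, U) where
  toFun x := (((PresheafOfModules.sheafificationAdjunction (𝟙 X.ringCatSheaf.obj)).unit.app
    (tensorPre V T l)).app (op U)).hom (Submodule.Quotient.mk x)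
  map_add' x y := (((PresheafOfModules.sheafificationAdjunction (𝟙 X.ringCatSheaf.obj)).unit.app
    (tensorPre V T l)).app (op U)).hom.map_add
      (Submodule.Quotient.mk x : (Γ(V.mod, U) ⊗[Γ(X, U)] Γ(T, U)) ⧸ tensorRel V T l U)
      (Submodule.Quotient.mk y : (Γ(V.mod, U) ⊗[Γ(X, U)] Γ(T, U)) ⧸ tensorRel V T l U)
  map_smul' a x := (((PresheafOfModules.sheafificationAdjunction (𝟙 X.ringCatSheaf.obj)).unit.app
    (tensorPre V T l)).app (op U)).hom.map_smul a
      (Submodule.Quotient.mk x : (Γ(V.mod, U) ⊗[Γ(X, U)] Γ(T, U)) ⧸ tensorRel V T l U)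

theorem tensorUnit_tmul {U : X.Opens} (v : Γ(V.mod, U)) (t : Γ(T, U)) :
    tensorUnit V T l U (v ⊗ₜ t) = tmul v t := rfl

theorem add_tmul {U : X.Opens} (v w : Γ(V.mod, U)) (t : Γ(T, U)) :
    tmul (l := l) (v + w) t = tmul v t + tmul w t := by
  simp only [← tensorUnit_tmul, TensorProduct.add_tmul, map_add]

theorem tmul_add {U : X.Opens} (v : Γ(V.mod, U)) (t t' : Γ(T, U)) :
    tmul (l := l) v (t + t') = tmul v t + tmul v t' := by
  simp only [← tensorUnit_tmul, TensorProduct.tmul_add, map_add]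

theorem smul_tmul {U : X.Opens} (a : Γ(X, U)) (v : Γ(V.mod, U)) (t : Γ(T, U)) :
    tmul (l := l) (a • v) t = a • tmul v t := by
  simp only [← tensorUnit_tmul, ← map_smul, TensorProduct.smul_tmul']

theorem tmul_smul {U : X.Opens} (a : Γ(X, U)) (v : Γ(V.mod, U)) (t : Γ(T, U)) :
    tmul (l := l) v (a • t) = a • tmul v t := by
  simp only [← tensorUnit_tmul, ← map_smul, TensorProduct.tmul_smul]

theorem zero_tmul {U : X.Opens} (t : Γ(T, U)) : tmul (l := l) (0 : Γ(V.mod, U)) t = 0 := by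
  rw [← tensorUnit_tmul, TensorProduct.zero_tmul, map_zero]

theorem tmul_zero {U : X.Opens} (v : Γ(V.mod, U)) : tmul (l := l) v (0 : Γ(T, U)) = 0 := by
  rw [← tensorUnit_tmul, TensorProduct.tmul_zero, map_zero]

theorem tmul_act {U : X.Opens} (v : Γ(V.mod, U)) (d : D) (t : Γ(T, U)) :
    tmul (l := l) (sec (V.act d) U v) t = tmul v (sec (l d) U t) := by
  have : (Submodule.Quotient.mk (sec (V.act d) U v ⊗ₜ t) :
      (Γ(V.mod, U) ⊗[Γ(X, U)] Γ(T, U)) ⧸ tensorRel V T l U) =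
      Submodule.Quotient.mk (v ⊗ₜ sec (l d) U t) :=
    (Submodule.Quotient.eq _).2 (Submodule.subset_span ⟨v, d, t, rfl⟩)
  exact congrArg (((PresheafOfModules.sheafificationAdjunction (𝟙 X.ringCatSheaf.obj)).unit.app
    (tensorPre V T l)).app (op U)).hom this

theorem res_tensorUnit {U W : X.Opens} (h : W ≤ U) (x : Γ(V.mod, U) ⊗[Γ(X, U)] Γ(T, U)) :
    res (tensorSheaf V T l) h (tensorUnit V T l U x) =
      tensorUnit V T l W (tensorRes V.mod T h x) :=
  (PresheafOfModules.naturality_apply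
    ((PresheafOfModules.sheafificationAdjunction (𝟙 X.ringCatSheaf.obj)).unit.app
    (tensorPre V T l)) (homOfLE h).op (Submodule.Quotient.mk x)).symm

theorem res_tmul {U W : X.Opens} (h : W ≤ U) (v : Γ(V.mod, U)) (t : Γ(T, U)) :
    res (tensorSheaf V T l) h (tmul v t) = tmul (res V.mod h v) (res T h t) :=
  res_tensorUnit h (v ⊗ₜ t)

theorem tensorMap_tmul {W : RMod k D X} (f : V ⟶ W) {U : X.Opens} (v : Γ(V.mod, U)) (t : Γ(T, U)) :
    sec ((tensorFunctor T l).map f) U (tmul v t) = tmul (sec f.hom U v) t := by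
  have := congrArg (fun q => (PresheafOfModules.Hom.app q (op U)).hom
      (Submodule.Quotient.mk (v ⊗ₜ[Γ(X, U)] t)))
    ((PresheafOfModules.sheafificationAdjunction (𝟙 X.ringCatSheaf.obj)).unit.naturality
      (tensorPreMap T l f))
  exact this.symm

/-- Every section of the tensor product is locally in the image of the tensor product of
sections. -/
theorem exists_tensorUnit {U : X.Opens} (z : Γ(tensorSheaf V T l, U)) {p : X} (hp : p ∈ U) :
    ∃ (W : X.Opens) (h : W ≤ U), p ∈ W ∧ ∃ x, res _ h z = tensorUnit V T l W x := by
  have := Presheaf.isLocallySurjective_toSheafify' (Opens.grothendieckTopology X)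
    (tensorPre V T l).presheaf
  have h1 := this.imageSieve_mem (U := U) z
  obtain ⟨W, f, ⟨x, hx⟩, hW⟩ := h1 p hp
  obtain ⟨x, rfl⟩ := Submodule.mkQ_surjective (tensorRel V T l W) x
  exact ⟨W, f.le, hW, x, hx.symm⟩

/-- To check a local property of the sections of the tensor product, which is stable under sums,
it suffices to check it on `v ⊗ t`. -/
theorem tensor_induction {P : ∀ U : X.Opens, Γ(tensorSheaf V T l, U) → Prop}
    (hloc : ∀ U z, (∀ p ∈ U, ∃ (W : X.Opens) (h : W ≤ U), p ∈ W ∧ P W (res _ h z)) → P U z)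
    (h0 : ∀ U, P U 0) (hadd : ∀ U z w, P U z → P U w → P U (z + w))
    (htmul : ∀ U v t, P U (tmul v t)) (U : X.Opens) (z : Γ(tensorSheaf V T l, U)) : P U z := by
  refine hloc U z fun p hp => ?_
  obtain ⟨W, h, hpW, x, hx⟩ := exists_tensorUnit z hp
  refine ⟨W, h, hpW, ?_⟩
  rw [hx]
  clear hx
  induction x with
  | zero => rw [map_zero]; exact h0 W
  | add x y hx hy => rw [map_add]; exact hadd W _ _ hx hy
  | tmul v t => exact htmul W v t

theorem tensor_hom_ext {Q : X.Modules} {f g : tensorSheaf V T l ⟶ Q}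
    (h : ∀ U (v : Γ(V.mod, U)) (t : Γ(T, U)), sec f U (tmul v t) = sec g U (tmul v t)) :
    f = g := by
  refine sec_ext (tensor_induction (P := fun U z => sec f U z = sec g U z) ?_ ?_ ?_ h)
  · intro U z hz
    refine eq_of_local _ _ _ fun p hp => ?_
    obtain ⟨W, hW, hpW, e⟩ := hz p hp
    exact ⟨W, hW, hpW, by rw [← sec_res, ← sec_res, e]⟩
  · intro U; simp
  · intro U z w hz hw; rw [map_add, map_add, hz, hw]

/-- Sections of the sheaf of homomorphisms from a tensor product are determined by their values
on `v ⊗ t`. -/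
theorem tensor_ev_ext {Q : X.Modules} {U : X.Opens} {f g : Γ(homSheaf (tensorSheaf V T l) Q, U)}
    (h : ∀ (W : X.Opens) (hW : W ≤ U) (v : Γ(V.mod, W)) (t : Γ(T, W)),
      ev f hW (tmul v t) = ev g hW (tmul v t)) : f = g := by
  refine ev_ext fun W hW z => ?_
  refine tensor_induction (P := fun W z => ∀ hW : W ≤ U, ev f hW z = ev g hW z)
    ?_ ?_ ?_ (fun W v t hW => h W hW v t) W z hW
  · intro W z hz hW
    refine eq_of_local _ _ _ fun p hp => ?_
    obtain ⟨W', hW', hpW, e⟩ := hz p hp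
    exact ⟨W', hW', hpW, by rw [← res_ev f hW hW', ← res_ev g hW hW', e]⟩
  · intro W hW; rw [map_zero, map_zero]
  · intro W z w hz hw hW; rw [map_add, map_add, hz, hw]

section Lift

variable {Q : X.Modules} (b : ∀ U : X.Opens, Γ(V.mod, U) →ₗ[Γ(X, U)] Γ(T, U) →ₗ[Γ(X, U)] Γ(Q, U))
  (hact : ∀ U v d t, b U (sec (V.act d) U v) t = b U v (sec (l d) U t))
  (hres : ∀ {U W : X.Opens} (h : W ≤ U) v t,
    b W (res V.mod h v) (res T h t) = res Q h (b U v t))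

/-- The linear map on the presheaf tensor product given by a balanced bilinear map. -/
def tensorLiftSec (U : X.Opens) :
    (Γ(V.mod, U) ⊗[Γ(X, U)] Γ(T, U)) ⧸ tensorRel V T l U →ₗ[Γ(X, U)] Γ(Q, U) :=
  Submodule.liftQ _ (TensorProduct.lift (b U)) (by
    refine Submodule.span_le.2 ?_
    rintro _ ⟨v, d, t, rfl⟩
    change TensorProduct.lift (b U) _ = 0
    rw [map_sub, TensorProduct.lift.tmul, TensorProduct.lift.tmul, hact, sub_self])

/-- The morphism of presheaves given by a balanced bilinear map. -/
def tensorLiftPre : tensorPre V T l ⟶ (PresheafOfModules.restrictScalars (𝟙 X.ringCatSheaf.obj)).obj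
    ((SheafOfModules.forget X.ringCatSheaf).obj Q) :=
  PresheafOfModules.homMk
    { app := fun U => AddCommGrpCat.ofHom (tensorLiftSec b hact U.unop).toAddMonoidHom
      naturality := fun U U' i => by
        ext x
        obtain ⟨x, rfl⟩ := Submodule.mkQ_surjective (tensorRel V T l U.unop) x
        change TensorProduct.lift (b U'.unop) (tensorRes V.mod T i.unop.le x) =
          res Q i.unop.le (TensorProduct.lift (b U.unop) x)
        induction x with
        | zero => simp
        | add x y hx hy => simp only [map_add, hx, hy]
        | tmul m n =>
          rw [tensorRes_tmul, TensorProduct.lift.tmul, TensorProduct.lift.tmul, hres] }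
    (fun U (a : Γ(X, U.unop)) (x : (Γ(V.mod, U.unop) ⊗[Γ(X, U.unop)] Γ(T, U.unop)) ⧸
        tensorRel V T l U.unop) => map_smul (tensorLiftSec b hact U.unop) a x)

/-- The universal property of the tensor product over `D ⊗ O_X`: balanced bilinear maps on
sections, compatible with restrictions, define a morphism. -/
def tensorLift : tensorSheaf V T l ⟶ Q :=
  ((PresheafOfModules.sheafificationAdjunction (𝟙 X.ringCatSheaf.obj)).homEquiv
    (tensorPre V T l) Q).symm (tensorLiftPre b hact hres)

theorem tensorLift_tmul {U : X.Opens} (v : Γ(V.mod, U)) (t : Γ(T, U)) :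
    sec (tensorLift b hact hres) U (tmul v t) = b U v t := by
  have h := (Adjunction.homEquiv_unit
    (PresheafOfModules.sheafificationAdjunction (𝟙 X.ringCatSheaf.obj)) (tensorPre V T l) Q
    (tensorLift b hact hres)).symm.trans
      (((PresheafOfModules.sheafificationAdjunction (𝟙 X.ringCatSheaf.obj)).homEquiv
        (tensorPre V T l) Q).apply_symm_apply (tensorLiftPre b hact hres))
  have := congrArg (fun q => (PresheafOfModules.Hom.app q (op U)).hom
      (Submodule.Quotient.mk (v ⊗ₜ[Γ(X, U)] t) :
        (Γ(V.mod, U) ⊗[Γ(X, U)] Γ(T, U)) ⧸ tensorRel V T l U)) h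
  refine Eq.trans this ?_
  exact TensorProduct.lift.tmul _ _

end Lift

theorem tensorFunctor_additive : (tensorFunctor (k := k) (D := D) T l).Additive where
  map_add {V W f g} := tensor_hom_ext fun U v t => by
    refine (tensorMap_tmul (f + g) v t).trans ?_
    refine (add_tmul (sec f.hom U v) (sec g.hom U v) t).trans ?_
    rw [← tensorMap_tmul f, ← tensorMap_tmul g]
    rfl

end TensorSheaf

/-! ### Sections, exactness and bases of sheaves of modules -/

section LocalTools

variable {X : Scheme.{u}}

/-- If a morphism is injective on sections, then sections which are locally in its image are
in its image. -/
theorem exists_of_local {M N : X.Modules} (f : M ⟶ N) (hf : ∀ U, Function.Injective (sec f U))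
    {U : X.Opens} (y : Γ(N, U))
    (h : ∀ p ∈ U, ∃ (W : X.Opens) (hW : W ≤ U), p ∈ W ∧ ∃ x, sec f W x = res N hW y) :
    ∃ x, sec f U x = y := by
  choose W hW hp x hx using h
  obtain ⟨t, ht⟩ := glue' M (V := U) (fun p : U => W p p.2) (fun p => hW p p.2)
    (fun p hpU => TopologicalSpace.Opens.mem_iSup.2 ⟨⟨p, hpU⟩, hp p hpU⟩) (fun p => x p p.2)
    (fun p q => hf _ (by rw [sec_res, sec_res, hx p p.2, hx q q.2, res_res, res_res]))
  refine ⟨t, eq_of_local _ _ _ fun p hpU => ⟨W p hpU, hW p hpU, hp p hpU, ?_⟩⟩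
  rw [← sec_res, ht ⟨p, hpU⟩, hx p hpU]

theorem isIso_of_bijective {M N : X.Modules} (f : M ⟶ N) (hf : ∀ U, Function.Bijective (sec f U)) :
    IsIso f := by
  let e := fun U => LinearEquiv.ofBijective (sec f U) (hf U)
  have he : ∀ U x, sec f U ((e U).symm x) = x := fun U x => (e U).apply_symm_apply x
  refine ⟨homMk (fun U => (e U).symm.toLinearMap) (fun {U V} h x => ?_), sec_ext fun U x => ?_,
    sec_ext fun U x => ?_⟩
  · apply (hf V).1
    change sec f V ((e V).symm _) = sec f V (res M h ((e U).symm x))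
    rw [he, sec_res, he]
  · exact (e U).symm_apply_apply x
  · exact he U x

/-- A morphism which is bijective on all sufficiently small open sets is an isomorphism. -/
theorem isIso_of_local {M N : X.Modules} (f : M ⟶ N)
    (hf : ∀ x : X, ∃ U : X.Opens, x ∈ U ∧ ∀ V ≤ U, Function.Bijective (sec f V)) : IsIso f := by
  have inj : ∀ U, Function.Injective (sec f U) := by
    intro U x y h
    refine eq_of_local _ _ _ fun p hp => ?_
    obtain ⟨W, hpW, hW⟩ := hf p
    refine ⟨W ⊓ U, inf_le_right, ⟨hpW, hp⟩, (hW _ inf_le_left).1 ?_⟩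
    rw [sec_res, sec_res, h]
  refine isIso_of_bijective f fun U => ⟨inj U, fun y => exists_of_local f inj y fun p hp => ?_⟩
  obtain ⟨W, hpW, hW⟩ := hf p
  exact ⟨W ⊓ U, inf_le_right, ⟨hpW, hp⟩, (hW _ inf_le_left).2 _⟩

theorem bijective_of_isIso {M N : X.Modules} (f : M ⟶ N) [IsIso f] (U : X.Opens) :
    Function.Bijective (sec f U) := by
  refine Function.bijective_iff_has_inverse.2 ⟨sec (inv f) U, fun x => ?_, fun x => ?_⟩
  · rw [← sec_comp, IsIso.hom_inv_id, sec_id]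
  · rw [← sec_comp, IsIso.inv_hom_id, sec_id]

/-- The kernel of a morphism of `O_X`-modules. -/
def kerSheaf {M N : X.Modules} (f : M ⟶ N) : X.Modules :=
  subMk M (fun U => LinearMap.ker (sec f U))
    (fun h x hx => by
      rw [LinearMap.mem_ker] at hx ⊢
      rw [sec_res, hx, map_zero])
    (fun {U} x hx => by
      refine eq_of_local _ _ _ fun p hp => ?_
      obtain ⟨V, hV, hpV, h⟩ := hx p hp
      exact ⟨V, hV, hpV, by rw [map_zero, ← sec_res]; exact h⟩)

/-- The inclusion of the kernel. -/
def kerι {M N : X.Modules} (f : M ⟶ N) : kerSheaf f ⟶ M :=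
  homMk (M := kerSheaf f) (fun U => (LinearMap.ker (sec f U)).subtype) (fun _ _ => rfl)

/-- A section of the kernel. -/
def kerMk {M N : X.Modules} (f : M ⟶ N) {U : X.Opens} (x : Γ(M, U)) (hx : sec f U x = 0) :
    Γ(kerSheaf f, U) := (⟨x, hx⟩ : LinearMap.ker (sec f U))

theorem kerι_kerMk {M N : X.Modules} (f : M ⟶ N) {U : X.Opens} (x : Γ(M, U))
    (hx : sec f U x = 0) : sec (kerι f) U (kerMk f x hx) = x := rfl

theorem kerι_comp {M N : X.Modules} (f : M ⟶ N) : kerι f ≫ f = 0 :=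
  sec_ext fun U (x : LinearMap.ker (sec f U)) => x.2

theorem injective_of_mono {M N : X.Modules} (f : M ⟶ N) [Mono f] (U : X.Opens) :
    Function.Injective (sec f U) := by
  have h : kerι f = 0 := by
    rw [← cancel_mono f, kerι_comp, Limits.zero_comp]
  refine (injective_iff_map_eq_zero _).2 fun x hx => ?_
  rw [← kerι_kerMk f x hx, h, sec_zero]

/-- The sheaf of sections which are locally in the image of a morphism. -/
def imSheaf {M N : X.Modules} (f : M ⟶ N) : X.Modules :=
  subMk N (fun U =>
      { carrier := {y | ∀ p ∈ U, ∃ (W : X.Opens) (hW : W ≤ U), p ∈ W ∧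
          res N hW y ∈ LinearMap.range (sec f W)}
        zero_mem' := fun p hp => ⟨U, le_rfl, hp, by rw [map_zero]; exact zero_mem _⟩
        add_mem' := fun {y z} hy hz p hp => by
          obtain ⟨W, hW, hpW, a, ha⟩ := hy p hp
          obtain ⟨W', hW', hpW', b, hb⟩ := hz p hp
          refine ⟨W ⊓ W', inf_le_left.trans hW, ⟨hpW, hpW'⟩,
            res M inf_le_left a + res M inf_le_right b, ?_⟩
          rw [map_add, sec_res, sec_res, ha, hb, res_res, res_res, map_add]
        smul_mem' := fun c y hy p hp => by
          obtain ⟨W, hW, hpW, a, ha⟩ := hy p hp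
          exact ⟨W, hW, hpW, resO hW c • a, by rw [map_smul, ha, res_smul]⟩ })
    (fun {U V} h y hy p hp => by
      obtain ⟨W, hW, hpW, a, ha⟩ := hy p (h hp)
      refine ⟨W ⊓ V, inf_le_right, ⟨hpW, hp⟩, res M inf_le_left a, ?_⟩
      rw [sec_res, ha, res_res, res_res])
    (fun {U} y hy p hp => by
      obtain ⟨V, hV, hpV, h⟩ := hy p hp
      obtain ⟨W, hW, hpW, a, ha⟩ := h p hpV
      exact ⟨W, hW.trans hV, hpW, a, by rw [ha, res_res]⟩)

/-- An epimorphism factors through its image sheaf, so the inclusion of the image is both a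
monomorphism and an epimorphism, hence an isomorphism. -/
theorem locally_surjective_of_epi {M N : X.Modules} (f : M ⟶ N) [Epi f] {U : X.Opens}
    (y : Γ(N, U)) {p : X} (hp : p ∈ U) :
    ∃ (W : X.Opens) (hW : W ≤ U), p ∈ W ∧ ∃ x, sec f W x = res N hW y := by
  let i : imSheaf f ⟶ N := homMk (M := imSheaf f) (fun U => Submodule.subtype _) (fun _ _ => rfl)
  let g : M ⟶ imSheaf f := homMk (N := imSheaf f) (fun U =>
      { toFun := fun x => ⟨sec f U x, fun p hp => ⟨U, le_rfl, hp, x, (res_self _ _ _).symm⟩⟩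
        map_add' := fun x y => Subtype.ext (map_add _ x y)
        map_smul' := fun a x => Subtype.ext (map_smul _ a x) })
    (fun h x => Subtype.ext (sec_res f h x))
  have hgi : g ≫ i = f := sec_ext fun _ _ => rfl
  have : Epi i := by
    have : Epi (g ≫ i) := by rw [hgi]; infer_instance
    exact epi_of_epi g i
  have : Mono i := by
    refine ⟨fun a b h => sec_ext fun U x => Subtype.ext ?_⟩
    exact congrArg (fun q => sec q U x) h
  have : IsIso i := isIso_of_mono_of_epi i
  obtain ⟨z, rfl⟩ := (bijective_of_isIso i U).2 y
  obtain ⟨W, hW, hpW, a, ha⟩ := z.2 p hp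
  exact ⟨W, hW, hpW, a, ha⟩

/-- Short exact sequences of `O_X`-modules in terms of sections. -/
theorem shortExact_iff (S : ShortComplex X.Modules) : S.ShortExact ↔
    (∀ U, Function.Injective (sec S.f U)) ∧
    (∀ (U : X.Opens) (y : Γ(S.X₂, U)), sec S.g U y = 0 → ∀ p ∈ U,
      ∃ (W : X.Opens) (hW : W ≤ U), p ∈ W ∧ ∃ x, sec S.f W x = res S.X₂ hW y) ∧
    (∀ (U : X.Opens) (z : Γ(S.X₃, U)), ∀ p ∈ U,
      ∃ (W : X.Opens) (hW : W ≤ U), p ∈ W ∧ ∃ y, sec S.g W y = res S.X₃ hW z) := by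
  constructor
  · intro h
    have := h.mono_f
    have := h.epi_g
    refine ⟨injective_of_mono S.f, fun U y hy p hp => ?_, fun U z p hp =>
      locally_surjective_of_epi S.g z hp⟩
    let l := h.exact.lift (kerι S.g) (kerι_comp S.g)
    have hl : l ≫ S.f = kerι S.g := h.exact.lift_f _ _
    exact ⟨U, le_rfl, hp, sec l U (kerMk S.g y hy), by
      rw [← sec_comp, hl, res_self, kerι_kerMk]⟩
  · rintro ⟨h1, h2, h3⟩
    have hm : Mono S.f := ⟨fun a b h => sec_ext fun U x => h1 U
      (congrArg (fun q => sec q U x) h)⟩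
    have he : Epi S.g := by
      refine ⟨fun a b h => sec_ext fun U z => eq_of_local _ _ _ fun p hp => ?_⟩
      obtain ⟨W, hW, hpW, y, hy⟩ := h3 U z p hp
      refine ⟨W, hW, hpW, ?_⟩
      rw [← sec_res, ← sec_res, ← hy]
      exact congrArg (fun q => sec q W y) h
    have hex : ∀ (A : X.Modules) (a : A ⟶ S.X₂), a ≫ S.g = 0 → ∀ U x, ∃ y, sec S.f U y = sec a U x := by
      intro A a ha U x
      have := h2 U (sec a U x) (congrArg (fun q => sec q U x) ha)
      exact exists_of_local S.f h1 _ this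
    refine ⟨S.exact_of_f_is_kernel (Limits.KernelFork.IsLimit.ofι' _ _ fun {A} a ha => ?_)⟩
    choose l hl using hex A a ha
    refine ⟨homMk (fun U =>
      { toFun := l U
        map_add' := fun x y => h1 U (by rw [map_add, hl, hl, hl, map_add])
        map_smul' := fun c x => h1 U (by
          rw [RingHom.id_apply, map_smul, hl, hl, map_smul]) })
      (fun {U V} h x => h1 V ?_), sec_ext hl⟩
    change sec S.f V (l V _) = sec S.f V (res _ h (l U x))
    rw [sec_res, hl, hl, sec_res]

/-- The sections `e` form a basis of the restriction of `M` to `U`. -/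
def IsBasisOn (M : X.Modules) (U : X.Opens) {ι : Type*} [Fintype ι] (e : ι → Γ(M, U)) : Prop :=
  ∀ (V : X.Opens) (h : V ≤ U),
    Function.Bijective fun c : ι → Γ(X, V) => ∑ i, c i • res M h (e i)

namespace IsBasisOn

variable {M N : X.Modules} {U : X.Opens} {ι κ : Type*} [Fintype ι] [Fintype κ] {e : ι → Γ(M, U)}

theorem res (hb : IsBasisOn M U e) {V : X.Opens} (h : V ≤ U) :
    IsBasisOn M V (fun i => SBWitt.res M h (e i)) := fun W hW => by
  simpa only [res_res] using hb W (hW.trans h)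

/-- The coordinates of a section with respect to a basis. -/
def coord (hb : IsBasisOn M U e) {V : X.Opens} (h : V ≤ U) : Γ(M, V) ≃ₗ[Γ(X, V)] (ι → Γ(X, V)) :=
  (LinearEquiv.ofBijective
    { toFun := fun c : ι → Γ(X, V) => ∑ i, c i • SBWitt.res M h (e i)
      map_add' := fun c d => by simp only [Pi.add_apply, add_smul, Finset.sum_add_distrib]
      map_smul' := fun a c => by
        simp only [Pi.smul_apply, smul_eq_mul, mul_smul, Finset.smul_sum, RingHom.id_apply] }
    (hb V h)).symm

theorem sum_coord (hb : IsBasisOn M U e) {V : X.Opens} (h : V ≤ U) (x : Γ(M, V)) :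
    ∑ i, hb.coord h x i • SBWitt.res M h (e i) = x :=
  (hb.coord h).symm_apply_apply x

theorem coord_sum (hb : IsBasisOn M U e) {V : X.Opens} (h : V ≤ U) (c : ι → Γ(X, V)) :
    hb.coord h (∑ i, c i • SBWitt.res M h (e i)) = c :=
  (hb.coord h).apply_symm_apply c

theorem coord_res (hb : IsBasisOn M U e) {V W : X.Opens} (h : V ≤ U) (h' : W ≤ V) (x : Γ(M, V))
    (i : ι) : hb.coord (h'.trans h) (SBWitt.res M h' x) i = resO h' (hb.coord h x i) := by
  have : SBWitt.res M h' x =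
      ∑ i, resO h' (hb.coord h x i) • SBWitt.res M (h'.trans h) (e i) := by
    conv_lhs => rw [← hb.sum_coord h x]
    rw [map_sum]
    simp only [res_smul, res_res]
  rw [this, coord_sum]

/-- The morphism from the restriction of `M` with given values on a basis. -/
def lift (hb : IsBasisOn M U e) (y : ι → Γ(N, U)) : Γ(homSheaf M N, U) :=
  evMk (fun V h =>
      { toFun := fun x => ∑ i, hb.coord h x i • SBWitt.res N h (y i)
        map_add' := fun x x' => by
          simp only [map_add, Pi.add_apply, add_smul, Finset.sum_add_distrib]
        map_smul' := fun a x => by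
          simp only [map_smul, Pi.smul_apply, smul_eq_mul, mul_smul, Finset.smul_sum,
            RingHom.id_apply] })
    (fun {V W} hV h x => by
      change ∑ i, hb.coord (h.trans hV) (SBWitt.res M h x) i • SBWitt.res N (h.trans hV) (y i) =
        SBWitt.res N h (∑ i, hb.coord hV x i • SBWitt.res N hV (y i))
      rw [map_sum]
      refine Finset.sum_congr rfl fun i _ => ?_
      rw [res_smul, res_res, coord_res hb])

theorem ev_lift (hb : IsBasisOn M U e) (y : ι → Γ(N, U)) {V : X.Opens} (h : V ≤ U) (x : Γ(M, V)) :
    ev (hb.lift y) h x = ∑ i, hb.coord h x i • SBWitt.res N h (y i) := rfl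

theorem coord_self [DecidableEq ι] (hb : IsBasisOn M U e) {V : X.Opens} (h : V ≤ U) (i : ι) :
    hb.coord h (SBWitt.res M h (e i)) = Pi.single i 1 := by
  rw [← hb.coord_sum h (Pi.single i 1)]
  congr 1
  rw [Finset.sum_eq_single i]
  · rw [Pi.single_eq_same, one_smul]
  · intro j _ hj
    rw [Pi.single_eq_of_ne hj, zero_smul]
  · simp

theorem ev_lift_self (hb : IsBasisOn M U e) (y : ι → Γ(N, U)) {V : X.Opens} (h : V ≤ U) (i : ι) :
    ev (hb.lift y) h (SBWitt.res M h (e i)) = SBWitt.res N h (y i) := by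
  classical
  rw [ev_lift, hb.coord_self h, Finset.sum_eq_single i]
  · rw [Pi.single_eq_same, one_smul]
  · intro j _ hj
    rw [Pi.single_eq_of_ne hj, zero_smul]
  · simp

theorem hom_ext (hb : IsBasisOn M U e) {f g : Γ(homSheaf M N, U)}
    (h : ∀ i, ev f le_rfl (e i) = ev g le_rfl (e i)) : f = g := by
  refine ev_ext fun V hV x => ?_
  rw [← hb.sum_coord hV x, map_sum, map_sum]
  refine Finset.sum_congr rfl fun i _ => ?_
  rw [map_smul, map_smul, res_ev f le_rfl hV, res_ev g le_rfl hV, h]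

theorem reindex (hb : IsBasisOn M U e) (f : κ ≃ ι) : IsBasisOn M U (fun i => e (f i)) := by
  intro V h
  have := (hb V h).comp (Equiv.arrowCongr f (Equiv.refl Γ(X, V))).bijective
  convert this using 1
  funext c
  simp only [Function.comp_apply]
  exact Fintype.sum_equiv f _ _ fun i => by simp [Equiv.arrowCongr]

/-- A basis of the sheaf of homomorphisms between two free sheaves. -/
theorem homSheaf [DecidableEq ι] (hb : IsBasisOn M U e) {f : κ → Γ(N, U)}
    (hb' : IsBasisOn N U f) :
    IsBasisOn (homSheaf M N) U (fun p : ι × κ =>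
      hb.lift (fun i => if i = p.1 then f p.2 else 0)) := by
  intro V h
  have key : ∀ (c : ι × κ → Γ(X, V)) (i : ι),
      ev (∑ p, c p • SBWitt.res (SBWitt.homSheaf M N) h
        (hb.lift (fun i => if i = p.1 then f p.2 else 0))) le_rfl (SBWitt.res M h (e i)) =
      ∑ j, c (i, j) • SBWitt.res N h (f j) := by
    intro c i
    have hs : ∀ g : ι × κ → Γ(SBWitt.homSheaf M N, V),
        ev (∑ p, g p) le_rfl (SBWitt.res M h (e i)) =
          ∑ p, ev (g p) le_rfl (SBWitt.res M h (e i)) := fun g =>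
      map_sum ({ toFun := fun q => ev q le_rfl (SBWitt.res M h (e i))
                 map_zero' := rfl
                 map_add' := fun _ _ => rfl } : Γ(SBWitt.homSheaf M N, V) →+ Γ(N, V)) g _
    rw [hs, Fintype.sum_prod_type, Finset.sum_eq_single i]
    · refine Finset.sum_congr rfl fun j _ => ?_
      rw [ev_smul, ev_res, ev_lift_self, if_pos rfl, resO_self]
    · intro i' _ hi'
      refine Finset.sum_eq_zero fun j _ => ?_
      rw [ev_smul, ev_res, ev_lift_self, if_neg (Ne.symm hi'), map_zero, smul_zero]
    · simp
  constructor
  · intro c d hcd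
    funext ⟨i, j⟩
    have h1 := congrArg (fun q => ev (M := M) (N := N) q le_rfl (SBWitt.res M h (e i))) hcd
    dsimp only at h1
    rw [key, key] at h1
    exact congrFun ((hb' V h).1 h1) j
  · intro g
    refine ⟨fun p => hb'.coord h (ev g le_rfl (SBWitt.res M h (e p.1))) p.2, ?_⟩
    apply IsBasisOn.hom_ext (hb.res h)
    intro i
    refine (key _ i).trans ?_
    exact hb'.sum_coord h (ev g le_rfl (SBWitt.res M h (e i)))

end IsBasisOn

theorem isLocFree_of_basis {M : X.Modules} (h : ∀ x : X, ∃ (U : X.Opens) (ι : Type) (_ : Fintype ι)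
    (e : ι → Γ(M, U)), x ∈ U ∧ IsBasisOn M U e) : IsLocFree M := by
  intro x
  obtain ⟨U, ι, _, e, hx, he⟩ := h x
  exact ⟨U, Fintype.card ι, _, hx, he.reindex (Fintype.equivFin ι).symm⟩

theorem IsLocFree.homSheaf {M N : X.Modules} (hM : IsLocFree M) (hN : IsLocFree N) :
    IsLocFree (homSheaf M N) := by
  refine isLocFree_of_basis fun x => ?_
  obtain ⟨U, m, e, hx, he⟩ := hM x
  obtain ⟨V, n, f, hx', hf⟩ := hN x
  have he : IsBasisOn M U e := he
  have hf : IsBasisOn N V f := hf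
  exact ⟨U ⊓ V, _, _, _, ⟨hx, hx'⟩,
    (he.res (inf_le_left : U ⊓ V ≤ U)).homSheaf (hf.res (inf_le_right : U ⊓ V ≤ V))⟩

end LocalTools

/-! ### Witt groups and duality-preserving equivalences -/

section Witt

universe v w v' w' v₁ w₁ v₂ w₂

variable {C : Type w} [Category.{v} C] [Preadditive C] {δ : Duality C}
  {A : Type w₁} [Category.{v₁} A] [Abelian A]

/-- The image under `E` of the sequence `0 → L → S → Q → 0` is exact. -/
def IsSES (E : C ⥤ A) {L S Q : C} (f : L ⟶ S) (g : S ⟶ Q) : Prop :=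
  ∃ w : E.map f ≫ E.map g = 0, (ShortComplex.mk _ _ w).ShortExact

omit [Preadditive C] in
theorem IsSES.of_iso {E : C ⥤ A} {L S Q L' S' Q' : C} {f : L ⟶ S} {g : S ⟶ Q} {f' : L' ⟶ S'}
    {g' : S' ⟶ Q'} (h : IsSES E f g) (a : L ≅ L') (b : S ≅ S') (c : Q ≅ Q')
    (h₁ : a.hom ≫ f' = f ≫ b.hom) (h₂ : b.hom ≫ g' = g ≫ c.hom) : IsSES E f' g' := by
  obtain ⟨w, h⟩ := h
  have w' : E.map f' ≫ E.map g' = 0 := by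
    rw [← cancel_epi (E.map a.hom), ← Category.assoc, ← E.map_comp, h₁, E.map_comp, Category.assoc,
      ← E.map_comp, h₂, E.map_comp, reassoc_of% w, Limits.zero_comp, Limits.comp_zero]
  refine ⟨w', ShortComplex.shortExact_of_iso (ShortComplex.isoMk (E.mapIso a) (E.mapIso b)
    (E.mapIso c) ?_ ?_) h⟩
  · simp only [Functor.mapIso_hom, ← E.map_comp, h₁]
  · simp only [Functor.mapIso_hom, ← E.map_comp, h₂]

theorem isMetabolic_iff_isSES (E : C ⥤ A) (S : Space δ) : S.IsMetabolic E ↔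
    ∃ (L : C) (α : L ⟶ S.obj), IsSES E α (S.form ≫ δ.dual.map α.op) := Iff.rfl

theorem Space.Isometric.symm {S T : Space δ} (h : S.Isometric T) : T.Isometric S := by
  obtain ⟨e, he⟩ := h
  refine ⟨e.symm, ?_⟩
  rw [← he, Iso.symm_hom, Category.assoc, Category.assoc, ← δ.dual.map_comp, ← op_comp,
    e.inv_hom_id, op_id, δ.dual.map_id, e.inv_hom_id_assoc, Category.comp_id]

theorem Space.Isometric.trans {S T U : Space δ} (h : S.Isometric T) (h' : T.Isometric U) :
    S.Isometric U := by
  obtain ⟨e, he⟩ := h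
  obtain ⟨f, hf⟩ := h'
  refine ⟨e ≪≫ f, ?_⟩
  rw [← he, ← hf, Iso.trans_hom, op_comp, δ.dual.map_comp]
  simp only [Category.assoc]

theorem Space.IsOrthogonalSum.of_isometric {S P Q S' P' Q' : Space δ}
    (h : S.IsOrthogonalSum P Q) (hS : S'.Isometric S) (hP : P'.Isometric P)
    (hQ : Q'.Isometric Q) : S'.IsOrthogonalSum P' Q' := by
  obtain ⟨i, j, p, q, h1, h2, h3, h4, h5, h6⟩ := h
  obtain ⟨e, he⟩ := hS
  obtain ⟨a, ha⟩ := hP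
  obtain ⟨b, hb⟩ := hQ
  refine ⟨a.hom ≫ i ≫ e.inv, b.hom ≫ j ≫ e.inv, e.hom ≫ p ≫ a.inv, e.hom ≫ q ≫ b.inv,
    ?_, ?_, ?_, ?_, ?_, ?_⟩
  · simp [reassoc_of% h1]
  · simp [reassoc_of% h2]
  · simp [reassoc_of% h3]
  · simp [reassoc_of% h4]
  · have : e.hom ≫ (p ≫ i + q ≫ j) ≫ e.inv = 𝟙 _ := by rw [h5]; simp
    rw [← this]
    simp
  · have ea : ∀ {Y Z : C} (f : Y ≅ Z) {W : C} (g : δ.dual.obj (op Z) ⟶ W),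
        δ.dual.map f.hom.op ≫ δ.dual.map f.inv.op ≫ g = g := fun f _ g => by
      rw [← Category.assoc, ← δ.dual.map_comp, ← op_comp, f.inv_hom_id, op_id, δ.dual.map_id,
        Category.id_comp]
    rw [← he, ← ha, ← hb, h6]
    simp only [op_comp, δ.dual.map_comp, Category.assoc, Preadditive.comp_add, Preadditive.add_comp,
      Iso.inv_hom_id_assoc, ea]

theorem Space.IsMetabolic.of_isometric {E : C ⥤ A} {S S' : Space δ} (h : S.IsMetabolic E)
    (e : S.Isometric S') : S'.IsMetabolic E := by
  obtain ⟨L, α, h⟩ := (isMetabolic_iff_isSES E S).1 h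
  obtain ⟨e, he⟩ := e
  refine (isMetabolic_iff_isSES E S').2 ⟨L, α ≫ e.hom, h.of_iso (Iso.refl _) e (Iso.refl _) ?_ ?_⟩
  · simp
  · rw [← he]
    simp

/-- Homomorphisms from the Witt group are given by maps on spaces which respect the relations. -/
def WittGroup.lift {E : C ⥤ A} {G : Type*} [AddCommGroup G] (f : Space δ → G)
    (hi : ∀ S T : Space δ, S.Isometric T → f S = f T)
    (hs : ∀ S P Q : Space δ, S.IsOrthogonalSum P Q → f S = f P + f Q)
    (hm : ∀ S : Space δ, S.IsMetabolic E → f S = 0) : WittGroup δ E →+ G :=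
  QuotientAddGroup.lift _ (FreeAbelianGroup.lift f) (by
    rw [AddSubgroup.closure_le]
    rintro _ (⟨S, T, h⟩ | ⟨S, P, Q, h⟩ | ⟨S, h⟩)
    · simp [hi S T h]
    · simp [hs S P Q h]
    · simp [hm S h])

theorem WittGroup.lift_mk {E : C ⥤ A} {G : Type*} [AddCommGroup G] (f : Space δ → G) (hi) (hs)
    (hm) (S : Space δ) : WittGroup.lift (E := E) f hi hs hm (.mk E S) = f S :=
  FreeAbelianGroup.lift_apply_of f S

theorem WittGroup.hom_ext {E : C ⥤ A} {G : Type*} [AddCommGroup G] {f g : WittGroup δ E →+ G}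
    (h : ∀ S, f (.mk E S) = g (.mk E S)) : f = g := by
  refine QuotientAddGroup.addMonoidHom_ext _ (FreeAbelianGroup.lift_ext _ _ h)

theorem WittGroup.mk_isometric (E : C ⥤ A) {S T : Space δ} (h : S.Isometric T) :
    WittGroup.mk E S = .mk E T :=
  sub_eq_zero.1 ((QuotientAddGroup.eq_zero_iff _).2 (AddSubgroup.subset_closure (.isometric S T h)))

theorem WittGroup.mk_sum (E : C ⥤ A) {S P Q : Space δ} (h : S.IsOrthogonalSum P Q) :
    WittGroup.mk E S = .mk E P + .mk E Q :=
  sub_eq_zero.1 ((QuotientAddGroup.eq_zero_iff _).2 (AddSubgroup.subset_closure (.sum S P Q h)))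

theorem WittGroup.mk_metabolic {E : C ⥤ A} {S : Space δ} (h : S.IsMetabolic E) :
    WittGroup.mk E S = 0 :=
  (QuotientAddGroup.eq_zero_iff _).2 (AddSubgroup.subset_closure (.metabolic S h))

variable {C' : Type w'} [Category.{v'} C'] [Preadditive C'] {δ' : Duality C'}
  {A' : Type w₂} [Category.{v₂} A'] [Abelian A'] {F : C ⥤ C'}

namespace DualityPreserving

variable (Φ : DualityPreserving F δ δ')

theorem θ_naturality {M N : C} (m : M ⟶ N) :
    F.map (δ.dual.map m.op) ≫ Φ.θ.hom.app (op M) =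
      Φ.θ.hom.app (op N) ≫ δ'.dual.map (F.map m).op := Φ.θ.hom.naturality m.op

theorem mapSpace_form_comp (S : Space δ) {M : C} (m : M ⟶ S.obj) :
    (F.map S.form ≫ Φ.θ.hom.app (op S.obj)) ≫ δ'.dual.map (F.map m).op =
      F.map (S.form ≫ δ.dual.map m.op) ≫ Φ.θ.hom.app (op M) := by
  refine (Category.assoc _ _ _).trans
    ((congrArg (F.map S.form ≫ ·) (Φ.θ_naturality m).symm).trans ?_)
  rw [F.map_comp]
  exact (Category.assoc _ _ _).symm

theorem comp_mapSpace_form_comp (S : Space δ) {M : C} (m : M ⟶ S.obj) :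
    F.map m ≫ (F.map S.form ≫ Φ.θ.hom.app (op S.obj)) ≫ δ'.dual.map (F.map m).op =
      F.map (m ≫ S.form ≫ δ.dual.map m.op) ≫ Φ.θ.hom.app (op M) := by
  rw [mapSpace_form_comp, F.map_comp m, Category.assoc]

theorem isometric_map {S T : Space δ} (h : S.Isometric T) :
    (Φ.mapSpace S).Isometric (Φ.mapSpace T) := by
  obtain ⟨e, he⟩ := h
  exact ⟨F.mapIso e, (Φ.comp_mapSpace_form_comp T e.hom).trans (by rw [he]; rfl)⟩

theorem isometric_of_map [F.Full] [F.Faithful] {S T : Space δ}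
    (h : (Φ.mapSpace S).Isometric (Φ.mapSpace T)) : S.Isometric T := by
  obtain ⟨e, he⟩ := h
  obtain ⟨e, rfl⟩ : ∃ e' : S.obj ≅ T.obj, F.mapIso e' = e :=
    ⟨F.preimageIso e, Iso.ext (F.map_preimage e.hom)⟩
  refine ⟨e, F.map_injective ?_⟩
  rw [← cancel_mono (Φ.θ.hom.app (op S.obj))]
  exact (Φ.comp_mapSpace_form_comp T e.hom).symm.trans he

theorem isOrthogonalSum_map [F.Additive] {S P Q : Space δ} (h : S.IsOrthogonalSum P Q) :
    (Φ.mapSpace S).IsOrthogonalSum (Φ.mapSpace P) (Φ.mapSpace Q) := by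
  obtain ⟨i, j, p, q, h1, h2, h3, h4, h5, h6⟩ := h
  refine ⟨F.map i, F.map j, F.map p, F.map q,
    (F.map_comp i p).symm.trans ((congrArg F.map h1).trans (F.map_id _)),
    (F.map_comp j q).symm.trans ((congrArg F.map h2).trans (F.map_id _)),
    (F.map_comp i q).symm.trans ((congrArg F.map h3).trans (F.map_zero _ _)),
    (F.map_comp j p).symm.trans ((congrArg F.map h4).trans (F.map_zero _ _)), ?_, ?_⟩
  · change F.map p ≫ F.map i + F.map q ≫ F.map j = 𝟙 (F.obj S.obj)
    rw [← F.map_comp, ← F.map_comp, ← F.map_add, h5, F.map_id]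
  · refine Eq.trans ?_ (congrArg₂ (· + ·) (Φ.comp_mapSpace_form_comp P p).symm
      (Φ.comp_mapSpace_form_comp Q q).symm)
    change F.map S.form ≫ Φ.θ.hom.app (op S.obj) = _
    rw [h6, F.map_add, Preadditive.add_comp]
    rfl

theorem isOrthogonalSum_of_map [F.Full] [F.Faithful] [F.Additive] {S P Q : Space δ}
    (h : (Φ.mapSpace S).IsOrthogonalSum (Φ.mapSpace P) (Φ.mapSpace Q)) :
    S.IsOrthogonalSum P Q := by
  obtain ⟨i, j, p, q, h1, h2, h3, h4, h5, h6⟩ := h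
  obtain ⟨i, rfl⟩ := F.map_surjective i
  obtain ⟨j, rfl⟩ := F.map_surjective j
  obtain ⟨p, rfl⟩ := F.map_surjective p
  obtain ⟨q, rfl⟩ := F.map_surjective q
  refine ⟨i, j, p, q, ?_, ?_, ?_, ?_, ?_, ?_⟩ <;> apply F.map_injective
  · rw [F.map_comp, F.map_id]; exact h1
  · rw [F.map_comp, F.map_id]; exact h2
  · rw [F.map_comp, F.map_zero]; exact h3
  · rw [F.map_comp, F.map_zero]; exact h4
  · rw [F.map_add, F.map_comp, F.map_comp, F.map_id]; exact h5
  · rw [← cancel_mono (Φ.θ.hom.app (op S.obj)), F.map_add, Preadditive.add_comp]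
    exact h6.trans (congrArg₂ (· + ·) (Φ.comp_mapSpace_form_comp P p)
      (Φ.comp_mapSpace_form_comp Q q))

section Metabolic

variable {E : C ⥤ A} {E' : C' ⥤ A'}
  (hF : ∀ {L S Q : C} (f : L ⟶ S) (g : S ⟶ Q), IsSES E f g ↔ IsSES E' (F.map f) (F.map g))

include hF in
theorem isMetabolic_map {S : Space δ} (h : S.IsMetabolic E) : (Φ.mapSpace S).IsMetabolic E' := by
  obtain ⟨L, α, h⟩ := (isMetabolic_iff_isSES E S).1 h
  refine (isMetabolic_iff_isSES E' _).2 ⟨F.obj L, F.map α, ?_⟩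
  have e := Φ.mapSpace_form_comp S α
  refine ((hF _ _).1 h).of_iso (Iso.refl _) (Iso.refl _) (Φ.θ.app (op L)) ?_ ?_
  · exact (Category.id_comp _).trans (Category.comp_id _).symm
  · exact (Category.id_comp _).trans e

include hF in
theorem isMetabolic_of_map [F.Full] [F.EssSurj] {S : Space δ}
    (h : (Φ.mapSpace S).IsMetabolic E') : S.IsMetabolic E := by
  obtain ⟨L, α, h⟩ := (isMetabolic_iff_isSES E' _).1 h
  let e := F.objObjPreimageIso L
  obtain ⟨β, hβ⟩ := F.map_surjective (e.hom ≫ α)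
  refine (isMetabolic_iff_isSES E _).2 ⟨F.objPreimage L, β, (hF _ _).2 ?_⟩
  refine h.of_iso e.symm (Iso.refl _)
    ((δ'.dual.mapIso e.op) ≪≫ (Φ.θ.app (op (F.objPreimage L))).symm) ?_ ?_
  · have h1 : e.inv ≫ F.map β = α := by
      rw [hβ]
      exact e.inv_hom_id_assoc α
    exact h1.trans (Category.comp_id _).symm
  · refine (Category.id_comp _).trans ?_
    have h2 : δ'.dual.map (F.map β).op = δ'.dual.map (α : L ⟶ F.obj S.obj).op ≫
        δ'.dual.map e.hom.op := by
      rw [hβ, ← δ'.dual.map_comp]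
      rfl
    have h3 := Φ.mapSpace_form_comp S β
    have h4 := (Φ.θ.app (op (F.objPreimage L))).eq_comp_inv.2 (h3.symm.trans
      ((congrArg ((F.map S.form ≫ Φ.θ.hom.app (op S.obj)) ≫ ·) h2).trans
        (Category.assoc _ _ _).symm))
    exact h4.trans (Category.assoc _ _ _)

end Metabolic

/-- Every space is, up to isometry, the image of a space, since the functor is an equivalence. -/
theorem exists_mapSpace_isometric [F.Full] [F.Faithful] [F.EssSurj] (T : Space δ') :
    ∃ S : Space δ, (Φ.mapSpace S).Isometric T := by
  let M := F.objPreimage T.obj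
  let e : F.obj M ≅ T.obj := F.objObjPreimageIso T.obj
  have := T.isIso
  let ψ : F.obj M ⟶ F.obj (δ.dual.obj (op M)) :=
    (e.hom ≫ T.form ≫ δ'.dual.map e.hom.op) ≫ Φ.θ.inv.app (op M)
  obtain ⟨φ, hφ⟩ := F.map_surjective ψ
  have hψ : F.map φ ≫ Φ.θ.hom.app (op M) = e.hom ≫ T.form ≫ δ'.dual.map e.hom.op := by
    rw [hφ]
    simp only [ψ, Category.assoc]
    erw [← NatTrans.comp_app, Φ.θ.inv_hom_id]
    simp
  have hiso : IsIso (F.map φ) := by rw [hφ]; infer_instance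
  have hφiso : IsIso φ := isIso_of_fully_faithful F φ
  refine ⟨⟨M, φ, hφiso, F.map_injective ?_⟩, e, hψ.symm⟩
  rw [← cancel_mono (Φ.θ.hom.app (op M)), hψ, F.map_comp, Category.assoc]
  have h := Φ.θ.hom.naturality φ.op
  simp only [Functor.comp_map, Functor.op_map, Quiver.Hom.unop_op] at h
  erw [h]
  rw [← Category.assoc]
  erw [Φ.comm M]
  rw [Category.assoc, ← δ'.dual.map_comp, ← op_comp]
  erw [hψ]
  have hn := δ'.can.naturality e.hom
  simp only [Functor.id_map, Functor.comp_map, Functor.rightOp_map] at hn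
  rw [op_comp, op_comp, δ'.dual.map_comp, δ'.dual.map_comp]
  have hs := T.symm
  conv_rhs => rw [← hs]
  simp only [← Category.assoc]
  congr 2
  exact hn.symm

variable {E : C ⥤ A} {E' : C' ⥤ A'}
  (hF : ∀ {L S Q : C} (f : L ⟶ S) (g : S ⟶ Q), IsSES E f g ↔ IsSES E' (F.map f) (F.map g))

include hF in
/-- A duality-preserving equivalence which preserves and reflects exact sequences induces an
isomorphism of Witt groups. -/
theorem exists_wittEquiv [F.Full] [F.Faithful] [F.EssSurj] [F.Additive] :
    ∃ m : WittGroup δ E ≃+ WittGroup δ' E', ∀ S, m (.mk E S) = .mk E' (Φ.mapSpace S) := by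
  choose ρ hρ using Φ.exists_mapSpace_isometric
  let f : WittGroup δ E →+ WittGroup δ' E' := WittGroup.lift (fun S => .mk E' (Φ.mapSpace S))
    (fun S T h => WittGroup.mk_isometric _ (Φ.isometric_map h))
    (fun S P Q h => WittGroup.mk_sum _ (Φ.isOrthogonalSum_map h))
    (fun S h => WittGroup.mk_metabolic (Φ.isMetabolic_map hF h))
  let g : WittGroup δ' E' →+ WittGroup δ E := WittGroup.lift (fun T => .mk E (ρ T))
    (fun S T h => WittGroup.mk_isometric _
      (Φ.isometric_of_map (((hρ S).trans h).trans (hρ T).symm)))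
    (fun S P Q h => WittGroup.mk_sum _
      (Φ.isOrthogonalSum_of_map (h.of_isometric (hρ S) (hρ P) (hρ Q))))
    (fun S h => WittGroup.mk_metabolic (Φ.isMetabolic_of_map hF (h.of_isometric (hρ S).symm)))
  have hf : ∀ S, f (.mk E S) = .mk E' (Φ.mapSpace S) := fun S => WittGroup.lift_mk _ _ _ _ S
  have hg : ∀ T, g (.mk E' T) = .mk E (ρ T) := fun T => WittGroup.lift_mk _ _ _ _ T
  refine ⟨AddMonoidHom.toAddEquiv f g (WittGroup.hom_ext fun S => ?_)
    (WittGroup.hom_ext fun T => ?_), hf⟩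
  · rw [AddMonoidHom.comp_apply, hf, hg]
    exact WittGroup.mk_isometric _ (Φ.isometric_of_map (hρ _))
  · rw [AddMonoidHom.comp_apply, hg, hf]
    exact WittGroup.mk_isometric _ (hρ _)

end DualityPreserving

end Witt

/-! ### Simplicity of `K ⊗ D` -/

section Simple

variable {k : Type u} [Field k] {D : Type u} [DivisionRing D] [Algebra k D]
  [Algebra.IsCentral k D] {K : Type u} [Field K] [Algebra k K]

/-- The two-sided ideal generated by an element, as the span of the products `a * x * b`. -/
def twoSided {R A : Type*} [CommRing R] [Ring A] [Algebra R A] (x : A) : Submodule R A :=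
  Submodule.span R (Set.range fun p : A × A => p.1 * x * p.2)

theorem mul_mul_mem_twoSided {R A : Type*} [CommRing R] [Ring A] [Algebra R A] {x y : A}
    (hy : y ∈ twoSided (R := R) x) (a b : A) : a * y * b ∈ twoSided (R := R) x := by
  induction hy using Submodule.span_induction with
  | mem z hz =>
    obtain ⟨⟨c, d⟩, rfl⟩ := hz
    refine Submodule.subset_span ⟨(a * c, d * b), ?_⟩
    simp only [mul_assoc]
  | zero => simp
  | add y z _ _ hy hz => rw [mul_add, add_mul]; exact add_mem hy hz
  | smul r y _ hy => rw [mul_smul_comm, smul_mul_assoc]; exact Submodule.smul_mem _ _ hy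

theorem exists_sum_of_mem_twoSided {R A : Type*} [CommRing R] [Ring A] [Algebra R A] {x y : A}
    (hy : y ∈ twoSided (R := R) x) :
    ∃ (m : ℕ) (a b : Fin m → A), ∑ i, a i * x * b i = y := by
  induction hy using Submodule.span_induction with
  | mem z hz =>
    obtain ⟨⟨c, d⟩, rfl⟩ := hz
    exact ⟨1, fun _ => c, fun _ => d, by simp⟩
  | zero => exact ⟨0, 0, 0, by simp⟩
  | add y z _ _ hy hz =>
    obtain ⟨m, a, b, rfl⟩ := hy
    obtain ⟨m', a', b', rfl⟩ := hz
    exact ⟨m + m', Fin.append a a', Fin.append b b', by simp [Fin.sum_univ_add]⟩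
  | smul r y _ hy =>
    obtain ⟨m, a, b, rfl⟩ := hy
    exact ⟨m, fun i => r • a i, b, by simp [Finset.smul_sum]⟩

/-- The algebra `K ⊗ D` is simple: an element of minimal length in a two-sided ideal is, up to
a factor from `D`, of the form `c ⊗ 1`. -/
theorem one_mem_twoSided (x : K ⊗[k] D) (hx : x ≠ 0) : 1 ∈ twoSided (R := K) x := by
  classical
  let b := Module.Basis.ofVectorSpace k K
  let φ := TensorProduct.equivFinsuppOfBasisLeft (N := D) b
  have hl : ∀ (d : D) (y : K ⊗[k] D) i, φ (1 ⊗ₜ d * y) i = d * φ y i := by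
    intro d y i
    induction y with
    | zero => simp
    | add y z hy hz => simp only [mul_add, map_add, Finsupp.add_apply, hy, hz]
    | tmul c e => simp [φ]
  have hr : ∀ (d : D) (y : K ⊗[k] D) i, φ (y * 1 ⊗ₜ d) i = φ y i * d := by
    intro d y i
    induction y with
    | zero => simp
    | add y z hy hz => simp only [add_mul, map_add, Finsupp.add_apply, hy, hz]
    | tmul c e => simp [φ]
  have hx0 : x ∈ twoSided (R := K) x := Submodule.subset_span ⟨(1, 1), by simp⟩
  have hex : ∃ m : ℕ, ∃ y ∈ twoSided (R := K) x, y ≠ 0 ∧ (φ y).support.card = m :=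
    ⟨_, x, hx0, hx, rfl⟩
  obtain ⟨y, hy, hy0, hym⟩ := Nat.find_spec hex
  have hmin : ∀ z ∈ twoSided (R := K) x, (φ z).support.card < (φ y).support.card → z = 0 := by
    intro z hz hlt
    by_contra hz0
    exact Nat.find_min hex (hym ▸ hlt) ⟨z, hz, hz0, rfl⟩
  obtain ⟨i, hi⟩ : ∃ i, φ y i ≠ 0 := by
    by_contra! h
    exact hy0 (φ.map_eq_zero_iff.1 (Finsupp.ext h))
  -- after multiplication by an element of `D`, the coefficient at `i` is `1`
  let z := 1 ⊗ₜ (φ y i)⁻¹ * y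
  have hz : z ∈ twoSided (R := K) x := by
    have := mul_mul_mem_twoSided hy (1 ⊗ₜ (φ y i)⁻¹) 1
    rwa [mul_one] at this
  have hzi : φ z i = 1 := by rw [hl, inv_mul_cancel₀ hi]
  have hzs : (φ z).support ⊆ (φ y).support := by
    intro j hj
    rw [Finsupp.mem_support_iff] at hj ⊢
    intro h
    exact hj (by rw [hl, h, mul_zero])
  have hcomm : ∀ d j, d * φ z j = φ z j * d := by
    intro d j
    have h0 : 1 ⊗ₜ d * z - z * 1 ⊗ₜ d = 0 := by
      refine hmin _ (sub_mem ?_ ?_) (Finset.card_lt_card ?_)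
      · have := mul_mul_mem_twoSided hz (1 ⊗ₜ d) 1
        rwa [mul_one] at this
      · have := mul_mul_mem_twoSided hz 1 (1 ⊗ₜ d)
        rwa [one_mul] at this
      · refine (Finset.ssubset_iff_of_subset fun l hl' => ?_).2 ⟨i, ?_, ?_⟩
        · refine hzs ?_
          rw [Finsupp.mem_support_iff] at hl' ⊢
          intro h
          exact hl' (by rw [map_sub, Finsupp.sub_apply, hl, hr, h, mul_zero, zero_mul, sub_zero])
        · rwa [Finsupp.mem_support_iff]
        · rw [Finsupp.notMem_support_iff, map_sub, Finsupp.sub_apply, hl, hr, hzi, mul_one, one_mul,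
            sub_self]
    have := congrArg (fun w => φ w j) h0
    simpa only [map_sub, Finsupp.sub_apply, hl, hr, map_zero, Finsupp.zero_apply, sub_eq_zero] using this
  have hcen : ∀ j, ∃ c : k, algebraMap k D c = φ z j := fun j =>
    Algebra.IsCentral.mem_center_iff (K := k) |>.1
      (Subalgebra.mem_center_iff.2 fun d => hcomm d j) |>.imp fun _ h => h.symm
  choose c hc using hcen
  have hz1 : z = (∑ j ∈ (φ z).support, c j • b j) ⊗ₜ 1 := by
    apply φ.injective
    ext l
    rw [TensorProduct.equivFinsuppOfBasisLeft_apply_tmul_apply, map_sum, Finsupp.finsetSum_apply]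
    simp only [map_smul, Finsupp.smul_apply, Module.Basis.repr_self, Finsupp.single_apply, smul_eq_mul,
      mul_ite, mul_one, mul_zero, Finset.sum_ite_eq']
    split_ifs with h
    · rw [← hc l, Algebra.algebraMap_eq_smul_one]
    · rw [zero_smul]; exact Finsupp.notMem_support_iff.1 h
  set s := ∑ j ∈ (φ z).support, c j • b j
  have hs : s ≠ 0 := by
    intro h
    rw [h, TensorProduct.zero_tmul] at hz1
    rw [hz1, map_zero, Finsupp.zero_apply] at hzi
    exact zero_ne_one hzi
  have : (1 : K ⊗[k] D) = s⁻¹ • z := by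
    rw [hz1, TensorProduct.smul_tmul', smul_eq_mul, inv_mul_cancel₀ hs]
    rfl
  rw [this]
  exact Submodule.smul_mem _ _ hz

/-- Homomorphisms from the simple ring `K ⊗ D` to nonzero rings are injective. -/
theorem eq_zero_of_map_eq_zero (x : K ⊗[k] D) {B : Type*} [Ring B] [Nontrivial B]
    (f : K ⊗[k] D →+* B) (hf : f x = 0) : x = 0 := by
  by_contra hx
  obtain ⟨m, a, b, h⟩ := exists_sum_of_mem_twoSided (one_mem_twoSided x hx)
  have := congrArg f h
  simp [hf] at this

/-- Over a field, the elements of a left ideal `I` of dimension `n` act on the right on `I` by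
scalars, and some element acts as the identity: left multiplication gives an isomorphism from
`K ⊗ D` to `End(I)`, as the dimensions agree. -/
theorem scalar_right_mul [FiniteDimensional k D] {n : ℕ} (hn : n ≠ 0)
    (hD : Module.finrank k D = n ^ 2) (I : Ideal (K ⊗[k] D))
    (hI : Module.finrank K (I.restrictScalars K) = n) :
    (∀ z ∈ I, ∃ c : K, ∀ y ∈ I, y * z = c • y) ∧ ∃ e ∈ I, ∀ y ∈ I, y * e = y := by
  let N : Submodule K (K ⊗[k] D) := I.restrictScalars K
  have hNI : ∀ {y}, y ∈ N ↔ y ∈ I := Iff.rfl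
  have : FiniteDimensional K N := inferInstance
  have : Nontrivial N := Module.nontrivial_of_finrank_pos (R := K) (by
    change 0 < Module.finrank K (I.restrictScalars K); omega)
  let L : K ⊗[k] D →ₐ[K] Module.End K N := AlgHom.ofLinearMap
    { toFun := fun x =>
        { toFun := fun y => ⟨x * y.1, I.mul_mem_left x y.2⟩
          map_add' := fun y z => Subtype.ext (mul_add _ _ _)
          map_smul' := fun c y => Subtype.ext (mul_smul_comm c x y.1) }
      map_add' := fun x y => LinearMap.ext fun z => Subtype.ext (add_mul _ _ _)
      map_smul' := fun c x => LinearMap.ext fun z => Subtype.ext (smul_mul_assoc _ _ _) }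
    (LinearMap.ext fun z => Subtype.ext (one_mul _))
    (fun x y => LinearMap.ext fun z => Subtype.ext (mul_assoc _ _ _))
  have hLinj : Function.Injective L := (injective_iff_map_eq_zero _).2 fun x hx =>
    eq_zero_of_map_eq_zero x (B := Module.End K N) L.toRingHom hx
  have hLsurj : Function.Surjective L := by
    have hfr : Module.finrank K (K ⊗[k] D) = Module.finrank K (Module.End K N) := by
      have hI' : Module.finrank K N = n := hI
      rw [Module.finrank_baseChange, hD, Module.finrank_linearMap, hI', sq]
    let L' : K ⊗[k] D →ₗ[K] (N →ₗ[K] N) := L.toLinearMap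
    exact (LinearMap.injective_iff_surjective_of_finrank_eq_finrank (K := K) (V := K ⊗[k] D)
      (V₂ := N →ₗ[K] N) hfr (f := L')).1 hLinj
  have h1 : ∀ z ∈ I, ∃ c : K, ∀ y ∈ I, y * z = c • y := by
    intro z hz
    let r : Module.End K N :=
      { toFun := fun y => ⟨y.1 * z, I.mul_mem_left y.1 hz⟩
        map_add' := fun y z => Subtype.ext (add_mul _ _ _)
        map_smul' := fun c y => Subtype.ext (smul_mul_assoc _ _ _) }
    have hr : r ∈ Subalgebra.center K (Module.End K N) := by
      refine Subalgebra.mem_center_iff.2 fun f => ?_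
      obtain ⟨x, rfl⟩ := hLsurj f
      exact LinearMap.ext fun y => Subtype.ext (mul_assoc x y.1 z).symm
    obtain ⟨c, hc⟩ := Algebra.IsCentral.mem_center_iff (K := K) |>.1 hr
    refine ⟨c, fun y hy => ?_⟩
    have := congrArg Subtype.val (LinearMap.congr_fun hc (⟨y, hy⟩ : N))
    rw [Module.algebraMap_end_apply] at this
    exact this
  refine ⟨h1, ?_⟩
  obtain ⟨⟨w, hw⟩, hw0⟩ := exists_ne (0 : N)
  have hw0 : w ≠ 0 := fun h => hw0 (Subtype.ext h)
  have : L w ≠ 0 := fun h => hw0 (hLinj (h.trans (map_zero L).symm))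
  obtain ⟨⟨z, hz⟩, hwz⟩ : ∃ z, L w z ≠ 0 := by
    by_contra! h
    exact this (LinearMap.ext h)
  obtain ⟨c, hc⟩ := h1 z hz
  have hc0 : c ≠ 0 := by
    rintro rfl
    exact hwz (Subtype.ext ((hc w hw).trans (zero_smul _ _)))
  refine ⟨c⁻¹ • z, N.smul_mem _ hz, fun y hy => ?_⟩
  rw [mul_smul_comm, hc y hy, inv_smul_smul₀ hc0]

end Simple

/-! ### Left ideals over local rings, and symplectic involutions -/

section LocalRing

variable {k : Type u} [Field k] {D : Type u} [DivisionRing D] [Algebra k D]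
  {R : Type u} [CommRing R] [Algebra k R]

theorem eq_zero_of_smul_one {c : R} (h : c • (1 : R ⊗[k] D) = 0) : c = 0 := by
  have h1 : Function.Injective (algebraMap R (R ⊗[k] D)) :=
    Algebra.TensorProduct.includeLeft_injective (S := k) (algebraMap k D).injective
  refine h1 ?_
  rw [Algebra.algebraMap_eq_smul_one, h, map_zero]

/-- A full element has no annihilator in `R`. -/
theorem eq_zero_of_smul_full {e : R ⊗[k] D} {m : ℕ} {a b : Fin m → R ⊗[k] D}
    (hab : ∑ i, a i * e * b i = 1) {c : R} (h : c • e = 0) : c = 0 := by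
  refine eq_zero_of_smul_one (k := k) (D := D) ?_
  rw [← hab, Finset.smul_sum]
  refine Finset.sum_eq_zero fun i _ => ?_
  rw [← smul_mul_assoc, ← mul_smul_comm, h, mul_zero, zero_mul]

/-- The property of `e` to be of rank one is stable under extensions of scalars. -/
theorem exists_smul_of_ext {S : Type u} [CommRing S] [Algebra k S] (f : R →ₐ[k] S)
    {e : R ⊗[k] D} (he : ∀ x, ∃ c : R, e * x * e = c • e) (x : S ⊗[k] D) :
    ∃ c : S, ext D f e * x * ext D f e = c • ext D f e := by
  induction x with
  | zero => exact ⟨0, by simp⟩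
  | add x y hx hy =>
    obtain ⟨c, hc⟩ := hx
    obtain ⟨d, hd⟩ := hy
    exact ⟨c + d, by rw [mul_add, add_mul, hc, hd, add_smul]⟩
  | tmul r d =>
    obtain ⟨c, hc⟩ := he (1 ⊗ₜ d)
    refine ⟨r * f c, ?_⟩
    have h1 : r ⊗ₜ[k] d = r • ext D f (1 ⊗ₜ d) := by simp [TensorProduct.smul_tmul']
    rw [h1, mul_smul_comm, smul_mul_assoc, ← map_mul, ← map_mul, hc, ext_smul, smul_smul]

theorem exists_smul_of_onExt (σ : Involution k D) {e : R ⊗[k] D}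
    (he : ∀ x, ∃ c : R, e * x * e = c • e) (x : R ⊗[k] D) :
    ∃ c : R, σ.onExt R e * x * σ.onExt R e = c • σ.onExt R e := by
  obtain ⟨c, hc⟩ := he (σ.onExt R x)
  refine ⟨c, ?_⟩
  have := congrArg (σ.onExt R) hc
  rwa [σ.onExt_mul, σ.onExt_mul, σ.onExt_onExt, map_smul, ← mul_assoc] at this

/-- Two full idempotents of rank one over a local ring are equivalent: one of the products
`(e' aᵢ e) (e bᵢ e')`, whose sum is `e'`, is a unit times `e'`. -/
theorem exists_equivalence_of_idempotents [IsLocalRing R] {e e' : R ⊗[k] D}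
    (he : e * e = e) (he' : e' * e' = e')
    {m : ℕ} {a b : Fin m → R ⊗[k] D} (hab : ∑ i, a i * e * b i = 1)
    {m' : ℕ} {a' b' : Fin m' → R ⊗[k] D} (hab' : ∑ i, a' i * e' * b' i = 1)
    (hc : ∀ x, ∃ c : R, e * x * e = c • e) (hc' : ∀ x, ∃ c : R, e' * x * e' = c • e') :
    ∃ u v, e' * u * e = u ∧ e * v * e' = v ∧ u * v = e' ∧ v * u = e := by
  have faithful : ∀ c : R, c • e' = 0 → c = 0 := fun c h => eq_zero_of_smul_full hab' h
  have h1 : ∀ x, e * (e * x) = e * x := fun x => by rw [← mul_assoc, he]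
  have h1' : ∀ x, e' * (e' * x) = e' * x := fun x => by rw [← mul_assoc, he']
  choose c hc2 using fun i => hc' (a i * e * b i)
  have hsum : ∑ i, c i = 1 := by
    refine sub_eq_zero.1 (faithful _ ?_)
    rw [sub_smul, one_smul, Finset.sum_smul, sub_eq_zero]
    simp only [← hc2]
    rw [← Finset.sum_mul, ← Finset.mul_sum, hab, mul_one, he']
  obtain ⟨i, hi⟩ : ∃ i, IsUnit (c i) := by
    by_contra! h
    have h1 : ∑ i, c i ∈ IsLocalRing.maximalIdeal R :=
      sum_mem fun i _ => (IsLocalRing.mem_maximalIdeal _).2 (h i)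
    rw [hsum] at h1
    exact (IsLocalRing.mem_maximalIdeal _).1 h1 isUnit_one
  obtain ⟨w, hw⟩ := hi
  obtain ⟨u, hu⟩ : ∃ u, u = (↑w⁻¹ : R) • (e' * a i * e) := ⟨_, rfl⟩
  obtain ⟨v, hv⟩ : ∃ v, v = e * b i * e' := ⟨_, rfl⟩
  have hu1 : e' * u * e = u := by
    simp only [hu, mul_smul_comm, smul_mul_assoc, mul_assoc, he, h1']
  have hv1 : e * v * e' = v := by
    simp only [hv, mul_assoc, he', h1]
  have huv : u * v = e' := by
    have := hc2 i
    simp only [mul_assoc] at this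
    simp only [hu, hv, smul_mul_assoc, mul_assoc, h1, this, smul_smul, ← hw,
      Units.inv_mul, one_smul]
  obtain ⟨d, hd⟩ := hc (v * u)
  have hvu : v * u = d • e := by
    rw [← hd]
    nth_rewrite 1 [← hu1, ← hv1]
    simp only [mul_assoc, h1']
    rw [← hv1, ← hu1]
    simp only [mul_assoc, he, h1, h1']
  have hd1 : d = 1 := by
    refine (sub_eq_zero.1 (faithful _ ?_)).symm
    have h2 : u * v * (u * v) = d • (u * v) := by
      rw [mul_assoc, ← mul_assoc v, hvu, smul_mul_assoc, mul_smul_comm, ← hv1]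
      simp only [mul_assoc, h1]
    rw [huv, he'] at h2
    rw [sub_smul, one_smul, ← h2, sub_self]
  exact ⟨u, v, hu1, hv1, huv, by rw [hvu, hd1, one_smul]⟩

/-- For a direct summand `N` of `M`, the intersection of `N` with `𝔪 M` is `𝔪 N`. -/
theorem mem_smul_of_isCompl {M : Type*} [AddCommGroup M] [Module R M] (m : Ideal R)
    {N J : Submodule R M} (h : IsCompl N J) {z : M} (hz : z ∈ N) (hz' : z ∈ m • (⊤ : Submodule R M)) :
    z ∈ m • N := by
  have h1 := Submodule.mem_map_of_mem (f := N.subtype ∘ₗ Submodule.projectionOnto N J h) hz'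
  rw [Submodule.map_smul''] at h1
  have h2 : (N.subtype ∘ₗ Submodule.projectionOnto N J h) z = z :=
    congrArg Subtype.val (Submodule.projectionOnto_apply_left h ⟨z, hz⟩)
  rw [h2] at h1
  refine Submodule.smul_mono le_rfl ?_ h1
  rintro _ ⟨x, -, rfl⟩
  exact (Submodule.projectionOnto N J h x).2

theorem fg_of_isCompl {M : Type*} [AddCommGroup M] [Module R M] [Module.Finite R M]
    {N J : Submodule R M} (h : IsCompl N J) : N.FG := by
  have : N = (⊤ : Submodule R M).map (N.subtype ∘ₗ Submodule.projectionOnto N J h) := by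
    refine le_antisymm (fun z hz => ⟨z, trivial,
      congrArg Subtype.val (Submodule.projectionOnto_apply_left h ⟨z, hz⟩)⟩) ?_
    rintro _ ⟨x, -, rfl⟩
    exact (Submodule.projectionOnto N J h x).2
  rw [this]
  exact Module.Finite.fg_top.map _

variable [FiniteDimensional k D]

theorem mem_smul_top_of_ext_eq_zero {S : Type u} [CommRing S] [Algebra k S] (f : R →ₐ[k] S)
    {x : R ⊗[k] D} (hx : ext D f x = 0) :
    x ∈ RingHom.ker f • (⊤ : Submodule R (R ⊗[k] D)) := by
  let b := Module.finBasis k D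
  rw [← (Algebra.TensorProduct.basis R b).sum_repr x]
  refine sum_mem fun i _ => Submodule.smul_mem_smul ?_ trivial
  have := repr_ext D b f x i
  rw [hx, map_zero, Finsupp.zero_apply] at this
  exact this.symm

omit [FiniteDimensional k D] in
theorem ext_surjective {S : Type u} [CommRing S] [Algebra k S] (f : R →ₐ[k] S)
    (hf : Function.Surjective f) : Function.Surjective (ext D f) :=
  TensorProduct.map_surjective hf Function.surjective_id

theorem ext_injective {S : Type u} [CommRing S] [Algebra k S] (f : R →ₐ[k] S)
    (hf : Function.Injective f) : Function.Injective (ext D f) := by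
  refine (injective_iff_map_eq_zero _).2 fun x hx => ?_
  let b := Module.finBasis k D
  refine (Algebra.TensorProduct.basis R b).ext_elem fun i => hf ?_
  rw [← repr_ext D b f x i, hx, map_zero, map_zero, Finsupp.zero_apply, Finsupp.zero_apply, map_zero]

/-- Over a local ring, a left ideal which is a direct summand, with fibre of dimension `n` over
the residue field, is generated by an idempotent `e` which is full and of rank one. -/
theorem exists_idempotent_of_isLocalRing [Algebra.IsCentral k D] [IsLocalRing R] {n : ℕ}
    (hn : n ≠ 0) (hD : Module.finrank k D = n ^ 2) (I : Ideal (R ⊗[k] D))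
    (J : Submodule R (R ⊗[k] D)) (hJ : IsCompl (I.restrictScalars R) J)
    {K : Type u} [Field K] [Algebra k K] (q : R →ₐ[k] K) (hq : Function.Surjective q)
    (hI : Module.finrank K ((I.map (ext D q)).restrictScalars K) = n) :
    ∃ e ∈ I, (∀ y ∈ I, y * e = y) ∧
      (∃ (m : ℕ) (a b : Fin m → R ⊗[k] D), ∑ i, a i * e * b i = 1) ∧
      ∀ x, ∃ c : R, e * x * e = c • e := by
  have hext := ext_surjective (D := D) q hq
  have hmem : ∀ z, z ∈ I.map (ext D q) ↔ ∃ y ∈ I, ext D q y = z := fun z =>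
    Ideal.mem_map_iff_of_surjective _ hext
  let m := RingHom.ker q
  have hm : m ≤ Ideal.jacobson ⊥ := by
    rw [IsLocalRing.jacobson_eq_maximalIdeal ⊥ bot_ne_top]
    exact IsLocalRing.le_maximalIdeal (RingHom.ker_ne_top q.toRingHom)
  let N : Submodule R (R ⊗[k] D) := I.restrictScalars R
  have hNI : ∀ {y}, y ∈ N ↔ y ∈ I := Iff.rfl
  have hfg : N.FG := fg_of_isCompl hJ
  obtain ⟨hscal, e₀, he₀, hye₀⟩ := scalar_right_mul hn hD (I.map (ext D q)) hI
  obtain ⟨a, ha, rfl⟩ := (hmem e₀).1 he₀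
  -- right multiplication by a lift `a` of the identity is surjective on `I`, by Nakayama
  have hsurj : ∀ y ∈ I, ∃ z ∈ I, z * a = y := by
    have : N ≤ N.map (LinearMap.mulRight R a) := by
      refine Submodule.le_of_le_smul_of_le_jacobson_bot (I := m) hfg hm fun y hy => ?_
      rw [show y = y * a + (y - y * a) by abel]
      refine Submodule.add_mem_sup ⟨y, hy, rfl⟩ (mem_smul_of_isCompl m hJ ?_ ?_)
      · exact N.sub_mem hy (I.mul_mem_left y ha)
      · refine mem_smul_top_of_ext_eq_zero q ?_
        rw [map_sub, map_mul, hye₀ _ ((hmem _).2 ⟨y, hy, rfl⟩), sub_self]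
    exact fun y hy => this hy
  have hinj : ∀ y ∈ I, y * a = 0 → y = 0 := by
    have : Module.Finite R N := Module.Finite.iff_fg.2 hfg
    let r : N →ₗ[R] N :=
      { toFun := fun y => ⟨y.1 * a, I.mul_mem_left y.1 ha⟩
        map_add' := fun y z => Subtype.ext (add_mul _ _ _)
        map_smul' := fun c y => Subtype.ext (smul_mul_assoc _ _ _) }
    have hr : Function.Injective r := OrzechProperty.injective_of_surjective_endomorphism r
      fun y => by
        obtain ⟨z, hz, h⟩ := hsurj y.1 y.2
        exact ⟨⟨z, hz⟩, Subtype.ext h⟩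
    intro y hy h
    exact congrArg Subtype.val (@hr ⟨y, hy⟩ 0 (Subtype.ext (h.trans (zero_mul a).symm)))
  -- `(y e - y) a = 0` for all `y` in `I`
  obtain ⟨e, he, hea⟩ := hsurj a ha
  have hye : ∀ y ∈ I, y * e = y := by
    intro y hy
    refine sub_eq_zero.1 (hinj _ (I.sub_mem (I.mul_mem_left y he) hy) ?_)
    rw [sub_mul, mul_assoc, hea, sub_self]
  have hye' : ∀ y ∈ I.map (ext D q), y * ext D q e = y := by
    intro y hy
    obtain ⟨y, hy', rfl⟩ := (hmem y).1 hy
    rw [← map_mul, hye y hy']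
  refine ⟨e, he, hye, ?_, ?_⟩
  · have he0 : ext D q e ≠ 0 := by
      intro h0
      have : I.map (ext D q) = ⊥ := by
        refine (Submodule.eq_bot_iff _).2 fun y hy => ?_
        rw [← hye' y hy, h0, mul_zero]
      rw [this] at hI
      refine hn (hI.symm.trans ?_)
      exact finrank_bot K (K ⊗[k] D)
    obtain ⟨r, a', b', hab'⟩ := exists_sum_of_mem_twoSided (one_mem_twoSided _ he0)
    choose a hea using fun i => hext (a' i)
    choose b heb using fun i => hext (b' i)
    have hs : ext D q (∑ i, a i * e * b i) = 1 := by
      rw [map_sum, ← hab']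
      refine Finset.sum_congr rfl fun i _ => ?_
      rw [map_mul, map_mul, hea, heb]
    -- `e` is full, by Nakayama, since it is full modulo the maximal ideal
    have hle : (⊤ : Submodule R (R ⊗[k] D)) ≤ twoSided e := by
      refine Submodule.le_of_le_smul_of_le_jacobson_bot (I := m) Module.Finite.fg_top hm
        fun x _ => ?_
      rw [show x = x * (∑ i, a i * e * b i) + (x - x * (∑ i, a i * e * b i)) by abel]
      refine Submodule.add_mem_sup ?_ ?_
      · have h1 : (∑ i, a i * e * b i) ∈ twoSided (R := R) e :=
          sum_mem fun i _ => Submodule.subset_span ⟨(a i, b i), rfl⟩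
        have := mul_mul_mem_twoSided h1 x 1
        rwa [mul_one] at this
      · refine mem_smul_top_of_ext_eq_zero q ?_
        rw [map_sub, map_mul, hs, mul_one, sub_self]
    exact exists_sum_of_mem_twoSided (R := R) (hle trivial)
  -- `e (R ⊗ D) e` is spanned by `e`, by Nakayama for the image of the projection `x ↦ e x e`
  · let p : R ⊗[k] D →ₗ[R] R ⊗[k] D := LinearMap.mulLeft R e ∘ₗ LinearMap.mulRight R e
    have hp : ∀ x, p x = e * x * e := fun x => (mul_assoc e x e).symm
    have hpp : ∀ x, p (p x) = p x := fun x => by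
      simp only [hp, mul_assoc, hye e he]
      rw [← mul_assoc e e, hye e he]
    have hle : LinearMap.range p ≤ Submodule.span R {e} := by
      refine Submodule.le_of_le_smul_of_le_jacobson_bot (I := m)
        (by rw [LinearMap.range_eq_map]; exact Module.Finite.fg_top.map _) hm ?_
      rintro _ ⟨x, rfl⟩
      obtain ⟨c', hc'⟩ := hscal (ext D q (x * e)) ((hmem _).2 ⟨_, I.mul_mem_left x he, rfl⟩)
      obtain ⟨c, rfl⟩ := hq c'
      rw [show p x = c • e + (p x - c • e) by abel]
      refine Submodule.add_mem_sup (Submodule.smul_mem _ _ (Submodule.mem_span_singleton_self e)) ?_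
      have h1 : p x - c • e ∈ m • (⊤ : Submodule R (R ⊗[k] D)) := by
        refine mem_smul_top_of_ext_eq_zero q ?_
        rw [map_sub, hp, mul_assoc, map_mul, hc' _ ((hmem _).2 ⟨e, he, rfl⟩), ext_smul, sub_self]
      have h2 := Submodule.mem_map_of_mem (f := p) h1
      rw [Submodule.map_smul'', map_sub, hpp, map_smul, hp e, hye e he, hye e he,
        ← LinearMap.range_eq_map] at h2
      exact h2
    intro x
    obtain ⟨c, hc⟩ := Submodule.mem_span_singleton.1 (hle ⟨x, rfl⟩)
    exact ⟨c, by rw [hc, hp]⟩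

end LocalRing

section Symplectic

variable {k : Type u} [Field k] {D : Type u} [DivisionRing D] [Algebra k D]
  {F : Type u} [Field F] [Algebra k F]

/-- Any two extensions of a field are contained in a common extension. -/
theorem exists_compositum (F K : Type u) [Field F] [Algebra k F] [Field K] [Algebra k K] :
    ∃ (E : Type u) (_ : Field E) (_ : Algebra k E), Nonempty (F →ₐ[k] E) ∧ Nonempty (K →ₐ[k] E) := by
  obtain ⟨m, hm⟩ := Ideal.exists_maximal (F ⊗[k] K)
  let _ := Ideal.Quotient.field m
  exact ⟨F ⊗[k] K ⧸ m, inferInstance, inferInstance,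
    ⟨(Ideal.Quotient.mkₐ k m).comp Algebra.TensorProduct.includeLeft⟩,
    ⟨(Ideal.Quotient.mkₐ k m).comp Algebra.TensorProduct.includeRight⟩⟩

/-- For a symplectic involution and an idempotent `e` of rank one, `σ(y) y = 0` for all `y` in
the left ideal generated by `e`: over a splitting field, `y = v w` for a column `v` and a row `w`,
and `σ(y) y` has the factor `vᵗ J v = 0`. -/
theorem onExt_mul_self_of_isSymplectic [Algebra.IsCentral k D] {n : ℕ} (hn : n ≠ 0)
    (hk : ringChar k ≠ 2) {σ : Involution k D} (hσ : σ.IsSymplectic n) {e : F ⊗[k] D}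
    (he : ∀ x, ∃ c : F, e * x * e = c • e) (y : F ⊗[k] D) :
    σ.onExt F (y * e) * (y * e) = 0 := by
  obtain ⟨K, _, _, s, J, hJ, hJt, -, hs⟩ := hσ
  obtain ⟨E, _, _, ⟨f⟩, ⟨g⟩⟩ := exists_compositum (k := k) F K
  have : Nonempty (Fin n) := ⟨⟨0, Nat.pos_of_ne_zero hn⟩⟩
  let t : D →ₐ[k] Matrix (Fin n) (Fin n) E :=
    g.mapMatrix.comp ((s.toAlgHom.restrictScalars k).comp Algebra.TensorProduct.includeRight)
  let r : F →ₐ[k] Matrix (Fin n) (Fin n) E :=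
    ((Algebra.ofId E (Matrix (Fin n) (Fin n) E)).restrictScalars k).comp f
  let ψ : F ⊗[k] D →ₐ[k] Matrix (Fin n) (Fin n) E := Algebra.TensorProduct.lift r t
    (fun c d => Algebra.commutes (f c) (t d))
  have hψ : ∀ c d, ψ (c ⊗ₜ d) = f c • (s (1 ⊗ₜ d)).map g := fun c d => by
    rw [Algebra.smul_def]
    exact Algebra.TensorProduct.lift_tmul _ _ _ _ _
  have hψsmul : ∀ (c : F) x, ψ (c • x) = f c • ψ x := fun c x => by
    have h1 : algebraMap F (F ⊗[k] D) c = c ⊗ₜ 1 := rfl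
    have h2 : (s 1).map g = 1 := by rw [map_one, Matrix.map_one _ (map_zero g) (map_one g)]
    rw [Algebra.smul_def, map_mul, h1, hψ, ← Algebra.TensorProduct.one_def, h2, smul_mul_assoc,
      one_mul]
  have hinj : ∀ x, ψ x = 0 → x = 0 := fun x hx =>
    eq_zero_of_map_eq_zero x (B := Matrix (Fin n) (Fin n) E) ψ.toRingHom hx
  let J' : Matrix (Fin n) (Fin n) E := J.map g
  have hJ' : J'.transpose = -J' := by
    rw [← Matrix.transpose_map, hJt]
    ext i j
    simp [J']
  have hσ' : ∀ x, J' * ψ (σ.onExt F x) = (ψ x).transpose * J' := by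
    intro x
    induction x with
    | zero => simp
    | add x y hx hy => simp only [map_add, mul_add, add_mul, hx, hy, Matrix.transpose_add]
    | tmul c d =>
      have h1 := hs (1 ⊗ₜ d)
      have h2 : J * s (1 ⊗ₜ σ.map d) = (s (1 ⊗ₜ d)).transpose * J := by
        rw [show (1 : K) ⊗ₜ[k] σ.map d = σ.onExt K (1 ⊗ₜ d) by simp, h1, mul_assoc, ← mul_assoc J,
          Matrix.mul_nonsing_inv _ hJ, one_mul]
      have h3 := congrArg (fun M : Matrix (Fin n) (Fin n) K => M.map g) h2
      simp only [Matrix.map_mul] at h3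
      rw [LinearMap.baseChange_tmul, hψ, hψ, Matrix.transpose_smul, mul_smul_comm, smul_mul_assoc,
        ← Matrix.transpose_map]
      exact congrArg _ h3
  -- the matrices of `D` span `M_n(E)`, so the image `P` of `e` is again of rank one
  let P := ψ e
  have hP : ∀ x : K ⊗[k] D, ∃ c : E, P * (s x).map g * P = c • P := by
    intro x
    induction x with
    | zero => exact ⟨0, by simp⟩
    | add x y hx hy =>
      obtain ⟨c, hc⟩ := hx
      obtain ⟨d, hd⟩ := hy
      refine ⟨c + d, ?_⟩
      rw [map_add, Matrix.map_add _ (fun a b => map_add g a b), mul_add, add_mul, hc, hd, add_smul]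
    | tmul a d =>
      obtain ⟨c, hc⟩ := he (1 ⊗ₜ d)
      have h1 := congrArg ψ hc
      rw [map_mul, map_mul, hψ, map_one, one_smul, hψsmul] at h1
      refine ⟨g a * f c, ?_⟩
      have h2 : (s (a ⊗ₜ d)).map g = g a • (s (1 ⊗ₜ d)).map g := by
        rw [show a ⊗ₜ[k] d = a • (1 ⊗ₜ d) by rw [TensorProduct.smul_tmul', smul_eq_mul, mul_one],
          map_smul]
        ext i j
        simp
      rw [h2, mul_smul_comm, smul_mul_assoc, h1, smul_smul]
  -- `P` is of rank one: `P x P = c P` for the matrix unit `x` at `(q, p)`, where `P p q ≠ 0`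
  obtain ⟨v, w, hvw⟩ : ∃ v w : Fin n → E, P = Matrix.vecMulVec v w := by
    by_cases hP0 : P = 0
    · exact ⟨0, 0, by rw [hP0]; ext; simp [Matrix.vecMulVec_apply]⟩
    obtain ⟨p, q, hpq⟩ : ∃ p q, P p q ≠ 0 := by
      by_contra! h
      exact hP0 (Matrix.ext h)
    obtain ⟨x, hx⟩ := s.surjective (Matrix.single q p 1)
    obtain ⟨c, hc⟩ := hP x
    have h1 : ∀ i j, P i q * P p j = c * P i j := by
      intro i j
      have := congrFun (congrFun hc i) j
      rw [hx, Matrix.smul_apply, smul_eq_mul, Matrix.mul_apply] at this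
      rw [← this, Finset.sum_eq_single p]
      · congr 1
        rw [Matrix.mul_apply, Finset.sum_eq_single q]
        · simp
        · intro l _ hl
          simp [Matrix.single_apply_of_row_ne hl.symm]
        · simp
      · intro l _ hl
        have : (P * (Matrix.single q p (1 : K)).map g) i l = 0 := by
          rw [Matrix.mul_apply]
          refine Finset.sum_eq_zero fun l' _ => ?_
          simp [Matrix.single_apply_of_col_ne _ _ hl.symm]
        rw [this, zero_mul]
      · simp
    have hc0 : c = P p q := mul_right_cancel₀ hpq (h1 p q).symm
    refine ⟨fun i => (P p q)⁻¹ * P i q, fun j => P p j, ?_⟩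
    ext i j
    rw [Matrix.vecMulVec_apply, mul_assoc, h1, hc0, inv_mul_cancel_left₀ hpq]
  apply hinj
  have h2 : (2 : E) ≠ 0 := by
    have : (2 : k) ≠ 0 := Ring.two_ne_zero hk
    intro h
    refine this ((algebraMap k E).injective ?_)
    rw [map_ofNat, h, map_zero]
  have hJinv : IsUnit J'.det := by
    have : J'.det = g J.det := (RingHom.map_det g.toRingHom J).symm
    rw [this]
    exact hJ.map g
  -- in characteristic not `2`, a skew-symmetric matrix is alternating
  have hzz : ∀ z : Fin n → E, z ⬝ᵥ J'.mulVec z = 0 := by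
    intro z
    have h3 : z ⬝ᵥ J'.mulVec z = - (z ⬝ᵥ J'.mulVec z) := by
      conv_lhs => rw [dotProduct_comm, ← Matrix.vecMul_transpose, ← Matrix.dotProduct_mulVec]
      rw [hJ', Matrix.neg_mulVec, dotProduct_neg]
    have h4 : 2 * (z ⬝ᵥ J'.mulVec z) = 0 := by
      rw [two_mul]
      nth_rewrite 1 [h3]
      exact neg_add_cancel _
    exact (mul_eq_zero.1 h4).resolve_left h2
  have h0 : J' * ψ (σ.onExt F (y * e) * (y * e)) = 0 := by
    rw [map_mul, ← mul_assoc, hσ', map_mul]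
    change (ψ y * P).transpose * J' * (ψ y * P) = 0
    rw [hvw, Matrix.mul_vecMulVec, Matrix.transpose_vecMulVec, Matrix.vecMulVec_mul,
      Matrix.vecMulVec_mul_vecMulVec]
    rw [← Matrix.dotProduct_mulVec, hzz]
    ext
    simp [Matrix.vecMulVec_apply]
  have := congrArg (J'⁻¹ * ·) h0
  simpa [← mul_assoc, Matrix.nonsing_inv_mul _ hJinv] using this

/-- A symplectic involution acts as `-1` on `σ(e) (F ⊗ D) e` for `e` of rank one. -/
theorem onExt_eq_neg_of_isSymplectic [Algebra.IsCentral k D] {n : ℕ} (hn : n ≠ 0)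
    (hk : ringChar k ≠ 2) {σ : Involution k D} (hσ : σ.IsSymplectic n) {e : F ⊗[k] D}
    (he : ∀ x, ∃ c : F, e * x * e = c • e) {s : F ⊗[k] D} (hs : s * e = s)
    (hs' : σ.onExt F s * e = σ.onExt F s) : σ.onExt F s = -s := by
  have h := onExt_mul_self_of_isSymplectic hn hk hσ he (1 + s)
  have h1 := onExt_mul_self_of_isSymplectic hn hk hσ he 1
  have h2 := onExt_mul_self_of_isSymplectic hn hk hσ he s
  rw [add_mul, map_add, add_mul, mul_add, mul_add, h1, h2, hs, one_mul, zero_add, add_zero, hs'] at h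
  have h3 : σ.onExt F e * s = s := by
    have := congrArg (σ.onExt F) hs'
    rwa [σ.onExt_mul, σ.onExt_onExt] at this
  rw [h3] at h
  exact eq_neg_of_add_eq_zero_right h

end Symplectic

/-! ### Local splittings of the Severi–Brauer variety -/

section Points

variable {k : Type u} [Field k] {D : Type u} [Ring D] [Algebra k D] {n : ℕ}
  {X : Scheme.{u}} [X.Over (Spec (.of k))]

/-- The canonical point of `X` over the local ring of `X` at `x`. -/
def stalkPt (x : X) : Points k X (X.presheaf.stalk x) :=
  ⟨X.fromSpecStalk x, by
    apply ext_of_isAffine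
    have hφ : CommRingCat.ofHom (algebraMap k (X.presheaf.stalk x)) =
        (Scheme.ΓSpecIso (.of k)).inv ≫ (X ↘ Spec (.of k)).appTop ≫
          X.presheaf.germ ⊤ x trivial := by
      ext c
      exact congrArg (X.presheaf.germ ⊤ x trivial).hom (resO_self _ _)
    have hid : ((Spec (X.presheaf.stalk x)).presheaf.map
        (homOfLE (le_top : (⊤ : (Spec (X.presheaf.stalk x)).Opens) ≤ ⊤)).op) = 𝟙 _ :=
      (Spec (X.presheaf.stalk x)).presheaf.map_id _
    rw [Scheme.Hom.comp_appTop, Scheme.fromSpecStalk_appTop,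
      ← cancel_epi (Scheme.ΓSpecIso (.of k)).inv]
    refine Eq.trans ?_ (Scheme.ΓSpecIso_inv_naturality _)
    rw [hφ, hid, Category.comp_id]
    simp only [Category.assoc]
    rfl⟩

/-- The image of an `R`-point under a homomorphism `R → S`. -/
def Points.map {R S : Type u} [CommRing R] [Algebra k R] [CommRing S] [Algebra k S]
    (g : R →ₐ[k] S) (f : Points k X R) : Points k X S :=
  ⟨Spec.map (CommRingCat.ofHom g.toRingHom) ≫ f.1, by
    rw [Category.assoc, f.2, ← Spec.map_comp, ← CommRingCat.ofHom_comp]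
    congr 2
    exact g.comp_algebraMap⟩

theorem SeveriBrauer.equiv_points_map (sb : SeveriBrauer k D n X) {R S : Type u} [CommRing R]
    [Algebra k R] [CommRing S] [Algebra k S] (g : R →ₐ[k] S) (f : Points k X R) :
    (sb.equiv S (f.map g)).1 = (sb.equiv R f).1.map (ext D g) :=
  sb.equiv_map g f _ rfl

/-- The specialization map between local rings, as a homomorphism of `k`-algebras. -/
def specializeA {x y : X} (h : x ⤳ y) : X.presheaf.stalk y →ₐ[k] X.presheaf.stalk x where
  toRingHom := (X.presheaf.stalkSpecializes h).hom
  commutes' c := congrArg (fun q => q.hom (kToO (k := k) (⊤ : X.Opens) c))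
    (X.presheaf.germ_stalkSpecializes (U := ⊤) trivial h)

theorem specializeA_comp_germA {x y : X} (h : x ⤳ y) (U : X.Opens) (hy : y ∈ U) :
    (specializeA (k := k) h).comp (germA U y hy) = germA U x (h.mem_open U.isOpen hy) :=
  AlgHom.ext fun c => congrArg (fun q => q.hom c) (X.presheaf.germ_stalkSpecializes hy h)

/-- The left ideal over the function field is generated by the one over any local ring. -/
theorem idealT_eq_map [IsIntegral X] (sb : SeveriBrauer k D n X) (x : X) :
    idealT sb = (sb.equiv _ (stalkPt x)).1.map
      (ext D (specializeA (k := k) (genericPoint_specializes x))) :=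
  sb.equiv_map (specializeA (k := k) (genericPoint_specializes x)) (stalkPt x) (genericPt k)
    (Scheme.SpecMap_stalkSpecializes_fromSpecStalk (genericPoint_specializes x)).symm

/-- The reduction map from a local ring of `X` to its residue field. -/
def residueA (x : X) :
    X.presheaf.stalk x →ₐ[k] IsLocalRing.ResidueField (X.presheaf.stalk x) where
  toRingHom := IsLocalRing.residue _
  commutes' _ := rfl

end Points

section Spread

variable {k : Type u} [Field k] {D : Type u} [Ring D] [Algebra k D]
  {X : Scheme.{u}} [X.Over (Spec (.of k))]

theorem ext_comp_germ {U V : X.Opens} (h : V ≤ U) (x : X) (hx : x ∈ V) (z : Γ(X, U) ⊗[k] D) :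
    ext D (germA V x hx) (ext D (resA h) z) = ext D (germA U x (h hx)) z := by
  rw [ext_ext]
  congr 1
  congr 1
  exact AlgHom.ext fun y => X.presheaf.germ_res_apply (homOfLE h) x hx y

theorem ext_resA_resA {U V W : X.Opens} (h : V ≤ U) (h' : W ≤ V) (z : Γ(X, U) ⊗[k] D) :
    ext D (resA h') (ext D (resA h) z) = ext D (resA (h'.trans h)) z := by
  rw [ext_ext]
  congr 1
  congr 1
  exact AlgHom.ext fun y => resO_resO h h' y

theorem ext_resA_self {U : X.Opens} (h : U ≤ U) (z : Γ(X, U) ⊗[k] D) :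
    ext D (resA h) z = z := by
  have : resA (k := k) h = AlgHom.id k _ := AlgHom.ext fun y => resO_self h y
  rw [this]
  simp [ext]

theorem exists_lift {x : X} (z : X.presheaf.stalk x ⊗[k] D) :
    ∃ (U : X.Opens) (hx : x ∈ U) (y : Γ(X, U) ⊗[k] D), ext D (germA U x hx) y = z := by
  induction z with
  | zero => exact ⟨⊤, trivial, 0, map_zero _⟩
  | add z w hz hw =>
    obtain ⟨U, hU, y, rfl⟩ := hz
    obtain ⟨V, hV, y', rfl⟩ := hw
    have hUV : x ∈ U ⊓ V := ⟨hU, hV⟩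
    exact ⟨U ⊓ V, hUV, ext D (resA inf_le_left) y + ext D (resA inf_le_right) y', by
      rw [map_add, ext_comp_germ inf_le_left x hUV, ext_comp_germ inf_le_right x hUV]⟩
  | tmul c d =>
    obtain ⟨U, hU, a, rfl⟩ := X.presheaf.exists_germ_eq c
    exact ⟨U, hU, a ⊗ₜ d, rfl⟩

theorem exists_lifts {x : X} {ι : Type*} [Finite ι] (z : ι → X.presheaf.stalk x ⊗[k] D) :
    ∃ (U : X.Opens) (hx : x ∈ U) (y : ι → Γ(X, U) ⊗[k] D),
      ∀ i, ext D (germA U x hx) (y i) = z i := by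
  cases nonempty_fintype ι
  choose U hU y hy using fun i => exists_lift (z i)
  have hle : ∀ i, Finset.univ.inf U ≤ U i := fun i => Finset.inf_le (Finset.mem_univ i)
  refine ⟨Finset.univ.inf U, ?_, fun i => ext D (resA (hle i)) (y i), fun i => ?_⟩
  · rw [← SetLike.mem_coe, TopologicalSpace.Opens.coe_finset_inf]
    simpa using hU
  · rw [ext_comp_germ, hy]

theorem exists_liftsO {x : X} {ι : Type*} [Finite ι] (z : ι → X.presheaf.stalk x) :
    ∃ (U : X.Opens) (hx : x ∈ U) (y : ι → Γ(X, U)), ∀ i, X.presheaf.germ U x hx (y i) = z i := by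
  cases nonempty_fintype ι
  choose U hU y hy using fun i => X.presheaf.exists_germ_eq (z i)
  have hle : ∀ i, Finset.univ.inf U ≤ U i := fun i => Finset.inf_le (Finset.mem_univ i)
  refine ⟨Finset.univ.inf U, ?_, fun i => resO (hle i) (y i), fun i => ?_⟩
  · rw [← SetLike.mem_coe, TopologicalSpace.Opens.coe_finset_inf]
    simpa using hU
  · rw [← hy i]
    exact X.presheaf.germ_res_apply (homOfLE (hle i)) x _ (y i)

theorem genericPoint_mem [IsIntegral X] {U : X.Opens} {x : X} (hx : x ∈ U) :
    genericPoint X ∈ U := (genericPoint_specializes x).mem_open U.isOpen hx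

theorem eq_of_genericPoint_notMem [IsIntegral X] {U : X.Opens} (h : genericPoint X ∉ U)
    (z w : Γ(X, U) ⊗[k] D) : z = w := by
  have hU : U = ⊥ := by
    refine le_bot_iff.1 fun x hx => h (genericPoint_mem hx)
  have : Subsingleton Γ(X, U) := by rw [hU]; infer_instance
  have h1 : ∀ z : Γ(X, U) ⊗[k] D, z = 0 := fun z => by
    rw [← one_smul Γ(X, U) z, Subsingleton.elim (1 : Γ(X, U)) 0, zero_smul]
  rw [h1 z, h1 w]

end Spread

section Splitting

variable {k : Type u} [Field k] {D : Type u} [DivisionRing D] [Algebra k D]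
  [FiniteDimensional k D] {n : ℕ} {X : Scheme.{u}} [X.Over (Spec (.of k))] [IsIntegral X]

theorem ext_germA_injective {U : X.Opens} (x : X)
    (hx : x ∈ U) :
    Function.Injective (ext D (germA (k := k) U x hx)) :=
  ext_injective _ (germ_injective_of_isIntegral X x hx)

/-- A local trivialization of the Severi-Brauer variety over an open set `U`: an idempotent `e` of
`O_X(U) ⊗ D` which generates `𝒯`, which is full (`1 = ∑ aᵢ e bᵢ`), and of rank one
(`e z e` is a multiple of `e`), together with elements `u` and `v` which realize the equivalence of
`e` and `σ(e)`. -/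
structure Splitting (sb : SeveriBrauer k D n X) (σ : Involution k D) (U : X.Opens) where
  e : Γ(X, U) ⊗[k] D
  u : Γ(X, U) ⊗[k] D
  v : Γ(X, U) ⊗[k] D
  m : ℕ
  a : Fin m → Γ(X, U) ⊗[k] D
  b : Fin m → Γ(X, U) ⊗[k] D
  e_mul_e : e * e = e
  full : ∑ i, a i * e * b i = 1
  corner (z : Γ(X, U) ⊗[k] D) : ∃ c : Γ(X, U), e * z * e = c • e
  u_e : u * e = u
  σe_u : σ.onExt _ e * u = u
  e_v : e * v = v
  v_σe : v * σ.onExt _ e = v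
  u_v : u * v = σ.onExt _ e
  v_u : v * u = e
  mem_iff {W : X.Opens} (h : W ≤ U) (s : Γ(X, W) ⊗[k] D) :
    s ∈ interSections (spaceT sb) W ↔ s * ext D (resA h) e = s

namespace Splitting

variable {sb : SeveriBrauer k D n X} {σ : Involution k D} {U : X.Opens}

/-- The restriction of a trivialization to a smaller open set. -/
def restrict (S : Splitting sb σ U) {W : X.Opens} (h : W ≤ U) : Splitting sb σ W where
  e := ext D (resA h) S.e
  u := ext D (resA h) S.u
  v := ext D (resA h) S.v
  m := S.m
  a i := ext D (resA h) (S.a i)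
  b i := ext D (resA h) (S.b i)
  e_mul_e := by rw [← map_mul, S.e_mul_e]
  full := by simp only [← map_mul, ← map_sum, S.full, map_one]
  corner := exists_smul_of_ext (resA h) S.corner
  u_e := by rw [← map_mul, S.u_e]
  σe_u := by rw [← σ.ext_onExt, ← map_mul, S.σe_u]
  e_v := by rw [← map_mul, S.e_v]
  v_σe := by rw [← σ.ext_onExt, ← map_mul, S.v_σe]
  u_v := by rw [← map_mul, S.u_v, σ.ext_onExt]
  v_u := by rw [← map_mul, S.v_u]
  mem_iff h' s := by rw [S.mem_iff (h'.trans h), ext_resA_resA]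

theorem eq_zero_of_smul_e (S : Splitting sb σ U) {c : Γ(X, U)} (h : c • S.e = 0) : c = 0 :=
  eq_zero_of_smul_full S.full h

end Splitting

omit [FiniteDimensional k D] in
theorem ext_specializeA_germA {U : X.Opens} {x : X} (hx : x ∈ U) (z : Γ(X, U) ⊗[k] D) :
    ext D (specializeA (k := k) (genericPoint_specializes x)) (ext D (germA U x hx) z) =
      ext D (germA U _ (genericPoint_mem hx)) z := by
  rw [ext_ext, specializeA_comp_germA]

omit [FiniteDimensional k D] in
theorem mem_idealT_iff (sb : SeveriBrauer k D n X) {x : X} {e : X.presheaf.stalk x ⊗[k] D}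
    (he : e ∈ (sb.equiv _ (stalkPt x)).1) (hye : ∀ y ∈ (sb.equiv _ (stalkPt x)).1, y * e = y)
    (z : X.functionField ⊗[k] D) : z ∈ idealT sb ↔
      z * ext D (specializeA (k := k) (genericPoint_specializes x)) e = z := by
  rw [idealT_eq_map sb x]
  constructor
  · intro hz
    refine Submodule.span_induction
      (p := fun z _ => z * ext D (specializeA (k := k) (genericPoint_specializes x)) e = z)
      ?_ ?_ ?_ ?_ hz
    · rintro _ ⟨w, hw, rfl⟩
      refine (map_mul (ext D (specializeA (k := k) (genericPoint_specializes x))) w e).symm.trans ?_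
      rw [hye w hw]
    · exact zero_mul _
    · intro z w _ _ hz hw
      rw [add_mul, hz, hw]
    · intro c z _ hz
      rw [smul_eq_mul, mul_assoc, hz]
  · intro hz
    rw [← hz]
    exact Ideal.mul_mem_left _ _ (Ideal.mem_map_of_mem _ he)

/-- The Severi-Brauer variety is locally trivial: an idempotent which generates the left ideal over
the local ring at `x` extends to a neighbourhood of `x`. -/
theorem exists_splitting [Algebra.IsCentral k D] (hn : n ≠ 0)
    (hD : Module.finrank k D = n ^ 2) (sb : SeveriBrauer k D n X) (σ : Involution k D) (x : X) :
    ∃ U : X.Opens, x ∈ U ∧ Nonempty (Splitting sb σ U) := by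
  let R := X.presheaf.stalk x
  let K := IsLocalRing.ResidueField R
  let q : R →ₐ[k] K := residueA x
  obtain ⟨J, hJ⟩ := (sb.equiv R (stalkPt x)).2.1
  have hI : Module.finrank K (((sb.equiv R (stalkPt x)).1.map (ext D q)).restrictScalars K) = n := by
    rw [← sb.equiv_points_map q (stalkPt x)]
    have h1 := (sb.equiv K ((stalkPt x).map q)).2.2 ⊥
    rw [Module.rankAtStalk_eq_finrank_of_free] at h1
    exact h1
  obtain ⟨e, he, hye, ⟨m, a, b, hab⟩, hc⟩ := exists_idempotent_of_isLocalRing hn hD _ J hJ q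
    IsLocalRing.residue_surjective hI
  have hee : e * e = e := hye e he
  have hσab : ∑ i, σ.onExt R (b i) * σ.onExt R e * σ.onExt R (a i) = 1 := by
    have := congrArg (σ.onExt R) hab
    rw [map_sum] at this
    simp only [σ.onExt_mul] at this
    have h1 : σ.onExt R 1 = 1 := by simp [Algebra.TensorProduct.one_def, σ.map_one]
    rw [h1] at this
    simpa only [mul_assoc] using this
  have hσc := exists_smul_of_onExt σ hc
  obtain ⟨u, v, hu, hv, huv, hvu⟩ := exists_equivalence_of_idempotents hee
    (show σ.onExt R e * σ.onExt R e = σ.onExt R e by rw [← σ.onExt_mul, hee]) hab hσab hc hσc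
  let β := Module.finBasis k D
  choose c hc using fun j => hc (1 ⊗ₜ β j)
  obtain ⟨U₁, hx₁, y, hy⟩ := exists_lifts (Sum.elim ![e, u, v] (Sum.elim a b))
  obtain ⟨U₂, hx₂, c', hc'⟩ := exists_liftsO c
  obtain ⟨U, h₁, h₂, hx⟩ : ∃ U : X.Opens, U ≤ U₁ ∧ U ≤ U₂ ∧ x ∈ U :=
    ⟨U₁ ⊓ U₂, inf_le_left, inf_le_right, hx₁, hx₂⟩
  let g : Γ(X, U) ⊗[k] D →ₐ[k] R ⊗[k] D := ext D (germA U x hx)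
  have hg : Function.Injective g := ext_germA_injective x hx
  have hl : ∀ i, g (ext D (resA h₁) (y i)) = _ := fun i => (ext_comp_germ h₁ x hx (y i)).trans (hy i)
  have hcl : ∀ j, germA (k := k) U x hx (resO h₂ (c' j)) = c j := fun j =>
    (X.presheaf.germ_res_apply (homOfLE h₂) x hx (c' j)).trans (hc' j)
  let E := ext D (resA h₁) (y (.inl 0))
  let u' := ext D (resA h₁) (y (.inl 1))
  let v' := ext D (resA h₁) (y (.inl 2))
  have hE : g E = e := hl _
  have hu' : g u' = u := hl _
  have hv' : g v' = v := hl _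
  have hσ : ∀ z, g (σ.onExt _ z) = σ.onExt R (g z) := fun z => σ.ext_onExt _ z
  refine ⟨U, hx, ⟨
    { e := E, u := u', v := v', m := m
      a := fun i => ext D (resA h₁) (y (.inr (.inl i)))
      b := fun i => ext D (resA h₁) (y (.inr (.inr i)))
      e_mul_e := hg (by rw [map_mul, hE, hee])
      full := hg (by
        rw [map_sum, map_one, ← hab]
        refine Finset.sum_congr rfl fun i _ => ?_
        rw [map_mul, map_mul, hE, hl, hl]
        rfl)
      corner := fun z => ?_
      u_e := hg (by rw [map_mul, hE, hu', ← hu, mul_assoc, hee])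
      σe_u := hg (by
        rw [map_mul, hσ, hE, hu', ← hu, ← mul_assoc, ← mul_assoc, ← σ.onExt_mul, hee])
      e_v := hg (by rw [map_mul, hE, hv', ← hv, ← mul_assoc, ← mul_assoc, hee])
      v_σe := hg (by rw [map_mul, hσ, hE, hv', ← hv, mul_assoc, ← σ.onExt_mul, hee])
      u_v := hg (by rw [map_mul, hσ, hE, hv', hu', huv])
      v_u := hg (by rw [map_mul, hE, hv', hu', hvu])
      mem_iff := fun {W} h s => ?_ }⟩⟩
  · induction z with
    | zero => exact ⟨0, by simp⟩
    | add z w hz hw =>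
      obtain ⟨c, hc⟩ := hz
      obtain ⟨d, hd⟩ := hw
      exact ⟨c + d, by rw [mul_add, add_mul, hc, hd, add_smul]⟩
    | tmul r d =>
      have h1 : r ⊗ₜ[k] d = ∑ j, (β.repr d j • r) • (1 ⊗ₜ[k] β j) := by
        conv_lhs => rw [← β.sum_repr d]
        rw [TensorProduct.tmul_sum]
        refine Finset.sum_congr rfl fun j _ => ?_
        rw [TensorProduct.smul_tmul', smul_eq_mul, mul_one, TensorProduct.smul_tmul]
      have h2 : ∀ j, E * (1 ⊗ₜ β j) * E = resO h₂ (c' j) • E := fun j => hg (by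
        rw [map_mul, map_mul, hE]
        refine Eq.trans ?_ ((hc j).trans ?_)
        · congr 2
          simp [g]
        · refine Eq.trans ?_ (ext_smul D (germA U x hx) _ E).symm
          rw [hcl]
          exact congrArg _ hE.symm)
      refine ⟨∑ j, (β.repr d j • r) * resO h₂ (c' j), ?_⟩
      rw [h1, Finset.mul_sum, Finset.sum_mul, Finset.sum_smul]
      refine Finset.sum_congr rfl fun j _ => ?_
      rw [mul_smul_comm, smul_mul_assoc, h2, smul_smul]
  -- the sections of `𝒯` are defined through the generic point, which lies in `W` unless `W` is empty
  · by_cases hW : genericPoint X ∈ W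
    swap
    · exact ⟨fun _ => eq_of_genericPoint_notMem hW _ _, fun _ h => absurd h hW⟩
    have hEF : ext D (specializeA (k := k) (genericPoint_specializes x)) e =
        ext D (germA W _ hW) (ext D (resA h) E) := by
      rw [← hE]
      exact (ext_specializeA_germA hx E).trans (ext_comp_germ h _ hW E).symm
    have h1 : s ∈ interSections (spaceT sb) W ↔ ext D (germA W _ hW) s ∈ idealT sb :=
      ⟨fun h => h hW, fun h _ => h⟩
    rw [h1, mem_idealT_iff sb he hye, hEF, ← map_mul]
    exact ⟨fun h => ext_germA_injective _ hW h, fun h => by rw [h]⟩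

end Splitting

/-! ### Retracts of free sheaves, and intersections with `D ⊗ O_X` -/

section Retract

/-- Over a local ring, an idempotent matrix is a product `B C` with `C B = 1`. -/
theorem exists_matrix_factorization {R : Type*} [CommRing R] [IsLocalRing R] {ι : Type*} [Fintype ι]
    [DecidableEq ι] (E : Matrix ι ι R) (hE : E * E = E) :
    ∃ (m : ℕ) (B : Matrix ι (Fin m) R) (C : Matrix (Fin m) ι R), B * C = E ∧ C * B = 1 := by
  let p : (ι → R) →ₗ[R] (ι → R) := Matrix.toLin' E
  let P := LinearMap.range p
  let s : (ι → R) →ₗ[R] P := p.rangeRestrict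
  have hs : s ∘ₗ P.subtype = LinearMap.id := by
    ext ⟨_, y, rfl⟩ : 1
    refine Subtype.ext ?_
    change p (p y) = p y
    simp only [p, Matrix.toLin'_apply, Matrix.mulVec_mulVec, hE]
  have : Module.Projective R P := Module.Projective.of_split P.subtype s hs
  have : Module.Finite R P := Module.Finite.range p
  have : Module.Free R P := Module.free_of_flat_of_isLocalRing
  let b := Module.finBasis R P
  let B : (Fin (Module.finrank R P) → R) →ₗ[R] (ι → R) := P.subtype ∘ₗ b.equivFun.symm.toLinearMap
  let C : (ι → R) →ₗ[R] (Fin (Module.finrank R P) → R) := b.equivFun.toLinearMap ∘ₗ s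
  refine ⟨_, LinearMap.toMatrix' B, LinearMap.toMatrix' C, ?_, ?_⟩
  · rw [← LinearMap.toMatrix'_comp]
    have : B ∘ₗ C = p := by
      ext1 x
      ext1
      simp [B, C, s]
    rw [this]
    exact LinearMap.toMatrix'_toLin' E
  · rw [← LinearMap.toMatrix'_comp]
    have : C ∘ₗ B = LinearMap.id := by
      refine LinearMap.ext fun y => ?_
      have h1 : s (P.subtype (b.equivFun.symm y)) = b.equivFun.symm y := LinearMap.congr_fun hs _
      change b.equivFun (s (P.subtype (b.equivFun.symm y))) = y
      rw [h1, LinearEquiv.apply_symm_apply]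
    rw [this, LinearMap.toMatrix'_id]

variable {X : Scheme.{u}} {M N : X.Modules} {U : X.Opens} {ι : Type*} [Fintype ι] {e : ι → Γ(M, U)}

/-- A direct summand of a free sheaf is locally free. -/
theorem exists_basis_of_retract [IsIntegral X] (hb : IsBasisOn M U e)
    (i : Γ(homSheaf N M, U)) (r : Γ(homSheaf M N, U))
    (hri : ∀ (V : X.Opens) (h : V ≤ U) (y : Γ(N, V)), ev r h (ev i h y) = y) {x : X} (hx : x ∈ U) :
    ∃ (V : X.Opens) (m : ℕ) (f : Fin m → Γ(N, V)), x ∈ V ∧ IsBasisOn N V f := by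
  classical
  let E : Matrix ι ι Γ(X, U) := fun a b => hb.coord le_rfl (ev i le_rfl (ev r le_rfl (e b))) a
  -- coordinates of `i (r y)`
  have hEcoord : ∀ (V : X.Opens) (h : V ≤ U) (y : Γ(M, V)),
      hb.coord h (ev i h (ev r h y)) = (E.map (resO h)).mulVec (hb.coord h y) := by
    intro V h y
    funext a
    conv_lhs => rw [← hb.sum_coord h y]
    rw [map_sum, map_sum, map_sum, Finset.sum_apply, Matrix.mulVec, dotProduct]
    refine Finset.sum_congr rfl fun b _ => ?_
    rw [map_smul, map_smul, map_smul, Pi.smul_apply, smul_eq_mul, mul_comm]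
    congr 1
    rw [res_ev r le_rfl h, res_ev i le_rfl h]
    exact hb.coord_res le_rfl h _ a
  have hEE : E * E = E := by
    ext a b
    have h1 : ∀ c, E.mulVec (Pi.single c 1) = fun a => E a c := fun c => by
      ext a; simp
    have h2 := hEcoord U le_rfl (ev i le_rfl (ev r le_rfl (e b)))
    rw [hri] at h2
    have h3 : E.map (resO (le_refl U)) = E := by
      ext a b
      exact resO_self _ _
    rw [h3] at h2
    exact (congrFun h2 a).symm
  obtain ⟨m, B, C, hBC, hCB⟩ := exists_matrix_factorization (E.map (X.presheaf.germ U x hx).hom)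
    (by rw [← Matrix.map_mul, hEE])
  obtain ⟨U', hx', y, hy⟩ := exists_liftsO
    (Sum.elim (fun p : ι × Fin m => B p.1 p.2) (fun p : Fin m × ι => C p.1 p.2))
  obtain ⟨V, hV, hV', hxV⟩ : ∃ V : X.Opens, V ≤ U ∧ V ≤ U' ∧ x ∈ V :=
    ⟨U ⊓ U', inf_le_left, inf_le_right, hx, hx'⟩
  let g := (X.presheaf.germ V x hxV).hom
  have hg : Function.Injective g := germ_injective_of_isIntegral X x hxV
  let B' : Matrix ι (Fin m) Γ(X, V) := fun a j => resO hV' (y (.inl (a, j)))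
  let C' : Matrix (Fin m) ι Γ(X, V) := fun j a => resO hV' (y (.inr (j, a)))
  have hgr : ∀ a, g (resO hV' (y a)) = _ := fun a =>
    (X.presheaf.germ_res_apply (homOfLE hV') x hxV (y a)).trans (hy a)
  have hB : B'.map g = B := by ext a j; exact hgr _
  have hC : C'.map g = C := by ext a j; exact hgr _
  have hE' : (E.map (resO hV)).map g = E.map (X.presheaf.germ U x hx).hom := by
    ext a b; exact X.presheaf.germ_res_apply (homOfLE hV) x hxV _
  have hBC' : B' * C' = E.map (resO hV) := Matrix.map_injective hg (by
    change (B' * C').map g = (E.map _).map g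
    rw [Matrix.map_mul, hB, hC, hE', hBC])
  have hCB' : C' * B' = 1 := Matrix.map_injective hg (by
    change (C' * B').map g = (1 : Matrix _ _ _).map g
    rw [Matrix.map_mul, hB, hC, hCB, Matrix.map_one _ (map_zero g) (map_one g)])
  refine ⟨V, m, fun j => ev r hV (∑ a, B' a j • res M hV (e a)), hxV, fun W h => ?_⟩
  have hresE : (E.map (resO hV)).map (resO h) = E.map (resO (h.trans hV)) := by
    ext a b; exact resO_resO _ _ _
  have key : ∀ c : Fin m → Γ(X, W),
      ∑ j, c j • res N h (ev r hV (∑ a, B' a j • res M hV (e a))) =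
      ev r (h.trans hV) (∑ a, ((B'.map (resO h)).mulVec c) a • res M (h.trans hV) (e a)) := by
    intro c
    simp only [← res_ev r hV h, map_sum, res_smul, res_res, Matrix.mulVec, dotProduct, map_smul,
      Finset.smul_sum, Finset.sum_smul]
    rw [Finset.sum_comm]
    refine Finset.sum_congr rfl fun a _ => Finset.sum_congr rfl fun j _ => ?_
    rw [smul_smul, mul_comm]
    rfl
  constructor
  · intro c c' hcc
    dsimp only at hcc
    rw [key, key] at hcc
    have h1 := congrArg (fun z => hb.coord (h.trans hV) (ev i (h.trans hV) z)) hcc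
    simp only [hEcoord, hb.coord_sum] at h1
    have h2 : ∀ c, ((C'.map (resO h)).mulVec ((E.map (resO (h.trans hV))).mulVec
        ((B'.map (resO h)).mulVec c))) = c := by
      intro c
      rw [Matrix.mulVec_mulVec, Matrix.mulVec_mulVec, ← hresE, ← Matrix.map_mul, ← Matrix.map_mul,
        ← hBC', ← Matrix.mul_assoc, hCB', Matrix.one_mul, hCB',
        Matrix.map_one _ (map_zero _) (map_one _), Matrix.one_mulVec]
    rw [← h2 c, h1, h2]
  · intro z
    refine ⟨(C'.map (resO h)).mulVec (hb.coord (h.trans hV) (ev i (h.trans hV) z)), ?_⟩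
    dsimp only
    rw [key, Matrix.mulVec_mulVec, ← Matrix.map_mul, hBC', hresE, ← hEcoord, hb.sum_coord, hri, hri]

end Retract

section InterSections

variable {k : Type u} [Field k] {D : Type u} [Ring D] [Algebra k D]
  [FiniteDimensional k D] {n : ℕ} {X : Scheme.{u}} [X.Over (Spec (.of k))]

theorem sheafD_isLocFree : IsLocFree (sheafD k X D) := by
  refine isLocFree_of_basis fun x => ⟨⊤, _, inferInstance,
    fun j => (1 ⊗ₜ[k] Module.finBasis k D j : Γ(X, ⊤) ⊗[k] D), trivial, fun V h => ?_⟩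
  let b := Algebra.TensorProduct.basis Γ(X, V) (Module.finBasis k D)
  have h1 : (fun c : Fin (Module.finrank k D) → Γ(X, V) => ∑ j, c j •
      res (sheafD k X D) h (1 ⊗ₜ[k] Module.finBasis k D j : Γ(X, ⊤) ⊗[k] D)) =
      b.equivFun.symm := by
    funext c
    rw [Module.Basis.equivFun_symm_apply]
    refine Finset.sum_congr rfl fun j _ => ?_
    refine congrArg (fun z : Γ(X, V) ⊗[k] D => c j • z) ?_
    rw [Algebra.TensorProduct.basis_apply]
    change ext D (resA h) _ = _
    rw [Algebra.TensorProduct.map_tmul, map_one]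
    rfl
  rw [h1]
  exact b.equivFun.symm.bijective

variable [IsIntegral X] {W : Submodule X.functionField (X.functionField ⊗[k] D)} {U : X.Opens}

/-- A section of `W ∩ (D ⊗ O_X)` given by its value. -/
def interMk (s : Γ(X, U) ⊗[k] D) (hs : s ∈ interSections W U) : Γ(inter W, U) :=
  (⟨s, hs⟩ : interSections W U)

theorem interVal_mem (s : Γ(inter W, U)) : interVal s ∈ interSections W U :=
  (s : interSections W U).2

theorem inter_ext {s t : Γ(inter W, U)} (h : interVal s = interVal t) : s = t :=
  Subtype.ext h

variable (sb : SeveriBrauer k D n X)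

theorem mul_mem_interSections_spaceT (z : Γ(X, U) ⊗[k] D) {s : Γ(X, U) ⊗[k] D}
    (hs : s ∈ interSections (spaceT sb) U) : z * s ∈ interSections (spaceT sb) U := fun h => by
  change ext D (germA U _ h) (z * s) ∈ idealT sb
  rw [map_mul]
  exact (idealT sb).mul_mem_left _ (hs h)

theorem mem_interSections_spaceL (σ : Involution k D) {s : Γ(X, U) ⊗[k] D} :
    s ∈ interSections (spaceL sb σ.map) U ↔
      s ∈ interSections (spaceT sb) U ∧ σ.onExt _ s ∈ interSections (spaceT sb) U := by
  have h1 : ∀ h : genericPoint X ∈ U, ext D (germA U _ h) s ∈ (spaceT sb).map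
      (σ.onExt X.functionField) ↔ ext D (germA U _ h) (σ.onExt _ s) ∈ spaceT sb := by
    intro h
    rw [σ.ext_onExt]
    constructor
    · rintro ⟨t, ht, hts⟩
      rw [← hts, σ.onExt_onExt]
      exact ht
    · exact fun h => ⟨_, h, σ.onExt_onExt _ _⟩
  exact ⟨fun hs => ⟨fun h => (hs h).1, fun h => (h1 h).1 (hs h).2⟩,
    fun hs h => ⟨hs.1 h, (h1 h).2 (hs.2 h)⟩⟩

end InterSections

/-! ### The sheaves `𝒯`, `ℒ_σ` and `V ⊗ 𝒯` -/

section RightAction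

variable {k : Type u} [Field k] {D : Type u} [Ring D] [Algebra k D]
  {X : Scheme.{u}} [X.Over (Spec (.of k))]

/-- The action of `O_X(U) ⊗ D` on the sections over `U` of a right module over `D ⊗ O_X`. -/
def rmul {V : RMod k D X} {U : X.Opens} (v : Γ(V.mod, U)) : Γ(X, U) ⊗[k] D →+ Γ(V.mod, U) :=
  TensorProduct.liftAddHom
    (AddMonoidHom.mk' (fun c => AddMonoidHom.mk' (fun d => c • sec (V.act d) U v)
        (fun d d' => by rw [V.act_add, sec_add, smul_add]))
      (fun c c' => by ext d; exact add_smul c c' _))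
    (fun r c d => by
      change (r • c) • sec (V.act d) U v = c • sec (V.act (r • d)) U v
      rw [Algebra.smul_def r d, V.act_mul, sec_comp, ← map_smul, ← map_smul, V.act_algebraMap,
        smul_smul, Algebra.smul_def, mul_comm])

variable {V : RMod k D X} {U : X.Opens}

theorem rmul_tmul (v : Γ(V.mod, U)) (c : Γ(X, U)) (d : D) :
    rmul v (c ⊗ₜ d) = c • sec (V.act d) U v := rfl

theorem rmul_one_tmul (v : Γ(V.mod, U)) (d : D) :
    rmul v (1 ⊗ₜ d) = sec (V.act d) U v := one_smul _ _

theorem add_rmul (v w : Γ(V.mod, U)) (z : Γ(X, U) ⊗[k] D) :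
    rmul (v + w) z = rmul v z + rmul w z := by
  induction z with
  | zero => simp
  | add z z' hz hz' => rw [map_add, map_add, map_add, hz, hz']; abel
  | tmul c d => rw [rmul_tmul, rmul_tmul, rmul_tmul, map_add, smul_add]

theorem smul_rmul (a : Γ(X, U)) (v : Γ(V.mod, U)) (z : Γ(X, U) ⊗[k] D) :
    rmul (a • v) z = a • rmul v z := by
  induction z with
  | zero => simp
  | add z z' hz hz' => rw [map_add, map_add, hz, hz', smul_add]
  | tmul c d => rw [rmul_tmul, rmul_tmul, map_smul, smul_comm]

theorem zero_rmul (z : Γ(X, U) ⊗[k] D) : rmul (0 : Γ(V.mod, U)) z = 0 := by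
  have := smul_rmul (0 : Γ(X, U)) (0 : Γ(V.mod, U)) z
  rwa [zero_smul, zero_smul] at this

theorem sum_rmul {ι : Type*} (s : Finset ι) (v : ι → Γ(V.mod, U)) (z : Γ(X, U) ⊗[k] D) :
    rmul (∑ i ∈ s, v i) z = ∑ i ∈ s, rmul (v i) z :=
  map_sum (AddMonoidHom.mk' (fun v => rmul v z) (fun v w => add_rmul v w z)) v s

theorem rmul_smul (a : Γ(X, U)) (v : Γ(V.mod, U)) (z : Γ(X, U) ⊗[k] D) :
    rmul v (a • z) = a • rmul v z := by
  induction z with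
  | zero => simp
  | add z z' hz hz' => rw [smul_add, map_add, map_add, hz, hz', smul_add]
  | tmul c d => rw [TensorProduct.smul_tmul', rmul_tmul, rmul_tmul, smul_eq_mul, mul_smul]

theorem rmul_one (v : Γ(V.mod, U)) : rmul v 1 = v := by
  rw [Algebra.TensorProduct.one_def, rmul_tmul, V.act_one, sec_id, one_smul]

theorem rmul_mul (v : Γ(V.mod, U)) (z w : Γ(X, U) ⊗[k] D) :
    rmul v (z * w) = rmul (rmul v z) w := by
  induction z with
  | zero => rw [zero_mul, map_zero, zero_rmul]
  | add z z' hz hz' => rw [add_mul, map_add, map_add, add_rmul, hz, hz']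
  | tmul c d =>
    induction w with
    | zero => simp
    | add w w' hw hw' => rw [mul_add, map_add, map_add, hw, hw']
    | tmul c' d' =>
      rw [Algebra.TensorProduct.tmul_mul_tmul, rmul_tmul, rmul_tmul, rmul_tmul, V.act_mul,
        sec_comp, map_smul, smul_smul, mul_comm]

theorem res_rmul {W : X.Opens} (h : W ≤ U) (v : Γ(V.mod, U)) (z : Γ(X, U) ⊗[k] D) :
    res V.mod h (rmul v z) = rmul (res V.mod h v) (ext D (resA h) z) := by
  induction z with
  | zero => simp
  | add z z' hz hz' => simp only [map_add, hz, hz']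
  | tmul c d =>
    rw [rmul_tmul, res_smul, ← sec_res]
    rfl

theorem RMod.map_rmul {W : RMod k D X} (f : V ⟶ W) (v : Γ(V.mod, U)) (z : Γ(X, U) ⊗[k] D) :
    sec f.hom U (rmul v z) = rmul (sec f.hom U v) z := by
  induction z with
  | zero => simp
  | add z z' hz hz' => simp only [map_add, hz, hz']
  | tmul c d => rw [rmul_tmul, map_smul, RMod.comm_apply, rmul_tmul]

theorem sharpEv_rmul [FiniteDimensional k D] {U' : X.Opens} (f : Γ(sharpSheaf V, U')) (h : U ≤ U')
    (v : Γ(V.mod, U)) (z : Γ(X, U) ⊗[k] D) : sharpEv f h (rmul v z) = sharpEv f h v * z := by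
  have h0 : sharpEv f h 0 = 0 := by
    have := sharpEv_smul f h 0 0
    rwa [zero_smul, zero_smul] at this
  induction z with
  | zero => simp [h0]
  | add z z' hz hz' => rw [map_add, sharpEv_add, hz, hz', mul_add]
  | tmul c d =>
    rw [rmul_tmul, sharpEv_smul, sharpEv_act, ← mul_smul_comm, TensorProduct.smul_tmul',
      smul_eq_mul, mul_one]

theorem sharpEv_rmul_sharp [FiniteDimensional k D] (σ : Involution k D) {W : X.Opens}
    (f : Γ(sharpSheaf V, U)) (z : Γ(X, U) ⊗[k] D) (h : W ≤ U) (v : Γ(V.mod, W)) :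
    sharpEv (V := V) (rmul (V := sharp σ V) f z) h v =
      σ.onExt _ (ext D (resA h) z) * sharpEv f h v := by
  induction z with
  | zero =>
    rw [map_zero, map_zero, map_zero, zero_mul]
    rfl
  | add z z' hz hz' =>
    rw [map_add, map_add, map_add, add_mul, ← hz, ← hz']
    rfl
  | tmul c d =>
    change resO h c • (1 ⊗ₜ[k] (σ.map d) * sharpEv f h v) = (resO h c ⊗ₜ (σ.map d)) * sharpEv f h v
    rw [← smul_mul_assoc, TensorProduct.smul_tmul', smul_eq_mul, mul_one]

end RightAction

section Multiplication

variable {k : Type u} [Field k] {D : Type u} [DivisionRing D] [Algebra k D]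
  [FiniteDimensional k D] {n : ℕ} {X : Scheme.{u}} [X.Over (Spec (.of k))] [IsIntegral X]
  {sb : SeveriBrauer k D n X} {σ : Involution k D} {U : X.Opens} {V : RMod k D X}

/-- A section of `𝒯`, as an element of `O_X(U) ⊗ D`. -/
def tVal (t : Γ(sheafT sb, U)) : Γ(X, U) ⊗[k] D := interVal t

theorem tVal_ext {t t' : Γ(sheafT sb, U)} (h : tVal t = tVal t') : t = t' := inter_ext h

theorem tVal_mem (t : Γ(sheafT sb, U)) : tVal t ∈ interSections (spaceT sb) U := interVal_mem t

theorem tVal_add (t t' : Γ(sheafT sb, U)) : tVal (t + t') = tVal t + tVal t' := rfl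

theorem tVal_smul (a : Γ(X, U)) (t : Γ(sheafT sb, U)) : tVal (a • t) = a • tVal t := rfl

theorem tVal_res {W : X.Opens} (h : W ≤ U) (t : Γ(sheafT sb, U)) :
    tVal (res (sheafT sb) h t) = ext D (resA h) (tVal t) := rfl

theorem tVal_leftAct (d : D) (t : Γ(sheafT sb, U)) :
    tVal (sec (leftAct sb d) U t) = 1 ⊗ₜ[k] d * tVal t := rfl

/-- A section of `𝒯`, given by its value. -/
def tMk (s : Γ(X, U) ⊗[k] D) (hs : s ∈ interSections (spaceT sb) U) : Γ(sheafT sb, U) :=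
  interMk s hs

/-- A section of `ℒ_σ`, as an element of `O_X(U) ⊗ D`. -/
def lVal (s : Γ(sheafL sb σ.map, U)) : Γ(X, U) ⊗[k] D := interVal s

theorem lVal_ext {s s' : Γ(sheafL sb σ.map, U)} (h : lVal s = lVal s') : s = s' := inter_ext h

theorem lVal_mem (s : Γ(sheafL sb σ.map, U)) : lVal s ∈ interSections (spaceL sb σ.map) U :=
  interVal_mem s

theorem lVal_add (s s' : Γ(sheafL sb σ.map, U)) : lVal (s + s') = lVal s + lVal s' := rfl

theorem lVal_smul (a : Γ(X, U)) (s : Γ(sheafL sb σ.map, U)) : lVal (a • s) = a • lVal s := rfl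

theorem lVal_res {W : X.Opens} (h : W ≤ U) (s : Γ(sheafL sb σ.map, U)) :
    lVal (res (sheafL sb σ.map) h s) = ext D (resA h) (lVal s) := rfl

/-- A section of `ℒ_σ`, given by its value. -/
def lMk (s : Γ(X, U) ⊗[k] D) (hs : s ∈ interSections (spaceL sb σ.map) U) :
    Γ(sheafL sb σ.map, U) :=
  interMk s hs

/-- Multiplication of a section of `𝒯` by a section of `D ⊗ O_X` on the left. -/
def lmul (z : Γ(X, U) ⊗[k] D) (t : Γ(sheafT sb, U)) : Γ(sheafT sb, U) :=
  tMk (z * tVal t) (mul_mem_interSections_spaceT sb z (tVal_mem t))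

theorem tVal_lmul (z : Γ(X, U) ⊗[k] D) (t : Γ(sheafT sb, U)) :
    tVal (lmul z t) = z * tVal t := rfl

theorem tmul_rmul (v : Γ(V.mod, U)) (z : Γ(X, U) ⊗[k] D) (t : Γ(sheafT sb, U)) :
    tmul (l := leftAct sb) (rmul v z) t = tmul v (lmul z t) := by
  induction z with
  | zero =>
    have h1 : lmul 0 t = 0 := tVal_ext (zero_mul _)
    rw [h1, tmul_zero, map_zero, zero_tmul]
  | add z z' hz hz' =>
    have h1 : lmul (z + z') t = lmul z t + lmul z' t := tVal_ext (add_mul _ _ _)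
    rw [h1, map_add, add_tmul, tmul_add, hz, hz']
  | tmul c d =>
    have h1 : lmul (c ⊗ₜ d) t = c • sec (leftAct sb d) U t := tVal_ext (by
      have h2 : c ⊗ₜ[k] d = c • ((1 : Γ(X, U)) ⊗ₜ[k] d) := by
        rw [TensorProduct.smul_tmul', smul_eq_mul, mul_one]
      exact (congrArg (· * tVal t) h2).trans (smul_mul_assoc c _ (tVal t)))
    rw [h1, rmul_tmul, smul_tmul, tmul_smul, tmul_act]

/-- Multiplication of sections of `V` by sections of `𝒯`. -/
def multBilin (sb : SeveriBrauer k D n X) (V : RMod k D X) (U : X.Opens) :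
    Γ(V.mod, U) →ₗ[Γ(X, U)] Γ(sheafT sb, U) →ₗ[Γ(X, U)] Γ(V.mod, U) where
  toFun v :=
    { toFun := fun t => rmul v (tVal t)
      map_add' := fun t t' => map_add (rmul v) (tVal t) (tVal t')
      map_smul' := fun a t => rmul_smul a v (tVal t) }
  map_add' v w := LinearMap.ext fun t => add_rmul v w (tVal t)
  map_smul' a v := LinearMap.ext fun t => smul_rmul a v (tVal t)

theorem multBilin_act (v : Γ(V.mod, U)) (d : D) (t : Γ(sheafT sb, U)) :
    multBilin sb V U (sec (V.act d) U v) t = multBilin sb V U v (sec (leftAct sb d) U t) := by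
  change rmul (sec (V.act d) U v) (tVal t) = rmul v (1 ⊗ₜ[k] d * tVal t)
  rw [rmul_mul, rmul_one_tmul]

theorem multBilin_res {W : X.Opens} (h : W ≤ U) (v : Γ(V.mod, U)) (t : Γ(sheafT sb, U)) :
    multBilin sb V W (res V.mod h v) (res (sheafT sb) h t) = res V.mod h (multBilin sb V U v t) :=
  (res_rmul h v (tVal t)).symm

variable (sb V) in
/-- The multiplication map `V ⊗ 𝒯 → V`, where the tensor product is over `D ⊗ O_X`. -/
def mult : tensorSheaf V (sheafT sb) (leftAct sb) ⟶ V.mod :=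
  tensorLift (multBilin sb V) (fun _ => multBilin_act) multBilin_res

theorem mult_tmul (v : Γ(V.mod, U)) (t : Γ(sheafT sb, U)) :
    sec (mult sb V) U (tmul v t) = rmul v (tVal t) := by
  have h := tensorLift_tmul (l := leftAct sb) (multBilin sb V) (fun _ => multBilin_act)
    multBilin_res v t
  exact h

variable (sb) in
/-- The morphism `f ⊗ id` from `V ⊗ 𝒯` to `W ⊗ 𝒯`. -/
def tensorMap {W : RMod k D X} (f : V ⟶ W) :
    tensorSheaf V (sheafT sb) (leftAct sb) ⟶ tensorSheaf W (sheafT sb) (leftAct sb) :=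
  (tensorFunctor (sheafT sb) (leftAct sb)).map f

theorem sec_tensorMap {W : RMod k D X} (f : V ⟶ W) (v : Γ(V.mod, U)) (t : Γ(sheafT sb, U)) :
    sec (tensorMap sb f) U (tmul v t) = tmul (sec f.hom U v) t := tensorMap_tmul f v t

theorem mult_naturality {W : RMod k D X} (f : V ⟶ W) :
    tensorMap sb f ≫ mult sb W = mult sb V ≫ f.hom :=
  tensor_hom_ext fun U v t => by
    rw [sec_comp, sec_comp, sec_tensorMap, mult_tmul, mult_tmul, RMod.map_rmul]

theorem mult_map {W : RMod k D X} (f : V ⟶ W) (z : Γ(tensorSheaf V (sheafT sb) (leftAct sb), U)) :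
    sec (mult sb W) U (sec (tensorMap sb f) U z) = sec f.hom U (sec (mult sb V) U z) := by
  rw [← sec_comp, mult_naturality, sec_comp]

/-- A morphism of `O_X`-modules, as a section of the sheaf of homomorphisms. -/
def homSec {M N : X.Modules} (f : M ⟶ N) (U : X.Opens) : Γ(homSheaf M N, U) :=
  evMk (fun V _ => sec f V) (fun _ h x => sec_res f h x)

variable (sb) in
/-- The inclusion of `𝒯` into `D ⊗ O_X`. -/
def incT : sheafT sb ⟶ sheafD k X D :=
  homMk (M := sheafT sb) (fun U => (interSections (spaceT sb) U).subtype) (fun _ _ => rfl)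

namespace Splitting

variable (S : Splitting sb σ U)

theorem mem_iff_self (s : Γ(X, U) ⊗[k] D) : s ∈ interSections (spaceT sb) U ↔ s * S.e = s := by
  rw [S.mem_iff le_rfl, ext_resA_self]

/-- The idempotent `e`, as a section of `𝒯`. -/
def eT : Γ(sheafT sb, U) := tMk S.e ((S.mem_iff_self _).2 S.e_mul_e)

theorem tVal_eT : tVal S.eT = S.e := rfl

theorem res_eT {W : X.Opens} (h : W ≤ U) : res (sheafT sb) h S.eT = (S.restrict h).eT := rfl

theorem tVal_mul_e (t : Γ(sheafT sb, U)) : tVal t * S.e = tVal t :=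
  (S.mem_iff_self _).1 (tVal_mem t)

theorem lmul_eT (t : Γ(sheafT sb, U)) : lmul (tVal t) S.eT = t :=
  tVal_ext (S.tVal_mul_e t)

/-- The section `e` of `𝒯` is a right identity, so `v ⊗ t = v t ⊗ e`. -/
theorem tmul_mult (z : Γ(tensorSheaf V (sheafT sb) (leftAct sb), U)) :
    tmul (sec (mult sb V) U z) S.eT = z := by
  refine tensor_induction (l := leftAct sb) (P := fun W z => ∀ S : Splitting sb σ W,
    tmul (sec (mult sb V) W z) S.eT = z) ?_ ?_ ?_ ?_ U z S
  · intro W z hz S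
    refine eq_of_local _ _ _ fun p hp => ?_
    obtain ⟨W', h, hpW, e⟩ := hz p hp
    exact ⟨W', h, hpW, (res_tmul h _ _).trans ((congrArg (fun v => tmul v (S.restrict h).eT)
      (sec_res _ h z).symm).trans (e (S.restrict h)))⟩
  · intro W S
    rw [map_zero, zero_tmul]
  · intro W z w hz hw S
    rw [map_add, add_tmul, hz, hw]
  · intro W v t S
    rw [mult_tmul, tmul_rmul, lmul_eT]

theorem rmul_mult (z : Γ(tensorSheaf V (sheafT sb) (leftAct sb), U)) :
    rmul (sec (mult sb V) U z) S.e = sec (mult sb V) U z := by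
  conv_rhs => rw [← S.tmul_mult z, mult_tmul]
  rfl

theorem mult_injective (S : Splitting sb σ U) :
    Function.Injective (sec (mult sb V) U) := fun z w h => by
  rw [← S.tmul_mult z, h, S.tmul_mult]

/-- Right multiplication by `e`, from `D ⊗ O_X` to `𝒯`. -/
def projT : Γ(homSheaf (sheafD k X D) (sheafT sb), U) :=
  evMk (M := sheafD k X D) (N := sheafT sb) (fun W h =>
      { toFun := fun s => lmul (val k D s) (S.restrict h).eT
        map_add' := fun s t => tVal_ext (add_mul (val k D s) (val k D t) (S.restrict h).e)
        map_smul' := fun a s => tVal_ext (smul_mul_assoc a (val k D s) (S.restrict h).e) })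
    (fun {W W'} h h' s => tVal_ext (by
      change ext D (resA h') (val k D s) * ext D (resA (h'.trans h)) S.e =
        ext D (resA h') (val k D s * ext D (resA h) S.e)
      rw [map_mul, ext_resA_resA]))

/-- The map `v ↦ v ⊗ e` from `V` to `V ⊗ 𝒯`. -/
def tmulE (V : RMod k D X) :
    Γ(homSheaf V.mod (tensorSheaf V (sheafT sb) (leftAct sb)), U) :=
  evMk (fun W h =>
      { toFun := fun v => tmul v (res _ h S.eT)
        map_add' := fun v w => add_tmul v w _
        map_smul' := fun a v => smul_tmul a v _ })
    (fun {W W'} h h' v => by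
      refine Eq.trans ?_ (res_tmul (l := leftAct sb) h' v (res _ h S.eT)).symm
      rw [res_res]
      rfl)

theorem mem_spaceL_iff (s : Γ(X, U) ⊗[k] D) :
    s ∈ interSections (spaceL sb σ.map) U ↔ s * S.e = s ∧ σ.onExt _ S.e * s = s := by
  rw [mem_interSections_spaceL, S.mem_iff_self, S.mem_iff_self]
  refine and_congr Iff.rfl ⟨fun h => ?_, fun h => ?_⟩
  · have := congrArg (σ.onExt _) h
    rwa [σ.onExt_mul, σ.onExt_onExt] at this
  · have := congrArg (σ.onExt _) h
    rwa [σ.onExt_mul, σ.onExt_onExt] at this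

/-- The generator `u` of `ℒ_σ`. -/
def uL : Γ(sheafL sb σ.map, U) := lMk S.u ((S.mem_spaceL_iff _).2 ⟨S.u_e, S.σe_u⟩)

theorem σcorner (z : Γ(X, U) ⊗[k] D) :
    ∃ c : Γ(X, U), σ.onExt _ S.e * z * σ.onExt _ S.e = c • σ.onExt _ S.e :=
  exists_smul_of_onExt σ S.corner z

theorem eq_zero_of_smul_u {c : Γ(X, U)} (h : c • S.u = 0) : c = 0 := by
  refine S.eq_zero_of_smul_e ?_
  rw [← S.v_u, ← mul_smul_comm, h, mul_zero]

theorem exists_smul_u (s : Γ(sheafL sb σ.map, U)) : ∃ c : Γ(X, U), c • S.u = lVal s := by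
  obtain ⟨h1, h2⟩ := (S.mem_spaceL_iff _).1 (lVal_mem s)
  obtain ⟨c, hc⟩ := S.σcorner (lVal s * S.v)
  refine ⟨c, ?_⟩
  rw [mul_assoc, mul_assoc, S.v_σe, ← mul_assoc, h2] at hc
  rw [← S.σe_u, ← smul_mul_assoc, ← hc, mul_assoc, S.v_u, h1]

theorem isBasisOn_uL : IsBasisOn (sheafL sb σ.map) U (fun _ : Unit => S.uL) := by
  intro W h
  constructor
  · intro c c' hcc
    simp only [Finset.univ_unique, Finset.sum_singleton] at hcc
    have h1 := congrArg lVal hcc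
    funext i
    refine sub_eq_zero.1 ((S.restrict h).eq_zero_of_smul_u ?_)
    rw [sub_smul, sub_eq_zero]
    exact h1
  · intro s
    obtain ⟨c, hc⟩ := (S.restrict h).exists_smul_u s
    refine ⟨fun _ => c, ?_⟩
    simp only [Finset.univ_unique, Finset.sum_singleton]
    exact lVal_ext hc

end Splitting

/-- The Severi-Brauer variety is covered by open sets over which there is a trivialization. -/
def LocallySplit (sb : SeveriBrauer k D n X) (σ : Involution k D) : Prop :=
  ∀ x : X, ∃ U : X.Opens, x ∈ U ∧ Nonempty (Splitting sb σ U)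

/-- Equality of sections can be checked on open sets over which there is a trivialization. -/
theorem LocallySplit.eq_of_local (hS : LocallySplit sb σ) (M : X.Modules) {s t : Γ(M, U)}
    (h : ∀ (W : X.Opens) (hW : W ≤ U), Splitting sb σ W → res M hW s = res M hW t) : s = t := by
  refine SBWitt.eq_of_local M s t fun x hx => ?_
  obtain ⟨W, hxW, ⟨S⟩⟩ := hS x
  exact ⟨W ⊓ U, inf_le_right, ⟨hxW, hx⟩, h _ inf_le_right (S.restrict inf_le_left)⟩

/-- The multiplication map `V ⊗ 𝒯 → V` is injective; its image is locally `V e`. -/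
theorem LocallySplit.mult_injective (hS : LocallySplit sb σ) :
    Function.Injective (sec (mult sb V) U) := fun z w h =>
  hS.eq_of_local _ fun W hW S => S.mult_injective (by rw [sec_res, sec_res, h])

theorem LocallySplit.sheafL_isLocFree (hS : LocallySplit sb σ) : IsLocFree (sheafL sb σ.map) :=
  isLocFree_of_basis fun x => by
    obtain ⟨U, hx, ⟨S⟩⟩ := hS x
    exact ⟨U, Unit, inferInstance, _, hx, S.isBasisOn_uL⟩

theorem LocallySplit.sheafT_isLocFree (hS : LocallySplit sb σ) : IsLocFree (sheafT sb) := by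
  intro x
  obtain ⟨U, hx, ⟨S⟩⟩ := hS x
  obtain ⟨W, m, e, hxW, he⟩ := sheafD_isLocFree (k := k) (D := D) x
  have he : IsBasisOn (sheafD k X D) W e := he
  have hUW : x ∈ U ⊓ W := ⟨hx, hxW⟩
  exact exists_basis_of_retract (N := sheafT sb) (he.res (inf_le_right : U ⊓ W ≤ W))
    (homSec (incT sb) _) (S.restrict inf_le_left).projT
    (fun Z h (y : Γ(sheafT sb, Z)) => tVal_ext (((S.restrict inf_le_left).restrict h).tVal_mul_e y)) hUW

theorem LocallySplit.isLocFree_tensor (hS : LocallySplit sb σ) (hV : IsLocFree V.mod) :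
    IsLocFree (tensorSheaf V (sheafT sb) (leftAct sb)) := by
  intro x
  obtain ⟨U, hx, ⟨S⟩⟩ := hS x
  obtain ⟨W, m, e, hxW, he⟩ := hV x
  have he : IsBasisOn V.mod W e := he
  have hUW : x ∈ U ⊓ W := ⟨hx, hxW⟩
  exact exists_basis_of_retract (he.res (inf_le_right : U ⊓ W ≤ W))
    (homSec (mult sb V) _) ((S.restrict inf_le_left).tmulE V)
    (fun Z h y => ((S.restrict inf_le_left).restrict h).tmul_mult y) hUW

/-- A symplectic involution acts as `-1` on `ℒ_σ`. -/
theorem onExt_lVal [Algebra.IsCentral k D] (hn : n ≠ 0) (hk : ringChar k ≠ 2)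
    (hσ : σ.IsSymplectic n) (hS : LocallySplit sb σ) (s : Γ(sheafL sb σ.map, U)) :
    σ.onExt _ (lVal s) = - lVal s := by
  refine hS.eq_of_local (sheafD k X D) fun W hW S => ?_
  change ext D (resA hW) (σ.onExt _ (lVal s)) = ext D (resA hW) (- lVal s)
  rw [σ.ext_onExt, map_neg]
  obtain ⟨t, ht⟩ : ∃ t : Γ(sheafL sb σ.map, W), ext D (resA hW) (lVal s) = lVal t :=
    ⟨res _ hW s, rfl⟩
  rw [ht]
  by_cases hg : genericPoint X ∈ W
  swap
  · exact eq_of_genericPoint_notMem hg _ _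
  refine ext_germA_injective _ hg ?_
  rw [σ.ext_onExt, map_neg]
  obtain ⟨h1, h2⟩ := (mem_interSections_spaceL sb σ).1 (lVal_mem t)
  rw [S.mem_iff_self] at h1 h2
  refine onExt_eq_neg_of_isSymplectic hn hk hσ (e := ext D (germA W _ hg) S.e) ?_ ?_ ?_
  · exact exists_smul_of_ext _ S.corner
  · rw [← map_mul, h1]
  · rw [← σ.ext_onExt, ← map_mul, h2]

end Multiplication

/-! ### Reflexivity, and the morphism `θ` -/

section Star

variable {X : Scheme.{u}}

theorem IsLocFree.of_isIso {M N : X.Modules} (f : M ⟶ N) [IsIso f] (hM : IsLocFree M) :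
    IsLocFree N := by
  intro x
  obtain ⟨U, m, e, hx, he⟩ := hM x
  refine ⟨U, m, fun i => sec f U (e i), hx, fun V h => ?_⟩
  convert (bijective_of_isIso f V).comp (he V h) using 1
  funext c
  simp only [Function.comp_apply, map_sum, map_smul, sec_res]

/-- Over an open set on which `M` has a basis and `L` has a basis with one element, `M` is
reflexive with respect to the duality defined by `L`. -/
theorem bijective_can_of_basis {M L : X.Modules} {U : X.Opens} {ι : Type*} [Fintype ι]
    {e : ι → Γ(M, U)} (he : IsBasisOn M U e) {u : Γ(L, U)} (hu : IsBasisOn L U (fun _ : Unit => u)) :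
    Function.Bijective (sec ((starDuality L).can.app M) U) := by
  classical
  let f : ι → Γ(homSheaf M L, U) := fun i => he.lift (fun j => if j = i then u else 0)
  have hf : ∀ i (x : Γ(M, U)), ev (f i) le_rfl x = he.coord le_rfl x i • u := by
    intro i x
    rw [he.ev_lift, Finset.sum_eq_single i, if_pos rfl, res_self]
    · intro j _ hj
      rw [if_neg hj, map_zero, smul_zero]
    · simp
  have hsum : ∀ c : Unit → Γ(X, U), ∑ i, c i • res L (le_refl U) u = c () • u := fun c => by
    rw [Finset.univ_unique, Finset.sum_singleton, res_self]
  have hu0 : ∀ c c' : Γ(X, U), c • u = c' • u → c = c' := fun c c' h =>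
    congrFun ((hu U le_rfl).1 (a₁ := fun _ => c) (a₂ := fun _ => c')
      (by dsimp only; rw [hsum, hsum, h])) ()
  have hcan : ∀ (x : Γ(M, U)) (g : Γ(homSheaf M L, U)),
      ev (M := homSheaf M L) (N := L) (sec ((starDuality L).can.app M) U x) le_rfl g =
        ev g le_rfl x := fun x g => congrArg (ev g le_rfl) (res_self M le_rfl x)
  constructor
  · intro x y h
    refine (he.coord le_rfl).injective (funext fun i => hu0 _ _ ?_)
    rw [← hf, ← hf, ← hcan, ← hcan, h]
  · intro (ξ : Γ(homSheaf (homSheaf M L) L, U))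
    have h1 : ∀ i, ∃ c : Γ(X, U), c • u = ev ξ le_rfl (f i) := fun i => by
      obtain ⟨c, hc⟩ := (hu U le_rfl).2 (ev ξ le_rfl (f i))
      exact ⟨c (), (hsum c).symm.trans hc⟩
    choose c hc using h1
    refine ⟨∑ i, c i • res M le_rfl (e i), ?_⟩
    refine (he.homSheaf hu).hom_ext fun p => ?_
    refine (hcan _ _).trans ?_
    refine Eq.trans ?_ (hc p.1)
    refine (hf p.1 _).trans ?_
    rw [he.coord_sum]

/-- The morphism `Hom(N, L) → Hom(M, L)` defined by `f : M → N`. -/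
def starMap {M N : X.Modules} (L : X.Modules) (f : M ⟶ N) : homSheaf N L ⟶ homSheaf M L :=
  (starFunctor L).map f.op

theorem ev_starMap {M N L : X.Modules} (f : M ⟶ N) {U W : X.Opens} (g : Γ(homSheaf N L, U))
    (h : W ≤ U) (x : Γ(M, W)) : ev (sec (starMap L f) U g) h x = ev g h (sec f W x) := rfl

/-- The evaluation map from `M` to its bidual. -/
def starCan (M L : X.Modules) : M ⟶ homSheaf (homSheaf M L) L := (starDuality L).can.app M

theorem isIso_starDuality_can {M L : X.Modules} (hM : IsLocFree M)
    (hL : ∀ x : X, ∃ (U : X.Opens) (u : Γ(L, U)), x ∈ U ∧ IsBasisOn L U (fun _ : Unit => u)) :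
    IsIso ((starDuality L).can.app M) := by
  refine isIso_of_local _ fun x => ?_
  obtain ⟨U, u, hx, hu⟩ := hL x
  obtain ⟨V, m, e, hxV, he⟩ := hM x
  have he : IsBasisOn M V e := he
  exact ⟨U ⊓ V, ⟨hx, hxV⟩, fun W h =>
    bijective_can_of_basis (he.res (h.trans inf_le_right)) (hu.res (h.trans inf_le_left))⟩

end Star

section Theta

variable {k : Type u} [Field k] {D : Type u} [DivisionRing D] [Algebra k D]
  [FiniteDimensional k D] {n : ℕ} {X : Scheme.{u}} [X.Over (Spec (.of k))] [IsIntegral X]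
  {sb : SeveriBrauer k D n X} {σ : Involution k D} {U : X.Opens} {V : RMod k D X}

variable (sb V) in
/-- The sheaf `V ⊗ 𝒯`, where the tensor product is over `D ⊗ O_X`. -/
abbrev tens : X.Modules := tensorSheaf V (sheafT sb) (leftAct sb)

/-- Homomorphisms of right modules from `V` to `D ⊗ O_X` map products `v t` into `𝒯`. -/
theorem sharpEv_mult_mem (f : Γ(sharpSheaf V, U)) {W : X.Opens} (h : W ≤ U) (z : Γ(tens sb V, W)) :
    sharpEv f h (sec (mult sb V) W z) ∈ interSections (spaceT sb) W := by
  refine tensor_induction (l := leftAct sb) (P := fun W z => ∀ h : W ≤ U,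
    sharpEv f h (sec (mult sb V) W z) ∈ interSections (spaceT sb) W) ?_ ?_ ?_ ?_ W z h
  · intro W z hz h hg
    obtain ⟨W', h', hp, hm⟩ := hz _ hg
    have := hm (h'.trans h) hp
    rw [sec_res, sharpEv_res f h h'] at this
    exact (ext_comp_germ (D := D) h' _ hp (sharpEv f h (sec (mult sb V) W z))) ▸ this
  · intro W h
    have h0 := sharpEv_smul f h 0 0
    rw [zero_smul, zero_smul] at h0
    rw [map_zero, h0]
    exact zero_mem _
  · intro W z w hz hw h
    rw [map_add, sharpEv_add]
    exact add_mem (hz h) (hw h)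
  · intro W v t h
    rw [mult_tmul, sharpEv_rmul]
    exact mul_mem_interSections_spaceT sb _ (tVal_mem t)

variable (sb σ) in
/-- The section `σ(t) f(z)` of `ℒ_σ`, for `z` in `V ⊗ 𝒯`. -/
def thetaVal (f : Γ(sharpSheaf V, U)) (t : Γ(sheafT sb, U)) {W : X.Opens} (h : W ≤ U)
    (z : Γ(tens sb V, W)) : Γ(sheafL sb σ.map, W) :=
  lMk (σ.onExt _ (ext D (resA h) (tVal t)) * sharpEv f h (sec (mult sb V) W z)) (by
    rw [mem_interSections_spaceL]
    refine ⟨mul_mem_interSections_spaceT sb _ (sharpEv_mult_mem f h z), ?_⟩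
    rw [σ.onExt_mul, σ.onExt_onExt]
    exact mul_mem_interSections_spaceT sb _ (tVal_mem (res (sheafT sb) h t)))

theorem lVal_thetaVal (f : Γ(sharpSheaf V, U)) (t : Γ(sheafT sb, U)) {W : X.Opens} (h : W ≤ U)
    (z : Γ(tens sb V, W)) :
    lVal (thetaVal sb σ f t h z) =
      σ.onExt _ (ext D (resA h) (tVal t)) * sharpEv f h (sec (mult sb V) W z) := rfl

variable (sb σ) in
/-- The homomorphism `z ↦ σ(t) f(z)` from `V ⊗ 𝒯` to `ℒ_σ`. -/
def thetaHom (f : Γ(sharpSheaf V, U)) (t : Γ(sheafT sb, U)) :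
    Γ(homSheaf (tens sb V) (sheafL sb σ.map), U) :=
  evMk (fun W h =>
      { toFun := thetaVal sb σ f t h
        map_add' := fun z w => lVal_ext (by
          rw [lVal_add, lVal_thetaVal, lVal_thetaVal, lVal_thetaVal, map_add, sharpEv_add, mul_add])
        map_smul' := fun a z => lVal_ext (by
          rw [RingHom.id_apply, lVal_smul, lVal_thetaVal, lVal_thetaVal, map_smul, sharpEv_smul,
            mul_smul_comm]) })
    (fun {W W'} h h' z => lVal_ext (by
      refine Eq.trans ?_ (lVal_res h' _).symm
      refine (lVal_thetaVal f t (h'.trans h) _).trans ?_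
      refine Eq.trans ?_ (congrArg (ext D (resA h')) (lVal_thetaVal f t h z)).symm
      rw [sec_res, sharpEv_res f h h', map_mul, σ.ext_onExt, ext_resA_resA]))

theorem lVal_ev_thetaHom (f : Γ(sharpSheaf V, U)) (t : Γ(sheafT sb, U)) {W : X.Opens} (h : W ≤ U)
    (z : Γ(tens sb V, W)) : lVal (ev (thetaHom sb σ f t) h z) =
      σ.onExt _ (ext D (resA h) (tVal t)) * sharpEv f h (sec (mult sb V) W z) := rfl

theorem thetaHom_ext {g g' : Γ(homSheaf (tens sb V) (sheafL sb σ.map), U)}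
    (h : ∀ (W : X.Opens) (h : W ≤ U) (z : Γ(tens sb V, W)), lVal (ev g h z) = lVal (ev g' h z)) :
    g = g' := ev_ext fun W hW z => lVal_ext (h W hW z)

theorem thetaHom_tadd (f : Γ(sharpSheaf V, U)) (t t' : Γ(sheafT sb, U)) :
    thetaHom sb σ f (t + t') = thetaHom sb σ f t + thetaHom sb σ f t' :=
  thetaHom_ext fun W h z => by
    rw [ev_add, lVal_add, lVal_ev_thetaHom, lVal_ev_thetaHom, lVal_ev_thetaHom, tVal_add, map_add,
      map_add, add_mul]

theorem thetaHom_tsmul (f : Γ(sharpSheaf V, U)) (a : Γ(X, U)) (t : Γ(sheafT sb, U)) :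
    thetaHom sb σ f (a • t) = a • thetaHom sb σ f t :=
  thetaHom_ext fun W h z => by
    rw [ev_smul, lVal_smul, lVal_ev_thetaHom, lVal_ev_thetaHom, tVal_smul, ext_smul, map_smul,
      smul_mul_assoc]
    rfl

variable (sb σ V U) in
/-- The bilinear map `(f, t) ↦ (z ↦ σ(t) f(z))`. -/
def thetaBilin : Γ((sharp σ V).mod, U) →ₗ[Γ(X, U)] Γ(sheafT sb, U) →ₗ[Γ(X, U)]
    Γ(homSheaf (tens sb V) (sheafL sb σ.map), U) where
  toFun f :=
    { toFun := fun t => thetaHom sb σ f t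
      map_add' := thetaHom_tadd (V := V) f
      map_smul' := thetaHom_tsmul (V := V) f }
  map_add' f f' := LinearMap.ext fun _ => thetaHom_ext fun W h z =>
    mul_add _ (sharpEv f h (sec (mult sb V) W z)) (sharpEv f' h (sec (mult sb V) W z))
  map_smul' a f := LinearMap.ext fun _ => thetaHom_ext fun W h z =>
    mul_smul_comm (resO h a) _ (sharpEv f h (sec (mult sb V) W z))

theorem thetaBilin_act (f : Γ((sharp σ V).mod, U)) (d : D) (t : Γ(sheafT sb, U)) :
    thetaBilin sb σ U V (sec ((sharp σ V).act d) U f) t =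
      thetaBilin sb σ U V f (sec (leftAct sb d) U t) := thetaHom_ext fun W h z => by
  change σ.onExt _ (ext D (resA h) (tVal t)) *
      (1 ⊗ₜ[k] (σ.map d) * sharpEv (V := V) f h (sec (mult sb V) W z)) =
    σ.onExt _ (ext D (resA h) (1 ⊗ₜ[k] d * tVal t)) * sharpEv (V := V) f h (sec (mult sb V) W z)
  have h1 : ext D (resA h) ((1 : Γ(X, U)) ⊗ₜ[k] d) = 1 ⊗ₜ d := by
    rw [Algebra.TensorProduct.map_tmul, map_one]
    rfl
  rw [map_mul, σ.onExt_mul, ← mul_assoc, h1]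
  rfl

theorem thetaBilin_res {W : X.Opens} (h : W ≤ U) (f : Γ((sharp σ V).mod, U))
    (t : Γ(sheafT sb, U)) :
    thetaBilin sb σ W V (res (sharp σ V).mod h f) (res (sheafT sb) h t) =
      res (homSheaf (tens sb V) (sheafL sb σ.map)) h (thetaBilin sb σ U V f t) :=
  thetaHom_ext fun W' h' z => by
    change σ.onExt _ (ext D (resA h') (ext D (resA h) (tVal t))) *
        sharpEv (V := V) f (h'.trans h) (sec (mult sb V) W' z) =
      σ.onExt _ (ext D (resA (h'.trans h)) (tVal t)) *
        sharpEv (V := V) f (h'.trans h) (sec (mult sb V) W' z)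
    rw [ext_resA_resA]

variable (sb σ V) in
/-- The map `θ : V♯ ⊗ 𝒯 → Hom(V ⊗ 𝒯, ℒ_σ)`. -/
def theta : tens sb (sharp σ V) ⟶ homSheaf (tens sb V) (sheafL sb σ.map) :=
  tensorLift (fun U => thetaBilin sb σ U V) (fun _ => thetaBilin_act) thetaBilin_res

theorem theta_tmul (f : Γ((sharp σ V).mod, U)) (t : Γ(sheafT sb, U)) :
    sec (theta sb σ V) U (tmul f t) = thetaHom sb σ (V := V) f t := by
  have h := tensorLift_tmul (l := leftAct sb) (fun U => thetaBilin sb σ U V)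
    (fun _ => thetaBilin_act) thetaBilin_res f t
  exact h

theorem theta_naturality {W : RMod k D X} (f : V ⟶ W) :
    tensorMap sb (sharpMap σ f) ≫ theta sb σ V =
      theta sb σ W ≫ starMap (sheafL sb σ.map) (tensorMap sb f) :=
  tensor_hom_ext fun U g t => by
    rw [sec_comp, sec_comp, sec_tensorMap, theta_tmul, theta_tmul]
    refine thetaHom_ext fun Z h z => ?_
    change σ.onExt _ (ext D (resA h) (tVal t)) *
        sharpEv (V := W) g h (sec f.hom Z (sec (mult sb V) Z z)) =
      σ.onExt _ (ext D (resA h) (tVal t)) *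
        sharpEv (V := W) g h (sec (mult sb W) Z (sec (tensorMap sb f) Z z))
    rw [mult_map]

theorem lVal_ev_theta_tmul {W : X.Opens} (h : W ≤ U) (f : Γ(sharpSheaf V, W)) (t' : Γ(sheafT sb, W))
    (v : Γ(V.mod, U)) (t : Γ(sheafT sb, U)) :
    lVal (ev (thetaHom sb σ f t') le_rfl (res (tens sb V) h (tmul v t))) =
      σ.onExt _ (tVal t') * (sharpEv f le_rfl (res V.mod h v) * ext D (resA h) (tVal t)) := by
  rw [res_tmul, lVal_ev_thetaHom, mult_tmul, sharpEv_rmul, ext_resA_self, tVal_res]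

/-- `θ` is compatible with the dualities, because `σ` acts as `-1` on `ℒ_σ`. -/
theorem theta_comm (hL : ∀ (U : X.Opens) (s : Γ(sheafL sb σ.map, U)),
      σ.onExt _ (lVal s) = - lVal s) :
    tensorMap sb (-(sharpCan σ V)) ≫ theta sb σ (sharp σ V) =
      starCan (tens sb V) (sheafL sb σ.map) ≫ starMap (sheafL sb σ.map) (theta sb σ V) :=
  tensor_hom_ext fun U v t => by
    rw [sec_comp, sec_comp, sec_tensorMap, theta_tmul]
    refine tensor_ev_ext fun W h (f : Γ(sharpSheaf V, W)) t' => lVal_ext ?_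
    have h1 : lVal (ev (M := tens sb V) (N := sheafL sb σ.map)
        (sec (theta sb σ V) W (tmul (V := sharp σ V) f t')) le_rfl
          (res (tens sb V) h (tmul v t))) =
        σ.onExt _ (tVal t') *
          (sharpEv f le_rfl (res V.mod h v) * ext D (resA h) (tVal t)) :=
      (congrArg (fun g => lVal (ev (M := tens sb V) (N := sheafL sb σ.map) g le_rfl
        (res (tens sb V) h (tmul v t)))) (theta_tmul (V := V) f t')).trans
          (lVal_ev_theta_tmul h f t' v t)
    refine Eq.trans ?_ h1.symm
    have h2 := hL W (ev (M := tens sb V) (N := sheafL sb σ.map)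
        (sec (theta sb σ V) W (tmul (V := sharp σ V) f t')) le_rfl
          (res (tens sb V) h (tmul v t)))
    rw [h1, ← neg_eq_iff_eq_neg] at h2
    have h3 : sec (mult sb (sharp σ V)) W (tmul (V := sharp σ V) f t') =
      rmul (V := sharp σ V) f (tVal t') := mult_tmul _ _
    have h4 : sharpEv (V := sharp σ V) (sec (-(sharpCan σ V)).hom U v) h
        (sec (mult sb (sharp σ V)) W (tmul (V := sharp σ V) f t')) =
        -σ.onExt _ (σ.onExt _ (tVal t') * sharpEv f le_rfl (res V.mod h v)) := by
      rw [h3]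
      change - σ.onExt _ (sharpEv (V := V) (rmul (V := sharp σ V) f (tVal t')) le_rfl
        (res V.mod h v)) = _
      refine congrArg (fun y => - σ.onExt _ y) ?_
      have := sharpEv_rmul_sharp σ f (tVal t') le_rfl (res V.mod h v)
      rwa [ext_resA_self] at this
    refine (congrArg (σ.onExt _ (ext D (resA h) (tVal t)) * ·) h4).trans ?_
    rw [← h2, ← mul_assoc, σ.onExt_mul _ (_ * _), mul_neg]

end Theta

/-! ### Bijectivity of `θ` -/

section ThetaIso

variable {k : Type u} [Field k] {D : Type u} [DivisionRing D] [Algebra k D]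
  [FiniteDimensional k D] {n : ℕ} {X : Scheme.{u}} [X.Over (Spec (.of k))] [IsIntegral X]
  {sb : SeveriBrauer k D n X} {σ : Involution k D} {U : X.Opens} {V : RMod k D X}

namespace Splitting

variable (S : Splitting sb σ U)

/-- The components `v aᵢ ⊗ e` of a section `v = ∑ v aᵢ e bᵢ` of `V`. -/
def component (v : Γ(V.mod, U)) (i : Fin S.m) : Γ(tens sb V, U) := tmul (rmul v (S.a i)) S.eT

theorem mult_component (v : Γ(V.mod, U)) (i : Fin S.m) :
    sec (mult sb V) U (S.component v i) = rmul v (S.a i * S.e) := by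
  rw [component, mult_tmul, rmul_mul, tVal_eT]

theorem sum_component (v : Γ(V.mod, U)) :
    ∑ i, rmul (sec (mult sb V) U (S.component v i)) (S.b i) = v := by
  simp only [mult_component, ← rmul_mul]
  rw [← map_sum, S.full, rmul_one]

theorem tmul_rmul_mult (y : Γ(tens sb V, U)) (x : Γ(X, U) ⊗[k] D) {c : Γ(X, U)}
    (hc : S.e * x * S.e = c • S.e) : tmul (rmul (sec (mult sb V) U y) x) S.eT = c • y := by
  have h1 : lmul (S.e * x) S.eT = c • S.eT := tVal_ext hc
  rw [← S.rmul_mult y, ← rmul_mul, tmul_rmul, h1, tmul_smul, S.tmul_mult]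

variable (G : Γ(tens sb V, U) →ₗ[Γ(X, U)] Γ(sheafL sb σ.map, U))

/-- The map `v ↦ ∑ G(v aᵢ ⊗ e) bᵢ`, for a linear map `G` on `V ⊗ 𝒯`. -/
def descend : Γ(V.mod, U) →ₗ[Γ(X, U)] Γ(X, U) ⊗[k] D where
  toFun v := ∑ i, lVal (G (S.component v i)) * S.b i
  map_add' v w := by
    simp only [component, add_rmul, add_tmul, map_add, lVal_add, add_mul, Finset.sum_add_distrib]
  map_smul' a v := by
    simp only [component, smul_rmul, smul_tmul, map_smul, lVal_smul, smul_mul_assoc,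
      Finset.smul_sum, RingHom.id_apply]

theorem descend_apply (v : Γ(V.mod, U)) :
    S.descend G v = ∑ i, lVal (G (S.component v i)) * S.b i := rfl

theorem lVal_mul_e (s : Γ(sheafL sb σ.map, U)) : lVal s * S.e = lVal s :=
  ((S.mem_spaceL_iff _).1 (lVal_mem s)).1

theorem σe_mul_lVal (s : Γ(sheafL sb σ.map, U)) : σ.onExt _ S.e * lVal s = lVal s :=
  ((S.mem_spaceL_iff _).1 (lVal_mem s)).2

theorem descend_rmul_mult (y : Γ(tens sb V, U)) (x : Γ(X, U) ⊗[k] D) :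
    S.descend G (rmul (sec (mult sb V) U y) x) = lVal (G y) * x := by
  have h1 : ∀ z, lVal (G (tmul (rmul (sec (mult sb V) U y) z) S.eT)) = lVal (G y) * (z * S.e) := by
    intro z
    obtain ⟨c, hc⟩ := S.corner z
    rw [S.tmul_rmul_mult y z hc, map_smul, lVal_smul, ← S.lVal_mul_e, mul_assoc, ← mul_assoc S.e,
      hc, mul_smul_comm]
  rw [descend_apply]
  simp only [component, ← rmul_mul, h1]
  simp only [mul_assoc]
  rw [← Finset.mul_sum, ← Finset.mul_sum]
  simp only [← mul_assoc]
  rw [S.full, mul_one]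

theorem descend_rmul (v : Γ(V.mod, U)) (x : Γ(X, U) ⊗[k] D) :
    S.descend G (rmul v x) = S.descend G v * x := by
  conv_lhs => rw [← S.sum_component v]
  rw [sum_rmul, map_sum, descend_apply, Finset.sum_mul]
  refine Finset.sum_congr rfl fun i _ => ?_
  rw [← rmul_mul, descend_rmul_mult, mul_assoc]

theorem descend_mult (y : Γ(tens sb V, U)) :
    S.descend G (sec (mult sb V) U y) = lVal (G y) := by
  rw [← rmul_one (sec (mult sb V) U y), descend_rmul_mult, mul_one]

theorem descend_res (g : Γ(homSheaf (tens sb V) (sheafL sb σ.map), U)) {W : X.Opens} (h : W ≤ U)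
    (S' : Splitting sb σ W) (v : Γ(V.mod, U)) :
    S'.descend (ev g h) (res V.mod h v) = ext D (resA h) (S.descend (ev g le_rfl) v) := by
  conv_lhs => rw [← S.sum_component v]
  rw [map_sum, map_sum, descend_apply, map_sum]
  refine Finset.sum_congr rfl fun i _ => ?_
  rw [res_rmul, ← sec_res, descend_rmul_mult, map_mul, res_ev g le_rfl h, lVal_res]

/-- The section of `V♯` which corresponds to a homomorphism from `V ⊗ 𝒯` to `ℒ_σ`. -/
def descendSharp (g : Γ(homSheaf (tens sb V) (sheafL sb σ.map), U)) : Γ(sharpSheaf V, U) :=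
  sharpMk (fun W h => (S.restrict h).descend (ev g h))
    (fun {W W'} h h' v => (S.restrict h).descend_res (res _ h g) h' (S.restrict (h'.trans h)) v)
    (fun {W} h v d => by
      rw [← descend_rmul, rmul_one_tmul])

theorem thetaHom_descendSharp (g : Γ(homSheaf (tens sb V) (sheafL sb σ.map), U)) :
    thetaHom sb σ (S.descendSharp g) S.eT = g := thetaHom_ext fun W h z => by
  refine Eq.trans ?_ ((S.restrict h).σe_mul_lVal (ev g h z))
  rw [lVal_ev_thetaHom]
  exact congrArg (σ.onExt _ (ext D (resA h) S.e) * ·) ((S.restrict h).descend_mult (ev g h) z)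

theorem eq_zero_of_thetaHom {f : Γ(sharpSheaf V, U)} (hf : rmul (V := sharp σ V) f S.e = f)
    (h0 : thetaHom sb σ f S.eT = 0) : f = 0 := by
  refine sharp_ext fun W h v => ?_
  have h1 : ∀ y : Γ(tens sb V, W), sharpEv f h (sec (mult sb V) W y) = 0 := by
    intro y
    have h2 := sharpEv_rmul_sharp σ f S.e h (sec (mult sb V) W y)
    refine (congrArg (fun f : Γ(sharpSheaf V, U) => sharpEv f h (sec (mult sb V) W y)) hf).symm.trans
      (h2.trans ?_)
    have h3 := lVal_ev_thetaHom (σ := σ) f S.eT h y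
    rw [h0] at h3
    exact h3.symm
  have h4 : ∀ w : Fin S.m → Γ(V.mod, W), sharpEv f h (∑ i, w i) = ∑ i, sharpEv f h (w i) := fun w =>
    map_sum (AddMonoidHom.mk' (fun v => sharpEv f h v) (fun v w => sharpEv_add f h v w)) w _
  refine (congrArg (sharpEv f h) ((S.restrict h).sum_component (V := V) v)).symm.trans ?_
  refine (h4 _).trans (Finset.sum_eq_zero fun i _ => ?_)
  rw [sharpEv_rmul, h1, zero_mul]

theorem theta_bijective (S : Splitting sb σ U) :
    Function.Bijective (sec (theta sb σ V) U) := by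
  constructor
  · refine (injective_iff_map_eq_zero _).2 fun z hz => S.mult_injective ?_
    rw [map_zero]
    refine S.eq_zero_of_thetaHom (V := V) (S.rmul_mult z) ?_
    rw [← hz]
    conv_rhs => rw [← S.tmul_mult z]
    exact (theta_tmul _ _).symm
  · intro g
    exact ⟨tmul (V := sharp σ V) (S.descendSharp g) S.eT,
      (theta_tmul _ _).trans (S.thetaHom_descendSharp g)⟩

end Splitting

theorem LocallySplit.isIso_theta (hS : LocallySplit sb σ) (V : RMod k D X) :
    IsIso (theta sb σ V) := isIso_of_local _ fun x => by
  obtain ⟨U, hx, ⟨S⟩⟩ := hS x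
  exact ⟨U, hx, fun W h => (S.restrict h).theta_bijective⟩

end ThetaIso

/-! ### The inverse functor `Hom(𝒯, –)` -/

section Inverse

variable {X : Scheme.{u}}

/-- The morphism `Hom(T, M) → Hom(T, N)` defined by `f : M → N`. -/
def homMap (T : X.Modules) {M N : X.Modules} (f : M ⟶ N) : homSheaf T M ⟶ homSheaf T N :=
  homMk (fun U =>
      { toFun := fun g => evMk (fun V h => (sec f V).comp (ev g h)) (fun hV h x => by
          simp only [LinearMap.comp_apply]
          rw [res_ev, sec_res])
        map_add' := fun g g' => ev_ext fun V h x => map_add (sec f V) (ev g h x) (ev g' h x)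
        map_smul' := fun a g => ev_ext fun V h x => map_smul (sec f V) (resO h a) (ev g h x) })
    (fun _ _ => rfl)

theorem RMod.isIso_of_isIso_hom {k : Type u} [Field k] {D : Type u} [Ring D] [Algebra k D]
    [X.Over (Spec (.of k))] {V W : RMod k D X} (f : V ⟶ W) [IsIso f.hom] : IsIso f :=
  ⟨⟨inv f.hom, fun d => by
      rw [← cancel_epi f.hom, ← Category.assoc, ← f.comm, Category.assoc, IsIso.hom_inv_id,
        Category.comp_id, IsIso.hom_inv_id_assoc]⟩,
    RMod.hom_ext (IsIso.hom_inv_id f.hom), RMod.hom_ext (IsIso.inv_hom_id f.hom)⟩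

variable {k : Type u} [Field k] {D : Type u} [DivisionRing D] [Algebra k D]
  [FiniteDimensional k D] {n : ℕ} [X.Over (Spec (.of k))] [IsIntegral X]
  {sb : SeveriBrauer k D n X} {σ : Involution k D} {U : X.Opens} {V W : RMod k D X}

variable (sb) in
/-- The right module `Hom(𝒯, M)` over `D ⊗ O_X`, with the action `(g d)(t) = g(d t)`. -/
def psi (M : X.Modules) : RMod k D X where
  mod := homSheaf (sheafT sb) M
  act d := starMap M (leftAct sb d)
  act_add a b := sec_ext fun U g => ev_ext fun V h t => by
    have h1 : sec (leftAct sb (a + b)) V t = sec (leftAct sb a) V t + sec (leftAct sb b) V t :=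
      tVal_ext (by
        rw [tVal_add, tVal_leftAct, tVal_leftAct, tVal_leftAct, TensorProduct.tmul_add, add_mul])
    rw [ev_starMap, h1, map_add]
    rfl
  act_one := sec_ext fun U g => ev_ext fun V h t => by
    have h1 : sec (leftAct sb 1) V t = t := tVal_ext (by
      rw [tVal_leftAct, ← Algebra.TensorProduct.one_def, one_mul])
    rw [ev_starMap, h1]
    rfl
  act_mul a b := sec_ext fun U g => ev_ext fun V h t => by
    have h1 : sec (leftAct sb (a * b)) V t = sec (leftAct sb a) V (sec (leftAct sb b) V t) :=
      tVal_ext (by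
        rw [tVal_leftAct, tVal_leftAct, tVal_leftAct, ← mul_assoc,
          Algebra.TensorProduct.tmul_mul_tmul, one_mul])
    rw [sec_comp, ev_starMap, ev_starMap, ev_starMap, h1]
  act_algebraMap c U g := ev_ext fun V h t => by
    have h1 : sec (leftAct sb (algebraMap k D c)) V t = resO h (algebraMap k Γ(X, U) c) • t :=
      tVal_ext (by
        rw [tVal_leftAct, tVal_smul, mul_tmul_smul]
        exact congrArg (· • tVal t) ((resA h).commutes c).symm)
    rw [ev_starMap, h1, map_smul, ev_smul]

theorem ev_rmul_psi {M : X.Modules} (g : Γ(homSheaf (sheafT sb) M, U)) (z : Γ(X, U) ⊗[k] D)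
    {W : X.Opens} (h : W ≤ U) (t : Γ(sheafT sb, W)) :
    ev (M := sheafT sb) (N := M) (rmul (V := psi sb M) g z) h t =
      ev g h (lmul (ext D (resA h) z) t) := by
  induction z with
  | zero =>
    have h1 : lmul (ext D (resA h) (0 : Γ(X, U) ⊗[k] D)) t = 0 := tVal_ext (by
      rw [tVal_lmul, map_zero, zero_mul]
      rfl)
    rw [h1, map_zero, map_zero]
    rfl
  | add z z' hz hz' =>
    have h1 : lmul (ext D (resA h) (z + z')) t =
        lmul (ext D (resA h) z) t + lmul (ext D (resA h) z') t := tVal_ext (by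
      rw [tVal_add, tVal_lmul, tVal_lmul, tVal_lmul, map_add, add_mul])
    rw [h1, map_add, map_add, ← hz, ← hz']
    rfl
  | tmul c d =>
    have h1 : lmul (ext D (resA h) (c ⊗ₜ d)) t = resO h c • sec (leftAct sb d) W t :=
      tVal_ext (by
        rw [tVal_lmul, tVal_smul, tVal_leftAct]
        have h2 : ext D (resA h) (c ⊗ₜ d) = resO h c • ((1 : Γ(X, W)) ⊗ₜ[k] d) := by
          rw [TensorProduct.smul_tmul', smul_eq_mul, mul_one]
          rfl
        rw [h2]
        exact smul_mul_assoc (resO h c) _ (tVal t))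
    rw [h1, map_smul]
    rfl

/-- The morphism `Hom(𝒯, M) → Hom(𝒯, N)` of right modules. -/
def psiMap {M N : X.Modules} (f : M ⟶ N) : psi sb M ⟶ psi sb N where
  hom := homMap (sheafT sb) f
  comm _ := sec_ext fun _ _ => rfl

variable (sb V) in
/-- The morphism `V → Hom(𝒯, V ⊗ 𝒯)`, which maps `v` to `t ↦ v ⊗ t`. -/
def psiUnit : V ⟶ psi sb (tens sb V) where
  hom := homMk (N := homSheaf (sheafT sb) (tens sb V)) (fun U =>
      { toFun := fun v => evMk (fun W h =>
          { toFun := fun t => tmul (res V.mod h v) t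
            map_add' := fun t t' => tmul_add _ t t'
            map_smul' := fun a t => tmul_smul a _ t })
          (fun h h' t => by
            change tmul (res V.mod (h'.trans h) v) (res (sheafT sb) h' t) =
              res (tens sb V) h' (tmul (res V.mod h v) t)
            rw [res_tmul, res_res])
        map_add' := fun v w => ev_ext fun W h t => by
          change tmul (res V.mod h (v + w)) t = tmul (res V.mod h v) t + tmul (res V.mod h w) t
          rw [map_add, add_tmul]
        map_smul' := fun a v => ev_ext fun W h t => by
          change tmul (res V.mod h (a • v)) t = resO h a • tmul (res V.mod h v) t
          rw [res_smul, smul_tmul] })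
    (fun {U W} h v => ev_ext fun W' h' t => by
      change tmul (res V.mod h' (res V.mod h v)) t = tmul (res V.mod (h'.trans h) v) t
      rw [res_res])
  comm d := sec_ext fun U v => ev_ext (M := sheafT sb) fun W h t => by
    change tmul (res V.mod h (sec (V.act d) U v)) t = tmul (res V.mod h v) (sec (leftAct sb d) W t)
    rw [← sec_res, tmul_act]

theorem ev_psiUnit (v : Γ(V.mod, U)) {W : X.Opens} (h : W ≤ U) (t : Γ(sheafT sb, W)) :
    ev (M := sheafT sb) (N := tens sb V) (sec (psiUnit sb V).hom U v) h t =
      tmul (res V.mod h v) t := rfl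

theorem psiUnit_naturality (f : V ⟶ W) :
    psiUnit sb V ≫ psiMap (tensorMap sb f) = f ≫ psiUnit sb W :=
  RMod.hom_ext (sec_ext fun U v => ev_ext (M := sheafT sb) fun Z h t => by
    change sec (tensorMap sb f) Z (tmul (res V.mod h v) t) = tmul (res W.mod h (sec f.hom U v)) t
    rw [sec_tensorMap, sec_res])

variable (sb U) in
/-- The bilinear map `(g, t) ↦ g(t)`. -/
def evalBilin (M : X.Modules) : Γ((psi sb M).mod, U) →ₗ[Γ(X, U)] Γ(sheafT sb, U) →ₗ[Γ(X, U)] Γ(M, U) where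
  toFun g := ev (M := sheafT sb) (N := M) g le_rfl
  map_add' _ _ := rfl
  map_smul' a g := LinearMap.ext fun t =>
    congrArg (· • ev (M := sheafT sb) (N := M) g le_rfl t) (resO_self le_rfl a)

variable (sb) in
/-- The evaluation map `Hom(𝒯, M) ⊗ 𝒯 → M`. -/
def psiCounit (M : X.Modules) : tens sb (psi sb M) ⟶ M :=
  tensorLift (fun U => evalBilin sb U M) (fun _ _ _ _ => rfl)
    (fun h (g : Γ(homSheaf (sheafT sb) M, _)) t => res_ev g le_rfl h t)

theorem psiCounit_tmul {M : X.Modules} (g : Γ((psi sb M).mod, U)) (t : Γ(sheafT sb, U)) :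
    sec (psiCounit sb M) U (tmul g t) = ev (M := sheafT sb) (N := M) g le_rfl t := by
  have h := tensorLift_tmul (l := leftAct sb) (fun U => evalBilin sb U M) (fun _ _ _ _ => rfl)
    (fun h (g : Γ(homSheaf (sheafT sb) M, _)) t => res_ev g le_rfl h t) g t
  exact h

theorem psiCounit_naturality {M N : X.Modules} (f : M ⟶ N) :
    tensorMap sb (psiMap (sb := sb) f) ≫ psiCounit sb N = psiCounit sb M ≫ f :=
  tensor_hom_ext fun U g t => by
    rw [sec_comp, sec_comp, sec_tensorMap, psiCounit_tmul, psiCounit_tmul]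
    rfl

theorem tensorMap_psiUnit_psiCounit :
    tensorMap sb (psiUnit sb V) ≫ psiCounit sb (tens sb V) = 𝟙 _ :=
  tensor_hom_ext fun U v t => by
    rw [sec_comp, sec_tensorMap, psiCounit_tmul, ev_psiUnit, res_self, sec_id]

namespace Splitting

variable (S : Splitting sb σ U)

theorem psiUnit_bijective (S : Splitting sb σ U) :
    Function.Bijective (sec (psiUnit sb V).hom U) := by
  constructor
  · refine (injective_iff_map_eq_zero _).2 fun v hv => ?_
    have h1 : ∀ t, tmul (l := leftAct sb) v t = 0 := fun t => by
      have := ev_psiUnit v le_rfl t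
      rw [hv, res_self] at this
      exact this.symm
    rw [← S.sum_component v]
    refine Finset.sum_eq_zero fun i _ => ?_
    rw [component, tmul_rmul, h1, map_zero, zero_rmul]
  · intro (g : Γ(homSheaf (sheafT sb) (tens sb V), U))
    refine ⟨∑ i, rmul (sec (mult sb V) U (ev g le_rfl (lmul (S.a i) S.eT))) (S.b i), ?_⟩
    refine ev_ext (M := sheafT sb) fun W h t => ?_
    refine (ev_psiUnit _ h t).trans ((S.restrict h).mult_injective ?_)
    have h2 : t = ∑ i, lmul ((S.restrict h).a i)
        (lmul ((S.restrict h).e * (S.restrict h).b i * tVal t) (S.restrict h).eT) := by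
      have h3 : ∀ w : Fin S.m → Γ(sheafT sb, W), tVal (∑ i, w i) = ∑ i, tVal (w i) := fun w =>
        map_sum (AddMonoidHom.mk' (tVal (sb := sb)) tVal_add) w _
      refine tVal_ext ?_
      refine Eq.trans ?_ (h3 _).symm
      simp only [tVal_lmul, tVal_eT]
      conv_lhs => rw [← one_mul (tVal t), ← (S.restrict h).full, Finset.sum_mul]
      refine Finset.sum_congr rfl fun i _ => ?_
      rw [mul_assoc _ (tVal t), (S.restrict h).tVal_mul_e t]
      simp only [mul_assoc]
    rw [mult_tmul, map_sum, sum_rmul]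
    conv_rhs => rw [h2, map_sum, map_sum]
    refine Finset.sum_congr rfl fun i _ => ?_
    obtain ⟨c, hc⟩ := (S.restrict h).corner ((S.restrict h).b i * tVal t)
    have h4 : lmul ((S.restrict h).e * (S.restrict h).b i * tVal t) (S.restrict h).eT =
        c • (S.restrict h).eT := tVal_ext (by
      rw [tVal_lmul, tVal_smul, tVal_eT, ← hc]
      simp only [mul_assoc])
    have h5 : lmul ((S.restrict h).a i) (c • (S.restrict h).eT) =
        c • res (sheafT sb) h (lmul (S.a i) S.eT) := tVal_ext (by
      rw [tVal_lmul, tVal_smul, tVal_smul, tVal_eT, tVal_res, tVal_lmul, tVal_eT, map_mul,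
        mul_smul_comm]
      rfl)
    rw [h4, h5, map_smul, map_smul, res_ev g le_rfl h, res_rmul, sec_res]
    obtain ⟨y, hy⟩ : ∃ y : Γ(tens sb V, W),
      sec (mult sb V) W y = res V.mod h (sec (mult sb V) U (ev g le_rfl (lmul (S.a i) S.eT))) :=
      ⟨res _ h _, sec_res _ _ _⟩
    rw [← hy, ← rmul_mul]
    conv_lhs => rw [← (S.restrict h).rmul_mult y, ← rmul_mul]
    have h6 : (S.restrict h).e * (ext D (resA h) (S.b i) * tVal t) = c • (S.restrict h).e := by
      rw [← hc, mul_assoc, mul_assoc, (S.restrict h).tVal_mul_e t]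
      rfl
    rw [h6, rmul_smul, (S.restrict h).rmul_mult y]

/-- The linear form `x ↦ c` with `e x e = c e`. -/
def coeff : Γ(X, U) ⊗[k] D →ₗ[Γ(X, U)] Γ(X, U) where
  toFun x := (S.corner x).choose
  map_add' x y := by
    refine sub_eq_zero.1 (S.eq_zero_of_smul_e ?_)
    rw [sub_smul, add_smul, ← (S.corner _).choose_spec, ← (S.corner _).choose_spec,
      ← (S.corner _).choose_spec, mul_add, add_mul, sub_self]
  map_smul' a x := by
    refine sub_eq_zero.1 (S.eq_zero_of_smul_e ?_)
    rw [sub_smul, RingHom.id_apply, smul_eq_mul, mul_smul, ← (S.corner _).choose_spec,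
      ← (S.corner _).choose_spec, mul_smul_comm, smul_mul_assoc, sub_self]

theorem coeff_smul_e (x : Γ(X, U) ⊗[k] D) : S.coeff x • S.e = S.e * x * S.e :=
  (S.corner x).choose_spec.symm

theorem coeff_res {W : X.Opens} (h : W ≤ U) (x : Γ(X, U) ⊗[k] D) :
    (S.restrict h).coeff (ext D (resA h) x) = resO h (S.coeff x) := by
  refine sub_eq_zero.1 ((S.restrict h).eq_zero_of_smul_e ?_)
  rw [sub_smul, coeff_smul_e, sub_eq_zero]
  have := congrArg (ext D (resA h)) (S.coeff_smul_e x)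
  rw [ext_smul, map_mul, map_mul] at this
  exact this.symm

theorem lmul_e (t : Γ(sheafT sb, U)) : lmul S.e t = S.coeff (tVal t) • S.eT := tVal_ext (by
  rw [tVal_lmul, tVal_smul, tVal_eT, coeff_smul_e, mul_assoc, S.tVal_mul_e])

/-- The homomorphism from `𝒯` to `M` which maps `e` to a given section of `M`. -/
def homOfSection {M : X.Modules} (m : Γ(M, U)) : Γ(homSheaf (sheafT sb) M, U) :=
  evMk (fun W h =>
      { toFun := fun t => (S.restrict h).coeff (tVal t) • res M h m
        map_add' := fun t t' => by rw [tVal_add, map_add, add_smul]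
        map_smul' := fun a t => by
          rw [tVal_smul, map_smul, smul_eq_mul, mul_smul, RingHom.id_apply] })
    (fun {W W'} h h' t => by
      change (S.restrict (h'.trans h)).coeff (ext D (resA h') (tVal t)) • res M (h'.trans h) m =
        res M h' ((S.restrict h).coeff (tVal t) • res M h m)
      rw [res_smul, res_res, ← (S.restrict h).coeff_res h']
      congr 2
      refine LinearMap.ext fun x => sub_eq_zero.1 ((S.restrict (h'.trans h)).eq_zero_of_smul_e ?_)
      rw [sub_smul, coeff_smul_e, sub_eq_zero]
      have h1 : (S.restrict (h'.trans h)).e = ((S.restrict h).restrict h').e :=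
        (ext_resA_resA h h' S.e).symm
      rw [h1, coeff_smul_e])

theorem psiCounit_bijective (S : Splitting sb σ U) (M : X.Modules) :
    Function.Bijective (sec (psiCounit sb M) U) := by
  constructor
  · refine (injective_iff_map_eq_zero _).2 fun z hz => S.mult_injective ?_
    obtain ⟨g, hg⟩ : ∃ g : Γ(homSheaf (sheafT sb) M, U), sec (mult sb (psi sb M)) U z = g :=
      ⟨_, rfl⟩
    have h1 : rmul (V := psi sb M) g S.e = g := hg ▸ S.rmul_mult z
    have h2 : tmul (V := psi sb M) g S.eT = z := hg ▸ S.tmul_mult z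
    rw [← h2] at hz
    have h3 : ev g le_rfl S.eT = 0 := (psiCounit_tmul _ _).symm.trans hz
    rw [map_zero, hg]
    refine ev_ext fun W h t => ?_
    have h4 := ev_rmul_psi g S.e h t
    refine (congrArg (fun g : Γ(homSheaf (sheafT sb) M, U) => ev g h t) h1).symm.trans (h4.trans ?_)
    refine (congrArg (ev g h) ((S.restrict h).lmul_e t)).trans ?_
    rw [map_smul, ← res_eT S h, res_ev g le_rfl h, h3, map_zero, smul_zero]
    rfl
  · intro m
    refine ⟨tmul (V := psi sb M) (S.homOfSection m) S.eT, (psiCounit_tmul _ _).trans ?_⟩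
    change (S.restrict le_rfl).coeff S.e • res M le_rfl m = m
    have h1 : (S.restrict le_rfl).coeff S.e = 1 := by
      refine sub_eq_zero.1 ((S.restrict le_rfl).eq_zero_of_smul_e ?_)
      have h2 : (S.restrict le_rfl).e = S.e := ext_resA_self _ _
      rw [sub_smul, coeff_smul_e, sub_eq_zero, h2, S.e_mul_e, S.e_mul_e, one_smul]
    rw [h1, one_smul, res_self]

end Splitting

theorem LocallySplit.isIso_psiUnit (hS : LocallySplit sb σ) (V : RMod k D X) :
    IsIso (psiUnit sb V) := by
  have : IsIso (psiUnit sb V).hom := isIso_of_local _ fun x => by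
    obtain ⟨U, hx, ⟨S⟩⟩ := hS x
    exact ⟨U, hx, fun W h => (S.restrict h).psiUnit_bijective⟩
  exact RMod.isIso_of_isIso_hom _

theorem LocallySplit.isIso_psiCounit (hS : LocallySplit sb σ) (M : X.Modules) :
    IsIso (psiCounit sb M) := isIso_of_local _ fun x => by
  obtain ⟨U, hx, ⟨S⟩⟩ := hS x
  exact ⟨U, hx, fun W h => (S.restrict h).psiCounit_bijective M⟩

end Inverse

/-! ### Exactness of the functor `V ↦ V ⊗ 𝒯` -/

section Exactness

variable {X : Scheme.{u}}

/-- The sequence of sheaves `0 → L → M → N → 0` with the maps `f` and `g` is exact. -/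
structure IsExactSeq {L M N : X.Modules} (f : L ⟶ M) (g : M ⟶ N) : Prop where
  zero : f ≫ g = 0
  injective (U : X.Opens) : Function.Injective (sec f U)
  exact (U : X.Opens) (y : Γ(M, U)) (hy : sec g U y = 0) (p : X) (hp : p ∈ U) :
    ∃ (W : X.Opens) (hW : W ≤ U), p ∈ W ∧ ∃ x, sec f W x = res M hW y
  surjective (U : X.Opens) (z : Γ(N, U)) (p : X) (hp : p ∈ U) :
    ∃ (W : X.Opens) (hW : W ≤ U), p ∈ W ∧ ∃ y, sec g W y = res N hW z

theorem isSES_iff_isExactSeq {C : Type*} [Category C] (E : C ⥤ X.Modules) {L S Q : C}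
    (f : L ⟶ S) (g : S ⟶ Q) : IsSES E f g ↔ IsExactSeq (E.map f) (E.map g) := by
  constructor
  · rintro ⟨w, h⟩
    obtain ⟨h1, h2, h3⟩ := (shortExact_iff _).1 h
    exact ⟨w, h1, h2, h3⟩
  · rintro ⟨w, h1, h2, h3⟩
    exact ⟨w, (shortExact_iff _).2 ⟨h1, h2, h3⟩⟩

/-- Finitely many local conditions can be satisfied on a common neighbourhood. -/
theorem exists_common_nhd {ι : Type*} [Finite ι] {U : X.Opens} {p : X} (hp : p ∈ U)
    (P : ι → ∀ W : X.Opens, W ≤ U → Prop)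
    (hP : ∀ i (W W' : X.Opens) (h : W ≤ U) (h' : W' ≤ W), P i W h → P i W' (h'.trans h))
    (h : ∀ i, ∃ (W : X.Opens) (hW : W ≤ U), p ∈ W ∧ P i W hW) :
    ∃ (W : X.Opens) (hW : W ≤ U), p ∈ W ∧ ∀ i, P i W hW := by
  cases nonempty_fintype ι
  choose W hW hpW hPW using h
  have hle : ∀ i, U ⊓ Finset.univ.inf W ≤ W i := fun i =>
    inf_le_right.trans (Finset.inf_le (Finset.mem_univ i))
  refine ⟨U ⊓ Finset.univ.inf W, inf_le_left, ⟨hp, ?_⟩, fun i => hP i _ _ (hW i) (hle i) (hPW i)⟩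
  rw [TopologicalSpace.Opens.coe_finset_inf]
  simpa using hpW

theorem exists_common_preimage {L M : X.Modules} (f : L ⟶ M) {ι : Type*} [Finite ι] {U : X.Opens}
    {p : X} (hp : p ∈ U) (y : ι → Γ(M, U))
    (h : ∀ i, ∃ (W : X.Opens) (hW : W ≤ U), p ∈ W ∧ ∃ x, sec f W x = res M hW (y i)) :
    ∃ (W : X.Opens) (hW : W ≤ U), p ∈ W ∧ ∀ i, ∃ x, sec f W x = res M hW (y i) := by
  refine exists_common_nhd hp (fun i W hW => ∃ x, sec f W x = res M hW (y i)) ?_ h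
  rintro i W W' h h' ⟨x, hx⟩
  exact ⟨res L h' x, by rw [sec_res, hx, res_res]⟩

variable {k : Type u} [Field k] {D : Type u} [DivisionRing D] [Algebra k D]
  [FiniteDimensional k D] {n : ℕ} [X.Over (Spec (.of k))] [IsIntegral X]
  {sb : SeveriBrauer k D n X} {σ : Involution k D} {U : X.Opens} {V W Z : RMod k D X}

namespace Splitting

variable (S : Splitting sb σ U)

theorem component_res (v : Γ(V.mod, U)) (i : Fin S.m) {W : X.Opens} (h : W ≤ U) :
    res (tens sb V) h (S.component v i) = (S.restrict h).component (res V.mod h v) i := by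
  rw [component, res_tmul, res_rmul]
  rfl

theorem tensorMap_component (f : V ⟶ W) (v : Γ(V.mod, U)) (i : Fin S.m) :
    sec (tensorMap sb f) U (S.component v i) = S.component (sec f.hom U v) i := by
  rw [component, sec_tensorMap, RMod.map_rmul, component]

/-- A section is in the image of a homomorphism of right modules if its components are in the
image. -/
theorem exists_of_component (f : V ⟶ W) (w : Γ(W.mod, U))
    (h : ∀ i, ∃ x, sec (tensorMap sb f) U x = S.component w i) : ∃ v, sec f.hom U v = w := by
  choose x hx using h
  refine ⟨∑ i, rmul (sec (mult sb V) U (x i)) (S.b i), ?_⟩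
  rw [map_sum]
  conv_rhs => rw [← S.sum_component w]
  refine Finset.sum_congr rfl fun i _ => ?_
  rw [RMod.map_rmul, ← mult_map, hx]

theorem sec_tensorMap_tmul_eT (f : V ⟶ W) {v : Γ(V.mod, U)} {z : Γ(tens sb W, U)}
    (h : sec f.hom U v = sec (mult sb W) U z) : sec (tensorMap sb f) U (tmul v S.eT) = z := by
  rw [sec_tensorMap, h, S.tmul_mult]

end Splitting

/-- Tensoring with `𝒯` preserves and reflects exact sequences. -/
theorem LocallySplit.isExactSeq_iff (hS : LocallySplit sb σ) (f : V ⟶ W) (g : W ⟶ Z) :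
    IsExactSeq f.hom g.hom ↔ IsExactSeq (tensorMap sb f) (tensorMap sb g) := by
  have hloc : ∀ {U : X.Opens} {p : X}, p ∈ U →
      ∃ (U' : X.Opens) (_ : U' ≤ U), p ∈ U' ∧ Nonempty (Splitting sb σ U') := fun {U p} hp => by
    obtain ⟨U', hp', ⟨S⟩⟩ := hS p
    exact ⟨U' ⊓ U, inf_le_right, ⟨hp', hp⟩, ⟨S.restrict inf_le_left⟩⟩
  constructor
  · intro h
    refine ⟨tensor_hom_ext fun U v t => ?_, fun U => ?_, fun U y hy p hp => ?_,
      fun U z p hp => ?_⟩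
    · rw [sec_comp, sec_tensorMap, sec_tensorMap, ← sec_comp, h.zero, sec_zero, sec_zero,
        zero_tmul]
    · refine (injective_iff_map_eq_zero _).2 fun z hz => hS.mult_injective ?_
      rw [map_zero]
      refine h.injective U ?_
      rw [map_zero, ← mult_map, hz, map_zero]
    · obtain ⟨U₁, h₁, hp₁, x, hx⟩ := h.exact U (sec (mult sb W) U y)
        (by rw [← mult_map, hy, map_zero]) p hp
      obtain ⟨U₂, h₂, hp₂, ⟨S⟩⟩ := hloc hp₁
      refine ⟨U₂, h₂.trans h₁, hp₂, tmul (res V.mod h₂ x) S.eT, S.sec_tensorMap_tmul_eT f ?_⟩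
      rw [sec_res, hx, res_res, sec_res]
    · obtain ⟨U₁, h₁, hp₁, y, hy⟩ := h.surjective U (sec (mult sb Z) U z) p hp
      obtain ⟨U₂, h₂, hp₂, ⟨S⟩⟩ := hloc hp₁
      refine ⟨U₂, h₂.trans h₁, hp₂, tmul (res W.mod h₂ y) S.eT, S.sec_tensorMap_tmul_eT g ?_⟩
      rw [sec_res, hy, res_res, sec_res]
  · intro h
    have hcomp0 : ∀ {U : X.Opens} (S : Splitting sb σ U) {V : RMod k D X} (v : Γ(V.mod, U)),
        (∀ i, S.component v i = 0) → v = 0 := fun {U} S {V} v h0 => by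
      rw [← S.sum_component v]
      refine Finset.sum_eq_zero fun i _ => ?_
      rw [h0, map_zero, zero_rmul]
    have hcomp : ∀ {U : X.Opens} (S : Splitting sb σ U) {V : RMod k D X} (i),
        S.component (0 : Γ(V.mod, U)) i = 0 := fun {U} S {V} i => by
      rw [Splitting.component, zero_rmul, zero_tmul]
    refine ⟨sec_ext fun U v => ?_, fun U => ?_, fun U y hy p hp => ?_, fun U z p hp => ?_⟩
    · refine hS.eq_of_local _ fun U' hU' S => ?_
      rw [← sec_res, sec_zero, map_zero]
      refine hcomp0 S _ fun i => ?_
      rw [sec_comp, ← S.tensorMap_component, ← S.tensorMap_component, ← sec_comp, h.zero, sec_zero]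
    · refine (injective_iff_map_eq_zero _).2 fun v hv => hS.eq_of_local _ fun U' hU' S => ?_
      rw [map_zero]
      refine hcomp0 S _ fun i => h.injective U' ?_
      rw [S.tensorMap_component, sec_res, hv, map_zero, map_zero, hcomp]
    · obtain ⟨U₁, h₁, hp₁, ⟨S⟩⟩ := hloc hp
      obtain ⟨U₂, h₂, hp₂, hx⟩ := exists_common_preimage (tensorMap sb f) hp₁
        (S.component (res W.mod h₁ y)) (fun i => h.exact U₁ _ (by
          rw [S.tensorMap_component, sec_res, hy, map_zero, hcomp]) p hp₁)
      refine ⟨U₂, h₂.trans h₁, hp₂, (S.restrict h₂).exists_of_component f _ fun i => ?_⟩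
      obtain ⟨x, hx⟩ := hx i
      exact ⟨x, hx.trans ((S.component_res _ i h₂).trans
        (congrArg (fun w => (S.restrict h₂).component w i) (res_res _ _ _ _)))⟩
    · obtain ⟨U₁, h₁, hp₁, ⟨S⟩⟩ := hloc hp
      obtain ⟨U₂, h₂, hp₂, hx⟩ := exists_common_preimage (tensorMap sb g) hp₁
        (S.component (res Z.mod h₁ z)) (fun i => h.surjective U₁ _ p hp₁)
      refine ⟨U₂, h₂.trans h₁, hp₂, (S.restrict h₂).exists_of_component g _ fun i => ?_⟩
      obtain ⟨x, hx⟩ := hx i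
      exact ⟨x, hx.trans ((S.component_res _ i h₂).trans
        (congrArg (fun w => (S.restrict h₂).component w i) (res_res _ _ _ _)))⟩

end Exactness

/-! ### The equivalence, and its compatibility with the dualities -/

section Assembly

variable {k : Type u} [Field k] {D : Type u} [DivisionRing D] [Algebra k D]
  [FiniteDimensional k D] {n : ℕ} {X : Scheme.{u}} [X.Over (Spec (.of k))] [IsIntegral X]
  {sb : SeveriBrauer k D n X} {σ : Involution k D}

/-- The dual `V♯` is isomorphic to `Hom(𝒯, Hom(V ⊗ 𝒯, ℒ_σ))`, hence locally free. -/
theorem LocallySplit.isLocFree_sharp (hS : LocallySplit sb σ) {V : RMod k D X}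
    (hV : IsLocFree V.mod) : IsLocFree (sharp σ V).mod := by
  have h1 : IsLocFree (tens sb (sharp σ V)) := by
    have := hS.isIso_theta V
    exact (IsLocFree.homSheaf (hS.isLocFree_tensor hV) hS.sheafL_isLocFree).of_isIso
      (inv (theta sb σ V))
  have := hS.isIso_psiUnit (sharp σ V)
  have h2 : IsIso (psiUnit sb (sharp σ V)).hom :=
    inferInstanceAs (IsIso ((RMod.forget k D X).map (psiUnit sb (sharp σ V))))
  exact (IsLocFree.homSheaf hS.sheafT_isLocFree h1).of_isIso (inv (psiUnit sb (sharp σ V)).hom)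

variable (hten : ∀ V : ModD X k D,
  IsLocFree ((tensorFunctor (sheafT sb) (leftAct sb)).obj V.obj))

/-- The functor `V ↦ V ⊗ 𝒯` between the categories of locally free modules. -/
abbrev tensorEquiv : ModD X k D ⥤ ModX X :=
  IsLocFree.lift ((IsLocFreeD k D).ι ⋙ tensorFunctor (sheafT sb) (leftAct sb)) hten

instance : (tensorEquiv hten).Additive where
  map_add {V W f g} := by
    have := tensorFunctor_additive (k := k) (D := D) (T := sheafT sb) (l := leftAct sb)
    apply ObjectProperty.hom_ext
    exact (tensorFunctor (sheafT sb) (leftAct sb)).map_add (f := f.hom) (g := g.hom)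

theorem tensorMap_comp {V W Z : RMod k D X} (f : V ⟶ W) (g : W ⟶ Z) :
    tensorMap sb (f ≫ g) = tensorMap sb f ≫ tensorMap sb g :=
  (tensorFunctor (sheafT sb) (leftAct sb)).map_comp f g

/-- The functor `V ↦ V ⊗ 𝒯` is faithful, by naturality of the unit. -/
theorem LocallySplit.tensorMap_injective (hS : LocallySplit sb σ) {V W : RMod k D X}
    {f g : V ⟶ W} (h : tensorMap sb f = tensorMap sb g) : f = g := by
  have := hS.isIso_psiUnit W
  rw [← cancel_mono (psiUnit sb W), ← psiUnit_naturality, ← psiUnit_naturality, h]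

/-- The functor `V ↦ V ⊗ 𝒯` is full: by the triangle identity, `h` is the image of the morphism
which corresponds to `Hom(𝒯, h)` under the units. -/
theorem LocallySplit.tensorMap_surjective (hS : LocallySplit sb σ) {V W : RMod k D X}
    (h : tens sb V ⟶ tens sb W) : ∃ f : V ⟶ W, tensorMap sb f = h := by
  have := hS.isIso_psiUnit W
  obtain ⟨f, hf⟩ : ∃ f : V ⟶ W, f ≫ psiUnit sb W = psiUnit sb V ≫ psiMap h :=
    ⟨(psiUnit sb V ≫ psiMap h) ≫ inv (psiUnit sb W), by simp⟩
  refine ⟨f, ?_⟩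
  have h1 := congrArg (fun q => tensorMap sb q ≫ psiCounit sb (tens sb W)) hf
  simp only [tensorMap_comp, Category.assoc] at h1
  rw [tensorMap_psiUnit_psiCounit, psiCounit_naturality, ← Category.assoc,
    tensorMap_psiUnit_psiCounit, Category.comp_id, Category.id_comp] at h1
  exact h1

theorem LocallySplit.tensorEquiv_faithful (hS : LocallySplit sb σ) :
    (tensorEquiv hten).Faithful where
  map_injective {V W f g} h := by
    apply ObjectProperty.hom_ext
    exact hS.tensorMap_injective (congrArg (fun q => q.hom) h)

theorem LocallySplit.tensorEquiv_full (hS : LocallySplit sb σ) : (tensorEquiv hten).Full where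
  map_surjective {V W} h := by
    obtain ⟨f, hf⟩ := hS.tensorMap_surjective h.hom
    refine ⟨ObjectProperty.homMk f, ?_⟩
    apply ObjectProperty.hom_ext
    exact hf

theorem LocallySplit.tensorEquiv_essSurj (hS : LocallySplit sb σ) :
    (tensorEquiv hten).EssSurj where
  mem_essImage M := by
    refine ⟨⟨psi sb M.obj, IsLocFree.homSheaf hS.sheafT_isLocFree M.property⟩, ⟨?_⟩⟩
    exact IsLocFree.isoMk (@asIso _ _ _ _ (psiCounit sb M.obj) (hS.isIso_psiCounit M.obj))

theorem LocallySplit.tensorEquiv_isSES (hS : LocallySplit sb σ) {L M N : ModD X k D}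
    (f : L ⟶ M) (g : M ⟶ N) : IsSES ((IsLocFreeD k D).ι ⋙ RMod.forget k D X) f g ↔
      IsSES (IsLocFree (X := X)).ι ((tensorEquiv hten).map f) ((tensorEquiv hten).map g) := by
  rw [isSES_iff_isExactSeq, isSES_iff_isExactSeq]
  exact hS.isExactSeq_iff f.hom g.hom

variable (hsharp : ∀ V : RMod k D X, IsLocFreeD k D V →
    IsLocFreeD k D ((sharpDuality σ).dual.obj (op V)))
  (hstar : ∀ M : X.Modules, IsLocFree M →
    IsLocFree ((starDuality (sheafL sb σ.map)).dual.obj (op M)))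

/-- The isomorphism `θ` in the category of locally free modules. -/
def thetaIso (hS : LocallySplit sb σ) (V : (ModD X k D)ᵒᵖ) :
    (((sharpDuality σ).neg.restrict (IsLocFreeD (X := X) k D) hsharp).dual ⋙
      tensorEquiv hten).obj V ≅ ((tensorEquiv hten).op ⋙
        ((starDuality (sheafL sb σ.map)).restrict IsLocFree hstar).dual).obj V :=
  IsLocFree.isoMk (@asIso _ _ _ _ (theta sb σ V.unop.obj) (hS.isIso_theta V.unop.obj))

/-- The isomorphisms `θ`, with their compatibility with the dualities. -/
def thetaPreserving (hS : LocallySplit sb σ)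
    (hL : ∀ (U : X.Opens) (s : Γ(sheafL sb σ.map, U)), σ.onExt _ (lVal s) = - lVal s) :
    DualityPreserving (tensorEquiv hten)
      ((sharpDuality σ).neg.restrict (IsLocFreeD (X := X) k D) hsharp)
      ((starDuality (sheafL sb σ.map)).restrict IsLocFree hstar) where
  θ := NatIso.ofComponents (thetaIso hten hsharp hstar hS)
    (fun f => ObjectProperty.hom_ext _ (theta_naturality (sb := sb) (σ := σ) f.unop.hom))
  comm V := ObjectProperty.hom_ext _ (theta_comm (V := V.obj) hL)

end Assembly

end

end SBWitt

theorem proposition3p2 {k : Type u} [Field k] (hk : ringChar k ≠ 2)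
    {D : Type u} [DivisionRing D] [Algebra k D] [FiniteDimensional k D] [Algebra.IsCentral k D]
    (n d : ℕ) (hd : 1 ≤ d) (hn : n = 2 ^ d) (hD : Module.finrank k D = n ^ 2)
    (σ : Involution k D) (hσ : σ.IsSymplectic n)
    (X : Scheme.{u}) [X.Over (Spec (.of k))] [IsIntegral X] (sb : SeveriBrauer k D n X) :
    ∃ (hsharp : ∀ V : RMod k D X, IsLocFreeD k D V →
        IsLocFreeD k D ((sharpDuality σ).dual.obj (op V)))
      (hstar : ∀ M : X.Modules, IsLocFree M →
        IsLocFree ((starDuality (sheafL sb σ.map)).dual.obj (op M)))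
      (hten : ∀ V : ModD X k D,
        IsLocFree ((tensorFunctor (sheafT sb) (leftAct sb)).obj V.obj)),
      let δD : Duality (ModD X k D) := (sharpDuality σ).neg.restrict (IsLocFreeD k D) hsharp
      let δX : Duality (ModX X) := (starDuality (sheafL sb σ.map)).restrict IsLocFree hstar
      let Θ : ModD X k D ⥤ ModX X :=
        IsLocFree.lift ((IsLocFreeD k D).ι ⋙ tensorFunctor (sheafT sb) (leftAct sb)) hten
      δD.IsStrong ∧ δX.IsStrong ∧ Θ.IsEquivalence ∧
      ∃ Φ : DualityPreserving Θ δD δX,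
        (∀ (V : ModD X k D) (U : X.Opens) (f : Γ(sharpSheaf V.obj, U)) (y : Γ(V.obj.mod, U))
            (t t' : Γ(sheafT sb, U)),
          interVal (ev (M := tensorSheaf V.obj (sheafT sb) (leftAct sb)) (N := sheafL sb σ.map)
            (sec (Φ.θ.hom.app (op V)).hom U
              (tmul (V := sharp σ V.obj) (l := leftAct sb) f t)) le_rfl (tmul y t')) =
          σ.onExt _ (interVal t) * sharpEv f le_rfl y * interVal t') ∧
        ∃ Mor : WittGroup δD ((IsLocFreeD k D).ι ⋙ RMod.forget k D X) ≃+
            WittGroup δX (IsLocFree (X := X)).ι,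
          ∀ S : Space δD, Mor (.mk _ S) = .mk _ (Φ.mapSpace S) := by
  have hn0 : n ≠ 0 := by rw [hn]; positivity
  have hS : LocallySplit sb σ := exists_splitting hn0 hD sb σ
  have hL : ∀ (U : X.Opens) (s : Γ(sheafL sb σ.map, U)), σ.onExt _ (lVal s) = - lVal s :=
    fun U s => onExt_lVal hn0 hk hσ hS s
  have hsharp : ∀ V : RMod k D X, IsLocFreeD k D V →
      IsLocFreeD k D ((sharpDuality σ).dual.obj (op V)) := fun V hV => hS.isLocFree_sharp hV
  have hstar : ∀ M : X.Modules, IsLocFree M →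
      IsLocFree ((starDuality (sheafL sb σ.map)).dual.obj (op M)) := fun M hM =>
    IsLocFree.homSheaf hM hS.sheafL_isLocFree
  have hten : ∀ V : ModD X k D,
      IsLocFree ((tensorFunctor (sheafT sb) (leftAct sb)).obj V.obj) := fun V =>
    hS.isLocFree_tensor V.property
  have hfaith := hS.tensorEquiv_faithful hten
  have hfull := hS.tensorEquiv_full hten
  have hess := hS.tensorEquiv_essSurj hten
  have hstrong : ((starDuality (sheafL sb σ.map)).restrict IsLocFree hstar).IsStrong := fun M => by
    have h1 : IsIso ((starDuality (sheafL sb σ.map)).can.app M.obj) :=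
      isIso_starDuality_can M.property fun x => by
        obtain ⟨U, hx, ⟨S⟩⟩ := hS x
        exact ⟨U, S.uL, hx, S.isBasisOn_uL⟩
    exact (ObjectProperty.isoMk IsLocFree (X := M) (Y := ((starDuality (sheafL sb σ.map)).restrict
      IsLocFree hstar).dual.obj (op (((starDuality (sheafL sb σ.map)).restrict
        IsLocFree hstar).dual.obj (op M))))
      (@asIso _ _ _ _ ((starDuality (sheafL sb σ.map)).can.app M.obj) h1)).isIso_hom
  let Φ := thetaPreserving hten hsharp hstar hS hL
  refine ⟨hsharp, hstar, hten, fun V => ?_, hstrong, { }, Φ, fun V U f y t t' => ?_, ?_⟩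
  -- `Θ(-π)` is an isomorphism by the compatibility of `θ` with the dualities
  · have h1 := Φ.comm V
    have h2 : IsIso ((tensorEquiv hten).map
        (((sharpDuality σ).neg.restrict (IsLocFreeD k D) hsharp).can.app V)) := by
      rw [← IsIso.eq_comp_inv] at h1
      rw [h1]
      have := hstrong ((tensorEquiv hten).obj V)
      infer_instance
    exact isIso_of_fully_faithful (tensorEquiv hten) _
  · have h1 := congrArg (fun g => lVal (ev (M := tens sb V.obj) (N := sheafL sb σ.map) g le_rfl
      (tmul y t'))) (theta_tmul (sb := sb) (σ := σ) (V := V.obj) f t)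
    refine h1.trans ?_
    refine (lVal_ev_thetaHom (V := V.obj) f t le_rfl _).trans ?_
    rw [mult_tmul, sharpEv_rmul, ext_resA_self, ← mul_assoc]
    rfl
  · exact Φ.exists_wittEquiv fun f g => hS.tensorEquiv_isSES hten f g
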